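/- Let $\mathcal M$ be the set of discrete random variables, i.e. of Lebesgue measurable functions from $[0,1]$ (with Lebesgue measure) to $\mathbb N_+=\{1,2,\dots\}$, regarded as a structure with one binary relation, probabilistic independence $\perp\!\!\!\perp$. FOTPI is the complete first-order theory $\mathrm{Th}(\mathcal M,\perp\!\!\!\perp)$. For $X\in\mathcal M$ let $|\mathcal X|\in\{1,2,\dots,\infty\}$ be the number of values $x$ with $P(X=x)>0$; $X\sim\mathrm{Unif}[k]$ and $X\sim\mathrm{Bern}(\theta)$ are always meant up to relabelling of the values, and "uniform" means $\mathrm{Unif}[k]$ for some $k\in\mathbb N_+$. Write $X\stackrel{\iota}{\le}Y$ if $X$ is almost surely a function of $Y$, $X\stackrel{\iota}{=}Y$ if also $Y\stackrel{\iota}{\le}X$, $X\stackrel{\iota}{<}Y$ if $X\stackrel{\iota}{\le}Y$ but not $Y\stackrel{\iota}{\le}X$, and $XY$ for the joint random variable. These notions are first-order expressible: $X\stackrel{\iota}{\le}Y$ by $\forall U(U\perp\!\!\!\perp Y\to U\perp\!\!\!\perp X)$, $XY$ as the join for $\stackrel{\iota}{\le}$, $X\stackrel{\iota}{=}\emptyset$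 (degenerate) by $X\perp\!\!\!\perp X$, and mutual independence $X\perp\!\!\!\perp Y\perp\!\!\!\perp Z$ by $Y\perp\!\!\!\perp X\wedge Z\perp\!\!\!\perp XY$. Consider the following formulas, built from $\perp\!\!\!\perp$, the logical connectives and the quantifiers, without the equality symbol: - $\mathrm{triple}(X,Y,Z)$: $X\stackrel{\iota}{\le}YZ$, $Y\stackrel{\iota}{\le}XZ$, $Z\stackrel{\iota}{\le}XY$, and $X,Y,Z$ are pairwise independent; $\mathrm{unif}(X):=\exists Y,Z\,\mathrm{triple}(X,Y,Z)$. - $\mathrm{card}_{\le0}:=\bot$, $\mathrm{card}_{\le1}(X):=(X\stackrel{\iota}{=}\emptyset)$, $\mathrm{card}_{\le k}(X):=\forall U(U\stackrel{\iota}{<}X\to\mathrm{card}_{\le k-1}(U))$ for $k\ge2$; $\mathrm{card}_{=k}:=\mathrm{card}_{\le k}\wedge\neg\mathrm{card}_{\le k-1}$ for $k\ge1$ and $\mathrm{card}_{=0}:=\bot$; $\mathrm{ueq}_k:=\mathrm{unif}\wedge\mathrm{card}_{=k}$. - $\mathrm{ueq}(X,Y):=\exists U_1,U_2,U_3(\mathrm{triple}(X,U_1,U_2)\wedge\mathrm{triple}(Y,U_1,U_3))$.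 - $\mathrm{uprod}(X,Y,Z):=\exists\tilde X,\tilde Y(\mathrm{ueq}(X,\tilde X)\wedge\mathrm{ueq}(Y,\tilde Y)\wedge\tilde X\perp\!\!\!\perp\tilde Y\wedge\tilde X\tilde Y\stackrel{\iota}{=}Z)$. - $\mathrm{ule}(X,Y):=\exists G,\tilde Y(\mathrm{uprod}(X,Y,G)\wedge\mathrm{ueq}(Y,\tilde Y)\wedge G\stackrel{\iota}{\le}Y\tilde Y)$; $\mathrm{ult}(X,Y):=\neg\,\mathrm{ule}(Y,X)$. - $\mathrm{smi}(X,Y):=(X\stackrel{\iota}{=}Y\stackrel{\iota}{=}\emptyset)\vee\big(Y\stackrel{\iota}{\le}X\wedge\mathrm{card}_{=2}(Y)\wedge\forall U(U\stackrel{\iota}{\le}X\wedge\mathrm{card}_{=4}(U)\to\neg\exists V(\mathrm{card}_{\le2}(V)\wedge U\stackrel{\iota}{\le}YV))\big)$. - $\mathrm{frac}(X,Y,Z,U):=\big(\mathrm{ueq}_2(U)\wedge\mathrm{uprod}(X,U,Z)\wedge\mathrm{uprod}(Y,U,Z)\big)\vee\exists\tilde X,\tilde Y\big(\mathrm{ueq}(X,\tilde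 X)\wedge\mathrm{ueq}(Y,\tilde Y)\wedge\mathrm{unif}(Z)\wedge\mathrm{card}_{=2}(U)\wedge\neg\mathrm{unif}(U)\wedge U\stackrel{\iota}{\le}Z\wedge\tilde X\perp\!\!\!\perp\tilde Y\perp\!\!\!\perp U\wedge Z\stackrel{\iota}{\le}\tilde X\tilde YU\wedge\forall V(\mathrm{smi}(Z,V)\to\mathrm{smi}(\tilde XU,V)\vee\mathrm{smi}(\tilde YU,V))\big)$; $\mathrm{usum}(X,Y,Z):=\exists U\,\mathrm{frac}(X,Y,Z,U)$. - $\mathrm{is0}(X):=\exists U(\mathrm{ueq}_3(U)\wedge\emptyset\stackrel{\iota}{<}X\stackrel{\iota}{<}U)$; $\mathrm{isnat}(X):=\mathrm{is0}(X)\vee\mathrm{unif}(X)$. - $\mathrm{natEq}(X,Y):=(\mathrm{is0}(X)\wedge\mathrm{is0}(Y))\vee\mathrm{ueq}(X,Y)$; $\mathrm{natAdd}(X,Y,Z):=(\mathrm{is0}(X)\wedge\mathrm{isnat}(Y)\wedge\mathrm{natEq}(Y,Z))\vee(\mathrm{is0}(Y)\wedge\mathrm{isnat}(X)\wedge\mathrm{natEq}(X,Z))\vee\mathrm{usum}(X,Y,Z)$;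 $\mathrm{natMul}(X,Y,Z):=(\mathrm{is0}(X)\wedge\mathrm{isnat}(Y)\wedge\mathrm{is0}(Z))\vee(\mathrm{is0}(Y)\wedge\mathrm{isnat}(X)\wedge\mathrm{is0}(Z))\vee\mathrm{uprod}(X,Y,Z)$; $\mathrm{natLt}(X,Y):=(\mathrm{is0}(X)\wedge\mathrm{unif}(Y))\vee(\mathrm{unif}(X)\wedge\mathrm{unif}(Y)\wedge\mathrm{ult}(X,Y))$. Then the following hold. 1. (Definability.) For all $X,Y,Z,U\in\mathcal M$ and $k\in\mathbb N_0$: - $\mathrm{unif}(X)$ holds iff $X$ is uniform; $\mathrm{card}_{\le k}(X)$ iff $|\mathcal X|\le k$; $\mathrm{card}_{=k}(X)$ iff $|\mathcal X|=k$; $\mathrm{ueq}_k(X)$ iff $k\ge1$ and $X\sim\mathrm{Unif}[k]$; - $\mathrm{ueq}(X,Y)$ iff $X,Y$ are uniform and $|\mathcal X|=|\mathcal Y|$; $\mathrm{uprod}(X,Y,Z)$ iff $X,Y,Z$ are uniform and $|\mathcal Z|=|\mathcal X||\mathcal Y|$; $\mathrm{ule}(X,Y)$ iff $X,Y$ are uniform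 and $|\mathcal X|\le|\mathcal Y|$; and, if $X,Y$ are uniform, $\mathrm{ult}(X,Y)$ iff $|\mathcal X|<|\mathcal Y|$; - $\mathrm{smi}(X,Y)$ iff $Y\stackrel{\iota}{=}\mathbf 1_{\{x\}}(X)$ for some $x$ with $P(X=x)>0$; - $\mathrm{frac}(X,Y,Z,U)$ iff $X,Y,Z$ are uniform, $|\mathcal Z|=|\mathcal X|+|\mathcal Y|$, $U\sim\mathrm{Bern}(|\mathcal X|/(|\mathcal X|+|\mathcal Y|))$, and ($|\mathcal X|=|\mathcal Y|$ or $U\stackrel{\iota}{\le}Z$); - $\mathrm{usum}(X,Y,Z)$ iff $X,Y,Z$ are uniform and $|\mathcal Z|=|\mathcal X|+|\mathcal Y|$; - $\mathrm{is0}(X)$ iff $X\sim\mathrm{Bern}(1/3)$; $\mathrm{isnat}(X)$ iff $X\sim\mathrm{Bern}(1/3)$ or $X$ is uniform. 2. (Interpretation.) The formulas $\mathrm{isnat}$ (domain), $\mathrm{natEq}$ (equality), $\mathrm{natAdd}$, $\mathrm{natMul}$ (graphs of addition and multiplication) and $\mathrm{natLt}$ (order) interpret $(\mathbb N_0,+,\cdot,<)$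 in $(\mathcal M,\perp\!\!\!\perp)$: there is a surjection $c$ from $\{X\in\mathcal M:\mathrm{isnat}(X)\}$ onto $\mathbb N_0$ under which these formulas correspond to $=,+,\cdot,<$; moreover $c(X)=0$ iff $X\sim\mathrm{Bern}(1/3)$, and for $n\ge1$, $c(X)=n$ iff $X\sim\mathrm{Unif}[n]$. Consequently true arithmetic $\mathrm{Th}(\mathbb N_0,+,\cdot,<)$ is interpretable in FOTPI: a sentence $\sigma$ of arithmetic is true in $\mathbb N_0$ if and only if its translation along these formulas (atomic formulas unnested, quantifiers relativized to $\mathrm{isnat}$) belongs to FOTPI. 3. FOTPI is undecidable, and it is not arithmetically definable: the set of Gödel numbers of its sentences is neither computable nor first-order definable in $(\mathbb N_0,+,\cdot,<)$. Both also hold for the set of those sentences of FOTPI that do not contain the equality symbol. -/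

import Mathlib

open FirstOrder FirstOrder.Language MeasureTheory ProbabilityTheory
open scoped FirstOrder

namespace FOTPI

/-! ## Discrete random variables on the standard probability space -/

instance : MeasurableSpace ℕ+ := ⊤

/-- The sample space `[0,1]`; `volume` on it is Lebesgue measure. -/
abbrev Ω : Type := unitInterval

/-- A discrete random variable: a Lebesgue measurable function from `[0,1]`, with Lebesgue
measure, to the positive integers. (`NullMeasurable` is measurability for the completed
σ-algebra, that is, Lebesgue measurability.) -/
def RV : Type := {X : Ω → ℕ+ // NullMeasurable X (volume : Measure Ω)}

instance : CoeFun RV (fun _ => Ω → ℕ+) := ⟨Subtype.val⟩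

namespace RV

/-- The probability mass `P(X = a)`. -/
noncomputable def pmf (X : RV) (a : ℕ+) : ℝ := (volume : Measure Ω).real (X ⁻¹' {a})

/-- The support of `X`, i.e. the set of values of positive probability. -/
def supp (X : RV) : Set ℕ+ := {a | 0 < X.pmf a}

/-- The cardinality of (the support of) `X`, possibly infinite. -/
noncomputable def card (X : RV) : ℕ∞ := X.supp.encard

/-- `X` is uniformly distributed over a set of `n` values, i.e. `X ∼ Unif[n]` up to
relabelling. -/
def IsUnif (X : RV) (n : ℕ) : Prop := X.card = n ∧ ∀ a ∈ X.supp, X.pmf a = 1 / n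

/-- `X ∼ Bern(θ)` up to relabelling. -/
def IsBern (X : RV) (θ : ℝ) : Prop := ∃ a b : ℕ+, a ≠ b ∧ X.pmf a = θ ∧ X.pmf b = 1 - θ

end RV

/-- `X` is almost surely a function of `Y`. -/
def FunctionOf {α β : Type} (X : Ω → α) (Y : Ω → β) : Prop :=
  ∃ f : β → α, ∀ᵐ ω ∂(volume : Measure Ω), X ω = f (Y ω)

/-- Informational equivalence: each of `X`, `Y` is almost surely a function of the other. -/
def InfoEquiv {α β : Type} (X : Ω → α) (Y : Ω → β) : Prop := FunctionOf X Y ∧ FunctionOf Y X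

open Classical in
/-- `Y` is a single-mass indicator of `X`: it is informationally equivalent to the indicator of
`{X = a}` for some value `a` of positive probability. -/
def IsSingleMassIndicator (X Y : RV) : Prop :=
  ∃ a ∈ X.supp, InfoEquiv Y (fun ω => if X ω = a then (1 : ℕ) else 0)

/-! ## The first-order theory of probabilistic independence -/

/-- The only non-logical symbol is the binary relation symbol `⊥⊥`. -/
inductive IndepRel : ℕ → Type
  | indep : IndepRel 2

/-- The first-order language of probabilistic independence. -/
def indepLang : FirstOrder.Language.{0, 0} := ⟨fun _ => Empty, IndepRel⟩

/-- The symbol `⊥⊥`. -/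
abbrev indepSym : indepLang.Relations 2 := IndepRel.indep

instance : indepLang.Structure RV where
  funMap f := nomatch f
  RelMap {k} R v := match k, R, v with
    | _, IndepRel.indep, v => IndepFun (v 0) (v 1) (volume : Measure Ω)

/-- Formulas in the variables `0, …, n - 1`, with no other free variables. -/
abbrev Fml (n : ℕ) : Type := indepLang.BoundedFormula Empty n

/-- `φ.Holds v`: the formula `φ` is true in the structure of random variables when its variables
are assigned the random variables `v 0, …, v (n - 1)`. -/
def Holds {n : ℕ} (φ : Fml n) (v : Fin n → RV) : Prop := φ.Realize default v

/-- A formula without the equality symbol. -/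
def EqFree {L : FirstOrder.Language.{0, 0}} {α : Type} : ∀ {n : ℕ}, L.BoundedFormula α n → Prop
  | _, .falsum => True
  | _, .equal _ _ => False
  | _, .rel _ _ => True
  | _, .imp φ ψ => EqFree φ ∧ EqFree ψ
  | _, .all φ => EqFree φ

/-- FOTPI: the complete theory of the structure of random variables. -/
def theory : Set indepLang.Sentence := indepLang.completeTheory RV

/-- The sentences of FOTPI whose only atomic formulas are independence statements. -/
def pureTheory : Set indepLang.Sentence := {σ ∈ theory | EqFree σ}

/-! ### Formulas

Each formula below is given for arbitrary variables `x y z …` among `0, …, n - 1`. A quantifier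
binds the variable with the next index, and `up x` is the variable `x` seen below one more
quantifier. -/

abbrev up {n : ℕ} (x : Fin n) : Fin (n + 1) := x.castSucc

def ex {n : ℕ} (φ : Fin (n + 1) → Fml (n + 1)) : Fml n := (φ (Fin.last n)).ex

def all {n : ℕ} (φ : Fin (n + 1) → Fml (n + 1)) : Fml n := (φ (Fin.last n)).all

/-- `x ⊥⊥ y`. -/
def ind {n : ℕ} (x y : Fin n) : Fml n :=
  Relations.boundedFormula₂ (L := indepLang) indepSym (&x) (&y)

/-- `x` is degenerate (almost surely constant): `x ⊥⊥ x`. -/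
def const {n : ℕ} (x : Fin n) : Fml n := ind x x

/-- `x ≤ y`: `x` is a function of `y`. -/
def le {n : ℕ} (x y : Fin n) : Fml n := all fun u => (ind u (up y)).imp (ind u (up x))

/-- Informational equivalence. -/
def equiv {n : ℕ} (x y : Fin n) : Fml n := le x y ⊓ le y x

/-- `x` has strictly less information than `y`. -/
def lt {n : ℕ} (x y : Fin n) : Fml n := le x y ⊓ (le y x).not

/-- `z` is equivalent to the joint random variable `xy`. -/
def joint {n : ℕ} (x y z : Fin n) : Fml n :=
  le x z ⊓ le y z ⊓ all fun u => (le (up x) u ⊓ le (up y) u).imp (le (up z) u)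

/-- `x ≤ yz`. -/
def leJoint {n : ℕ} (x y z : Fin n) : Fml n :=
  ex fun w => joint (up y) (up z) w ⊓ le (up x) w

/-- `x ≤ abc`. -/
def leJoint₃ {n : ℕ} (x a b c : Fin n) : Fml n :=
  ex fun w => joint (up a) (up b) w ⊓ leJoint (up x) w (up c)

/-- `x ⊥⊥ y ⊥⊥ z` (mutual independence). -/
def ind₃ {n : ℕ} (x y z : Fin n) : Fml n :=
  ind y x ⊓ ex fun w => joint (up x) (up y) w ⊓ ind (up z) w

def triple {n : ℕ} (x y z : Fin n) : Fml n :=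
  leJoint x y z ⊓ leJoint y x z ⊓ leJoint z x y ⊓ ind x y ⊓ ind x z ⊓ ind y z

def unif {n : ℕ} (x : Fin n) : Fml n := ex fun y => ex fun z => triple (up (up x)) (up y) z

/-- The cardinality of `x` is at most `k`. -/
def cardLE : ℕ → ∀ {n : ℕ}, Fin n → Fml n
  | 0, _, _ => ⊥
  | 1, _, x => const x
  | k + 2, _, x => all fun u => (lt u (up x)).imp (cardLE (k + 1) u)

/-- The cardinality of `x` is `k`. -/
def cardEq (k : ℕ) {n : ℕ} (x : Fin n) : Fml n := cardLE k x ⊓ (cardLE (k - 1) x).not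

def ueq {n : ℕ} (x y : Fin n) : Fml n :=
  ex fun u => ex fun v => ex fun w =>
    triple (up (up (up x))) (up (up u)) (up v) ⊓ triple (up (up (up y))) (up (up u)) w

def ueqConst (k : ℕ) {n : ℕ} (x : Fin n) : Fml n := unif x ⊓ cardEq k x

def uprod {n : ℕ} (x y z : Fin n) : Fml n :=
  ex fun a => ex fun b =>
    ueq (up (up x)) (up a) ⊓ ueq (up (up y)) b ⊓ ind (up a) b ⊓ joint (up a) b (up (up z))

def ule {n : ℕ} (x y : Fin n) : Fml n :=
  ex fun g => ex fun b =>
    uprod (up (up x)) (up (up y)) (up g) ⊓ ueq (up (up y)) b ⊓ leJoint (up g) (up (up y)) b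

def ult {n : ℕ} (x y : Fin n) : Fml n := (ule y x).not

/-- `y` is a single-mass indicator of `x`. -/
def smi {n : ℕ} (x y : Fin n) : Fml n :=
  (equiv x y ⊓ const y) ⊔
    (le y x ⊓ cardEq 2 y ⊓
      all fun u => (le u (up x) ⊓ cardEq 4 u).imp
        (ex fun v => cardLE 2 v ⊓ leJoint (up u) (up (up y)) v).not)

/-- `v` is a single-mass indicator of the joint random variable `xu`. -/
def smiJoint {n : ℕ} (x u v : Fin n) : Fml n :=
  ex fun w => joint (up x) (up u) w ⊓ smi w (up v)

def frac {n : ℕ} (x y z u : Fin n) : Fml n :=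
  (ueqConst 2 u ⊓ uprod x u z ⊓ uprod y u z) ⊔
    ex fun a => ex fun b =>
      ueq (up (up x)) (up a) ⊓ ueq (up (up y)) b ⊓ unif (up (up z)) ⊓
      cardEq 2 (up (up u)) ⊓ (unif (up (up u))).not ⊓
      le (up (up u)) (up (up z)) ⊓ ind₃ (up a) b (up (up u)) ⊓
      leJoint₃ (up (up z)) (up a) b (up (up u)) ⊓
      all fun v => (smi (up (up (up z))) v).imp
        (smiJoint (up (up a)) (up (up (up u))) v ⊔ smiJoint (up b) (up (up (up u))) v)

def usum {n : ℕ} (x y z : Fin n) : Fml n := ex fun u => frac (up x) (up y) (up z) u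

/-- `x` represents the integer `0`. -/
def is0 {n : ℕ} (x : Fin n) : Fml n :=
  ex fun u => ueqConst 3 u ⊓ (const (up x)).not ⊓ lt (up x) u

/-- `x` represents a nonnegative integer. -/
def isnat {n : ℕ} (x : Fin n) : Fml n := is0 x ⊔ unif x

def natEq {n : ℕ} (x y : Fin n) : Fml n := (is0 x ⊓ is0 y) ⊔ ueq x y

def natAdd {n : ℕ} (x y z : Fin n) : Fml n :=
  (is0 x ⊓ isnat y ⊓ natEq y z) ⊔ (is0 y ⊓ isnat x ⊓ natEq x z) ⊔ usum x y z

def natMul {n : ℕ} (x y z : Fin n) : Fml n :=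
  (is0 x ⊓ isnat y ⊓ is0 z) ⊔ (is0 y ⊓ isnat x ⊓ is0 z) ⊔ uprod x y z

def natLt {n : ℕ} (x y : Fin n) : Fml n :=
  (is0 x ⊓ unif y) ⊔ (unif x ⊓ unif y ⊓ ult x y)

/-! ## True arithmetic -/

inductive ArithFun : ℕ → Type
  | add : ArithFun 2
  | mul : ArithFun 2

inductive ArithRel : ℕ → Type
  | lt : ArithRel 2

/-- The first-order language with symbols `+`, `·`, `<`. -/
def arithLang : FirstOrder.Language.{0, 0} := ⟨ArithFun, ArithRel⟩

instance : arithLang.Structure ℕ where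
  funMap {k} f v := match k, f, v with
    | _, ArithFun.add, v => v 0 + v 1
    | _, ArithFun.mul, v => v 0 * v 1
  RelMap {k} R v := match k, R, v with
    | _, ArithRel.lt, v => v 0 < v 1

/-- True arithmetic `Th(ℕ₀, +, ·, <)`. -/
def trueArithmetic : Set arithLang.Sentence := arithLang.completeTheory ℕ

/-! ## Interpretations -/

/-- The formulas of a (one-dimensional, parameter-free) interpretation of a language `L'` in a
language `L`: the domain, the equivalence relation that interprets equality, the graphs of the
functions (the value is the last variable), and the relations. -/
structure Interpretation (L' L : FirstOrder.Language.{0, 0}) where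
  dom : L.BoundedFormula Empty 1
  eqv : L.BoundedFormula Empty 2
  fn : ∀ {k : ℕ}, L'.Functions k → L.BoundedFormula Empty (k + 1)
  rel : ∀ {k : ℕ}, L'.Relations k → L.BoundedFormula Empty k

namespace Interpretation

variable {L' L : FirstOrder.Language.{0, 0}} (Γ : Interpretation L' L)

/-- All the formulas of the interpretation are without the equality symbol. -/
def IsEqFree : Prop :=
  EqFree Γ.dom ∧ EqFree Γ.eqv ∧ (∀ {k : ℕ} (f : L'.Functions k), EqFree (Γ.fn f)) ∧
    ∀ {k : ℕ} (R : L'.Relations k), EqFree (Γ.rel R)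

/-- The elements of `M` that satisfy the domain formula. -/
abbrev Dom (M : Type) [L.Structure M] : Type := {x : M // Γ.dom.Realize default ![x]}

/-- `c` is a coordinate map of an interpretation of the structure `N` in the structure `M`: it
induces an isomorphism onto `N` from the structure that the formulas define on the quotient of
the domain by the equivalence formula. -/
def IsCoordinateMap {M N : Type} [L.Structure M] [L'.Structure N] (c : Γ.Dom M → N) : Prop :=
  Function.Surjective c ∧
  (∀ x y : Γ.Dom M, Γ.eqv.Realize default ![x.1, y.1] ↔ c x = c y) ∧
  (∀ {k : ℕ} (f : L'.Functions k) (x : Fin k → Γ.Dom M) (y : Γ.Dom M),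
    (Γ.fn f).Realize default (Fin.snoc (fun i => (x i).1) y.1) ↔
      Structure.funMap f (fun i => c (x i)) = c y) ∧
  (∀ {k : ℕ} (R : L'.Relations k) (x : Fin k → Γ.Dom M),
    (Γ.rel R).Realize default (fun i => (x i).1) ↔ Structure.RelMap R (fun i => c (x i)))

/-- Substitution of variables into a formula. -/
def inst {β : Type} {k : ℕ} (φ : L.BoundedFormula Empty k) (v : Fin k → β) : L.Formula β :=
  φ.toFormula.relabel (Sum.elim Empty.elim v)

/-- The formula which says that the variable `Sum.inr ()` represents the value of a term. -/
noncomputable def termGraph {β : Type} : L'.Term β → L.Formula (β ⊕ Unit)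
  | .var b => inst Γ.eqv ![.inl b, .inr ()]
  | .func (l := k) f ts => Formula.iExs (Fin k) <|
      Formula.iInf (fun i : Fin k =>
        (inst Γ.dom ![.inr i] : L.Formula ((β ⊕ Unit) ⊕ Fin k)) ⊓
          (termGraph (ts i)).relabel (Sum.elim (fun b => .inl (.inl b)) (fun _ => .inr i))) ⊓
      inst (Γ.fn f) (Fin.snoc (α := fun _ => (β ⊕ Unit) ⊕ Fin k) .inr (.inl (.inr ())))

/-- The translation of formulas of `L'` into formulas of `L`: atomic formulas are unnested, and
quantifiers are relativized to the domain. -/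
noncomputable def translateFormula {α : Type} :
    ∀ {n : ℕ}, L'.BoundedFormula α n → L.Formula (α ⊕ Fin n)
  | _, .falsum => ⊥
  | n, .equal s t => Formula.iExs Unit <|
      (inst Γ.dom ![.inr ()] : L.Formula ((α ⊕ Fin n) ⊕ Unit)) ⊓ Γ.termGraph s ⊓ Γ.termGraph t
  | n, .rel (l := k) R ts => Formula.iExs (Fin k) <|
      Formula.iInf (fun i : Fin k =>
        (inst Γ.dom ![.inr i] : L.Formula ((α ⊕ Fin n) ⊕ Fin k)) ⊓
          (Γ.termGraph (ts i)).relabel (Sum.elim .inl (fun _ => .inr i))) ⊓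
      inst (Γ.rel R) .inr
  | _, .imp φ ψ => (translateFormula φ).imp (translateFormula ψ)
  | n, .all φ => Formula.iAlls Unit <|
      (inst Γ.dom ![.inr ()] : L.Formula ((α ⊕ Fin n) ⊕ Unit)).imp
        ((translateFormula φ).relabel (Sum.elim (fun a => .inl (.inl a))
          (Fin.snoc (α := fun _ => (α ⊕ Fin n) ⊕ Unit) (fun i => .inl (.inr i)) (.inr ()))))

/-- The translation of sentences. -/
noncomputable def translate (σ : L'.Sentence) : L.Sentence :=
  (Γ.translateFormula σ).relabel (Sum.elim id Fin.elim0)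

end Interpretation

/-- The interpretation of arithmetic in the language of probabilistic independence. -/
def arithInterp : Interpretation arithLang indepLang where
  dom := isnat 0
  eqv := natEq 0 1
  fn {k} f := match k, f with
    | _, ArithFun.add => natAdd 0 1 2
    | _, ArithFun.mul => natMul 0 1 2
  rel {k} R := match k, R with
    | _, ArithRel.lt => natLt 0 1

/-! ## Gödel numbers -/

/-- The index of the variable that a term of the language of independence consists of. -/
def varIndex {n : ℕ} : indepLang.Term (Empty ⊕ Fin n) → ℕ
  | .var (.inr i) => i
  | .var (.inl e) => e.elim
  | .func f _ => nomatch f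

/-- The Gödel number of a formula of the language of independence. -/
def godelNumber : ∀ {n : ℕ}, Fml n → ℕ
  | _, .falsum => Nat.pair 0 0
  | _, .equal s t => Nat.pair 1 (Nat.pair (varIndex s) (varIndex t))
  | _, .rel .indep ts => Nat.pair 2 (Nat.pair (varIndex (ts 0)) (varIndex (ts 1)))
  | _, .imp φ ψ => Nat.pair 3 (Nat.pair (godelNumber φ) (godelNumber ψ))
  | _, .all φ => Nat.pair 4 (godelNumber φ)

/-- The set of Gödel numbers of a set of sentences. -/
def godelNumbers (T : Set indepLang.Sentence) : Set ℕ := {m | ∃ σ ∈ T, godelNumber σ = m}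

/-- A set of sentences is decidable if the set of its Gödel numbers is computable. -/
def Decidable (T : Set indepLang.Sentence) : Prop := ComputablePred (· ∈ godelNumbers T)

/-- A set of sentences is arithmetically definable if the set of its Gödel numbers is defined in
`(ℕ₀, +, ·, <)` by a first-order formula. -/
def ArithmeticallyDefinable (T : Set indepLang.Sentence) : Prop :=
  (∅ : Set ℕ).Definable₁ arithLang (godelNumbers T)

end FOTPI

namespace FOTPI

/-! ## Discrete variables with values in arbitrary countable types -/

/-! Everything rests on three facts about discrete variables on an atomless space. First,
independence determines functional dependence (`functionOf_of_forall_ind`): if `X` is not a function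
of `Y`, some atom of `Y` is split by an event `X = x`, and a coin whose bias is the conditional
probability, made to agree with `X = x` on that atom only, is independent of `Y` but not of `X`.
Hence joins, cardinalities (by counting strict coarsenings) and mutual independence are expressible.

Second, in a triple any compatible `x, y, z` satisfy P(x)P(y) = P(x)P(z), because the events (x,y)
and (x,z) coincide. So all atoms have the same mass (`Triple.isUnif`), and conversely addition
modulo `n` completes a uniform variable to a triple. Uniform variables thus serve as positive
integers. Independent pairing multiplies them. Comparison reduces to fitting `ab` values into the at
most `b²` values of a pair.

Third, addition is read off from a partition of `Z` into two sides marked by `U`. If each atom of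
`Z` is an atom of `AU` or of `BU`, with `A`, `B` uniform on `a` and `b` values and independent of
`U`, then each side has mass `a/n` or `b/n`. A nonuniform `U` forces both to occur, whence `n = a +
b` (`isBern_of_smi`). The converse is an explicit shuffle of independent uniform labels
(`exists_frac_witness`). Single-mass indicators are definable because fixing one atom leaves too few
values for a four-valued coarsening (`holds_smi`). Zero is represented by the nonconstant proper
coarsenings of Unif[3].

These facts make `value` a coordinate map, and `realize_translate` transfers truth of sentences. For
undefinability, graphs of partial recursive functions are arithmetical by Gödel's β-function
(`aDef_of_partrec`), and Tarski's diagonal argument applies. No substitution of numerals is needed: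
"every uniform variable on `m + 2` values satisfies the formula with code `m`" is a sentence whose
code is a primitive recursive function of `m`. If the codes of true sentences were arithmetical, the
interpretation would give an equality-free formula stating the failure of its own diagonal sentence.
Undecidability follows because computable sets are arithmetical. All formulas used avoid equality,
so the argument also covers the equality-free part. -/

/-- The probability of an event. -/
noncomputable abbrev prob (s : Set Ω) : ℝ := (volume : Measure Ω).real s

/-- All events expressible by `X` are Lebesgue measurable. -/
def Discrete {α : Type} (X : Ω → α) : Prop :=
  ∀ s : Set α, NullMeasurableSet (X ⁻¹' s) (volume : Measure Ω)

/-- Independence of discrete variables. -/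
def Ind {α β : Type} (X : Ω → α) (Y : Ω → β) : Prop :=
  ∀ (s : Set α) (t : Set β), prob (X ⁻¹' s ∩ Y ⁻¹' t) = prob (X ⁻¹' s) * prob (Y ⁻¹' t)

/-- `X` is uniformly distributed over all of its type of values. -/
def UnifOn {α : Type} [Fintype α] (X : Ω → α) : Prop :=
  ∀ a, prob (X ⁻¹' {a}) = 1 / Fintype.card α

section basic

variable {α β γ δ : Type}

lemma RV.discrete (X : RV) : Discrete X := fun s => X.2 (MeasurableSpace.measurableSet_top (s := s))

lemma Discrete.comp {X : Ω → α} (hX : Discrete X) (f : α → β) : Discrete fun ω => f (X ω) :=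
  fun s => hX (f ⁻¹' s)

lemma discrete_of_singleton [Countable α] {X : Ω → α}
    (h : ∀ a, NullMeasurableSet (X ⁻¹' {a}) (volume : Measure Ω)) : Discrete X := by
  intro s
  rw [← Set.biUnion_preimage_singleton]
  exact NullMeasurableSet.biUnion s.to_countable fun a _ => h a

lemma Discrete.prodMk [Countable α] [Countable β] {X : Ω → α} {Y : Ω → β} (hX : Discrete X)
    (hY : Discrete Y) : Discrete fun ω => (X ω, Y ω) := by
  refine discrete_of_singleton fun ⟨a, b⟩ => ?_
  convert (hX {a}).inter (hY {b}) using 1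
  ext ω; simp

open Classical in
lemma discrete_decide {B : Set Ω} (hB : NullMeasurableSet B (volume : Measure Ω)) :
    Discrete fun ω => decide (ω ∈ B) := by
  refine discrete_of_singleton fun b => ?_
  cases b
  · convert hB.compl using 1
    ext ω; simp
  · convert hB using 1
    ext ω; simp

/-- Encoding the values loses no information. Auxiliary variables can therefore live in whatever
countable type is convenient and enter the structure only at the end. -/
lemma Discrete.exists_rv [Countable α] {X : Ω → α} (hX : Discrete X) :
    ∃ X' : RV, InfoEquiv X' X := by
  have := Encodable.ofCountable α
  refine ⟨⟨fun ω => Nat.succPNat (Encodable.encode (X ω)),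
    fun s _ => hX ((fun a => Nat.succPNat (Encodable.encode a)) ⁻¹' s)⟩,
    ⟨fun a => Nat.succPNat (Encodable.encode a), .of_forall fun _ => rfl⟩, ?_⟩
  have : Nonempty α := ⟨X 0⟩
  refine ⟨Function.invFun fun a : α => Nat.succPNat (Encodable.encode a), .of_forall fun ω => ?_⟩
  exact (Function.leftInverse_invFun
    (Nat.succPNat_injective.comp Encodable.encode_injective) (X ω)).symm

lemma prob_nonneg (s : Set Ω) : 0 ≤ prob s := measureReal_nonneg

lemma prob_univ : prob Set.univ = 1 := by simp [prob]

lemma prob_mono {s t : Set Ω} (h : s ⊆ t) : prob s ≤ prob t := measureReal_mono h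

lemma prob_congr {s t : Set Ω} (h : ∀ᵐ ω ∂(volume : Measure Ω), ω ∈ s ↔ ω ∈ t) :
    prob s = prob t :=
  measureReal_congr (Filter.eventuallyEq_set.2 h)

lemma prob_pos_iff {s : Set Ω} : 0 < prob s ↔ (volume : Measure Ω) s ≠ 0 := by
  rw [prob, Measure.real, ENNReal.toReal_pos_iff]
  simp [pos_iff_ne_zero, measure_lt_top]

lemma exists_of_prob_pos {s : Set Ω} {p : Ω → Prop} (hs : 0 < prob s)
    (hp : ∀ᵐ ω ∂(volume : Measure Ω), p ω) : ∃ ω ∈ s, p ω := by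
  by_contra! h
  refine prob_pos_iff.1 hs (measure_mono_null (fun ω hω => ?_) (ae_iff.1 hp))
  exact h ω hω

lemma exists_prob_inter_pos [Countable α] (X : Ω → α) {s : Set Ω} (hs : 0 < prob s) :
    ∃ a, 0 < prob (s ∩ X ⁻¹' {a}) := by
  by_contra! h
  refine prob_pos_iff.1 hs ?_
  have : s = ⋃ a, s ∩ X ⁻¹' {a} := by ext; simp
  rw [this, measure_iUnion_null_iff]
  intro a
  by_contra h'
  exact absurd (prob_pos_iff.2 h') (not_lt.2 (h a))

lemma ae_prob_pos [Countable α] (X : Ω → α) :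
    ∀ᵐ ω ∂(volume : Measure Ω), 0 < prob (X ⁻¹' {X ω}) := by
  rw [ae_iff]
  have : {ω | ¬ 0 < prob (X ⁻¹' {X ω})} ⊆
      ⋃ a ∈ {a | ¬ 0 < prob (X ⁻¹' {a})}, X ⁻¹' {a} := by
    intro ω hω
    simpa using hω
  refine measure_mono_null this ?_
  rw [measure_biUnion_null_iff (Set.to_countable _)]
  intro a ha
  by_contra h'
  exact ha (prob_pos_iff.2 h')

lemma prob_inter_add_diff {B : Set Ω} (s : Set Ω)
    (hB : NullMeasurableSet B (volume : Measure Ω)) : prob (s ∩ B) + prob (s \ B) = prob s :=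
  measureReal_inter_add_sdiff₀ hB

/-- The set `s` need not be measurable: restricting the measure to `s` still gives a measure, and it
is additive over the fibres of `X`. -/
lemma prob_eq_sum [Fintype α] {X : Ω → α} (hX : Discrete X) (s : Set Ω) :
    prob s = ∑ a, prob (s ∩ X ⁻¹' {a}) := by
  have h := measure_biUnion_finset₀ (μ := (volume : Measure Ω).restrict s) (s := Finset.univ)
    (f := fun a => X ⁻¹' {a}) (fun a _ b _ hab => by
      refine Disjoint.aedisjoint (Set.disjoint_left.2 fun ω h1 h2 => hab ?_)
      simp at h1 h2; rw [← h1, ← h2]) (fun a _ => (hX {a}).mono Measure.restrict_le_self)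
  have h2 : (⋃ a ∈ (Finset.univ : Finset α), X ⁻¹' {a}) = Set.univ := by ext; simp
  rw [h2, Measure.restrict_apply_univ] at h
  rw [prob, Measure.real, h, ENNReal.toReal_sum]
  · refine Finset.sum_congr rfl fun a _ => ?_
    rw [prob, Measure.real, Measure.restrict_apply₀ ((hX {a}).mono Measure.restrict_le_self),
      Set.inter_comm]
  · intro a _
    exact measure_ne_top _ _

/-- On a countable space a measure is determined by its atoms, so the joint law equals the product
law once they agree on singletons. -/
lemma ind_of_singleton [Countable α] [Countable β] {X : Ω → α} {Y : Ω → β} (hX : Discrete X)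
    (hY : Discrete Y)
    (h : ∀ a b, prob (X ⁻¹' {a} ∩ Y ⁻¹' {b}) = prob (X ⁻¹' {a}) * prob (Y ⁻¹' {b})) :
    Ind X Y := by
  let : MeasurableSpace α := ⊤
  let : MeasurableSpace β := ⊤
  have hX' : NullMeasurable X (volume : Measure Ω) := fun s _ => hX s
  have hY' : NullMeasurable Y (volume : Measure Ω) := fun s _ => hY s
  have key : IndepFun X Y (volume : Measure Ω) := by
    rw [indepFun_iff_map_prod_eq_prod_map_map hX'.aemeasurable hY'.aemeasurable]
    refine Measure.ext_of_singleton fun ⟨a, b⟩ => ?_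
    have hXY : AEMeasurable (fun ω => (X ω, Y ω)) (volume : Measure Ω) :=
      hX'.aemeasurable.prodMk hY'.aemeasurable
    rw [← Set.singleton_prod_singleton, Measure.prod_prod,
      Measure.map_apply_of_aemeasurable hXY
        ((measurableSet_singleton a).prod (measurableSet_singleton b)),
      Measure.map_apply_of_aemeasurable hX'.aemeasurable (measurableSet_singleton a),
      Measure.map_apply_of_aemeasurable hY'.aemeasurable (measurableSet_singleton b)]
    have := h a b
    rw [prob, prob, prob, Measure.real, Measure.real, Measure.real, ← ENNReal.toReal_mul,
      ENNReal.toReal_eq_toReal_iff' (measure_ne_top _ _)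
        (ENNReal.mul_ne_top (measure_ne_top _ _) (measure_ne_top _ _))] at this
    exact this
  intro s t
  rw [indepFun_iff_measure_inter_preimage_eq_mul] at key
  rw [prob, prob, prob, Measure.real, key s t trivial trivial, ENNReal.toReal_mul]
  rfl

/-- The law of `X` under the measure restricted to `B` and `q` times the law of `X` are measures
with the same atoms. -/
lemma prob_preimage_inter_of_singleton [Countable α] {X : Ω → α} (hX : Discrete X) {B : Set Ω}
    (hB : NullMeasurableSet B (volume : Measure Ω)) {q : ℝ} (hq : 0 ≤ q)
    (h : ∀ a, prob (X ⁻¹' {a} ∩ B) = q * prob (X ⁻¹' {a})) (s : Set α) :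
    prob (X ⁻¹' s ∩ B) = q * prob (X ⁻¹' s) := by
  let _ : MeasurableSpace α := ⊤
  have hX' : AEMeasurable X (volume : Measure Ω) := NullMeasurable.aemeasurable fun s _ => hX s
  have key : ((volume : Measure Ω).restrict B).map X =
      ENNReal.ofReal q • (volume : Measure Ω).map X := by
    refine Measure.ext_of_singleton fun a => ?_
    rw [Measure.smul_apply, Measure.map_apply_of_aemeasurable hX'.restrict
      (measurableSet_singleton a), Measure.map_apply_of_aemeasurable hX'
      (measurableSet_singleton a), Measure.restrict_apply₀' hB, smul_eq_mul,
      ← ENNReal.toReal_eq_toReal_iff' (measure_ne_top _ _)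
        (ENNReal.mul_ne_top ENNReal.ofReal_ne_top (measure_ne_top _ _)), ENNReal.toReal_mul,
      ENNReal.toReal_ofReal hq]
    exact h a
  have := congrArg (fun ν : Measure α => (ν s).toReal) key
  simp only [Measure.smul_apply, smul_eq_mul, ENNReal.toReal_mul, ENNReal.toReal_ofReal hq] at this
  rwa [Measure.map_apply_of_aemeasurable hX'.restrict trivial,
    Measure.map_apply_of_aemeasurable hX' trivial, Measure.restrict_apply₀' hB] at this

lemma ind_iff_indepFun (X Y : RV) : Ind X Y ↔ IndepFun X Y (volume : Measure Ω) := by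
  rw [indepFun_iff_measure_inter_preimage_eq_mul]
  constructor
  · intro h s t _ _
    have := h s t
    rwa [prob, prob, prob, Measure.real, Measure.real, Measure.real, ← ENNReal.toReal_mul,
      ENNReal.toReal_eq_toReal_iff' (measure_ne_top _ _)
        (ENNReal.mul_ne_top (measure_ne_top _ _) (measure_ne_top _ _))] at this
  · intro h s t
    rw [prob, Measure.real, h s t trivial trivial, ENNReal.toReal_mul]
    rfl

/-! ### Calculus of independence and functional dependence. -/

lemma Ind.symm {X : Ω → α} {Y : Ω → β} (h : Ind X Y) : Ind Y X := by
  intro s t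
  rw [Set.inter_comm, h t s, mul_comm]

lemma Ind.of_functionOf_left {X : Ω → α} {X' : Ω → γ} {Y : Ω → β} (h : Ind X Y)
    (hf : FunctionOf X' X) : Ind X' Y := by
  obtain ⟨f, hf⟩ := hf
  intro s t
  have h1 : prob (X' ⁻¹' s ∩ Y ⁻¹' t) = prob (X ⁻¹' (f ⁻¹' s) ∩ Y ⁻¹' t) := prob_congr <| by
    filter_upwards [hf] with ω hω
    simp [hω]
  have h2 : prob (X' ⁻¹' s) = prob (X ⁻¹' (f ⁻¹' s)) := prob_congr <| by
    filter_upwards [hf] with ω hω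
    simp [hω]
  rw [h1, h2, h]

lemma Ind.of_functionOf {X : Ω → α} {X' : Ω → γ} {Y : Ω → β} {Y' : Ω → δ} (h : Ind X Y)
    (hX : FunctionOf X' X) (hY : FunctionOf Y' Y) : Ind X' Y' :=
  ((h.of_functionOf_left hX).symm.of_functionOf_left hY).symm

lemma FunctionOf.refl (X : Ω → α) : FunctionOf X X := ⟨id, .of_forall fun _ => rfl⟩

lemma functionOf_comp (X : Ω → α) (f : α → β) : FunctionOf (fun ω => f (X ω)) X :=
  ⟨f, .of_forall fun _ => rfl⟩

lemma FunctionOf.trans {X : Ω → α} {Y : Ω → β} {Z : Ω → γ} (h : FunctionOf X Y)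
    (h' : FunctionOf Y Z) : FunctionOf X Z := by
  obtain ⟨f, hf⟩ := h
  obtain ⟨g, hg⟩ := h'
  refine ⟨f ∘ g, ?_⟩
  filter_upwards [hf, hg] with ω h1 h2
  simp [h1, h2]

lemma FunctionOf.prodMk {X : Ω → α} {Y : Ω → β} {Z : Ω → γ} (h : FunctionOf X Z)
    (h' : FunctionOf Y Z) : FunctionOf (fun ω => (X ω, Y ω)) Z := by
  obtain ⟨f, hf⟩ := h
  obtain ⟨g, hg⟩ := h'
  refine ⟨fun z => (f z, g z), ?_⟩
  filter_upwards [hf, hg] with ω h1 h2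
  simp [h1, h2]

lemma functionOf_prod_left (X : Ω → α) (Y : Ω → β) : FunctionOf X fun ω => (X ω, Y ω) :=
  ⟨Prod.fst, .of_forall fun _ => rfl⟩

lemma functionOf_prod_right (X : Ω → α) (Y : Ω → β) : FunctionOf Y fun ω => (X ω, Y ω) :=
  ⟨Prod.snd, .of_forall fun _ => rfl⟩

lemma FunctionOf.prod_congr {X : Ω → α} {Y : Ω → β} {X' : Ω → γ} {Y' : Ω → δ}
    (h : FunctionOf X X') (h' : FunctionOf Y Y') :
    FunctionOf (fun ω => (X ω, Y ω)) fun ω => (X' ω, Y' ω) :=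
  (h.trans (functionOf_prod_left _ _)).prodMk (h'.trans (functionOf_prod_right _ _))

lemma FunctionOf.of_injective {X : Ω → α} {f : α → β} (hf : f.Injective) :
    FunctionOf X fun ω => f (X ω) := by
  have : Nonempty α := ⟨X 0⟩
  exact ⟨Function.invFun f, .of_forall fun ω => (Function.leftInverse_invFun hf (X ω)).symm⟩

lemma InfoEquiv.symm {X : Ω → α} {Y : Ω → β} (h : InfoEquiv X Y) : InfoEquiv Y X := ⟨h.2, h.1⟩

lemma InfoEquiv.trans {X : Ω → α} {Y : Ω → β} {Z : Ω → γ} (h : InfoEquiv X Y)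
    (h' : InfoEquiv Y Z) : InfoEquiv X Z := ⟨h.1.trans h'.1, h'.2.trans h.2⟩

lemma InfoEquiv.prod_congr {X : Ω → α} {Y : Ω → β} {X' : Ω → γ} {Y' : Ω → δ}
    (h : InfoEquiv X X') (h' : InfoEquiv Y Y') :
    InfoEquiv (fun ω => (X ω, Y ω)) fun ω => (X' ω, Y' ω) :=
  ⟨h.1.prod_congr h'.1, h.2.prod_congr h'.2⟩

end basic

/-! ### Uniform distributions on finite types. -/

section uniform

variable {α β : Type} [Fintype α] [Fintype β]

lemma UnifOn.equiv {X : Ω → α} (hX : UnifOn X) (e : α ≃ β) : UnifOn fun ω => e (X ω) := by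
  intro b
  rw [← Fintype.card_congr e, ← hX (e.symm b)]
  congr 1
  ext ω
  simp [Equiv.eq_symm_apply]

lemma UnifOn.prodMk {X : Ω → α} {Y : Ω → β} (hX : UnifOn X) (hY : UnifOn Y) (h : Ind X Y) :
    UnifOn fun ω => (X ω, Y ω) := by
  rintro ⟨a, b⟩
  have := h {a} {b}
  rw [hX, hY] at this
  convert this using 1
  · congr 1
    ext ω; simp
  · simp [mul_comm]

lemma UnifOn.fst {X : Ω → α} {Y : Ω → β} (hY : Discrete Y)
    (h : UnifOn fun ω => (X ω, Y ω)) : UnifOn X := by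
  intro a
  have : Nonempty β := ⟨Y 0⟩
  have hb : (Fintype.card β : ℝ) ≠ 0 := by simp
  have (b : β) : prob (X ⁻¹' {a} ∩ Y ⁻¹' {b}) = 1 / (Fintype.card α * Fintype.card β) := by
    have := h (a, b)
    rw [Fintype.card_prod, Nat.cast_mul] at this
    rw [← this]
    congr 1
    ext ω; simp
  rw [prob_eq_sum hY]
  simp only [this, Finset.sum_const, Finset.card_univ, nsmul_eq_mul]
  field_simp

lemma UnifOn.snd {X : Ω → α} {Y : Ω → β} (hX : Discrete X)
    (h : UnifOn fun ω => (X ω, Y ω)) : UnifOn Y :=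
  UnifOn.fst hX (h.equiv (Equiv.prodComm α β))

lemma UnifOn.ind {X : Ω → α} {Y : Ω → β} (hX : Discrete X) (hY : Discrete Y)
    (h : UnifOn fun ω => (X ω, Y ω)) : Ind X Y := by
  refine ind_of_singleton hX hY fun a b => ?_
  rw [h.fst hY a, h.snd hX b]
  have := h (a, b)
  rw [Fintype.card_prod, Nat.cast_mul] at this
  rw [one_div_mul_one_div, ← this]
  congr 1
  ext ω; simp

lemma UnifOn.prob_pos {X : Ω → α} (hX : UnifOn X) (a : α) : 0 < prob (X ⁻¹' {a}) := by
  rw [hX a]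
  have : Nonempty α := ⟨a⟩
  positivity

end uniform

/-! ## Existence of independent variables -/

/-- Every event can be cut at a point into two parts of prescribed proportions. -/
lemma exists_prob_inter_Iic (s : Set Ω) {q : ℝ} (h0 : 0 ≤ q) (h1 : q ≤ 1) :
    ∃ t : Ω, prob (s ∩ Set.Iic t) = q * prob s := by
  set F : Ω → ℝ := fun t => prob (s ∩ Set.Iic t) with hF
  -- Moving the cut adds at most the length of the interval swept. This needs only subadditivity, so
  -- it holds for nonmeasurable `s` too; it gives the continuity that the intermediate value theorem
  -- requires.
  have hlip : ∀ t t' : Ω, t ≤ t' → F t' ≤ F t + ((t' : ℝ) - t) := by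
    intro t t' htt
    have hsub : s ∩ Set.Iic t' ⊆ (s ∩ Set.Iic t) ∪ Set.Ioc t t' := by
      rintro ω ⟨h1, h2⟩
      by_cases h : ω ≤ t
      · exact Or.inl ⟨h1, h⟩
      · exact Or.inr ⟨not_le.1 h, h2⟩
    refine (prob_mono hsub).trans ((measureReal_union_le _ _).trans ?_)
    have : (volume : Measure Ω).real (Set.Ioc t t') = (t' : ℝ) - t := by
      rw [Measure.real, unitInterval.volume_Ioc, ENNReal.toReal_ofReal (sub_nonneg.2 htt)]
    rw [this]
  have hmono : Monotone F := fun t t' h => prob_mono (Set.inter_subset_inter_right _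
    (Set.Iic_subset_Iic.2 h))
  have hcont : Continuous F := by
    refine (LipschitzWith.of_dist_le_mul (K := 1) fun t t' => ?_).continuous
    rw [NNReal.coe_one, one_mul, Subtype.dist_eq, Real.dist_eq, Real.dist_eq]
    rcases le_total t t' with h | h
    · rw [abs_of_nonpos (sub_nonpos.2 (hmono h)),
        abs_of_nonpos (sub_nonpos.2 (Subtype.coe_le_coe.2 h))]
      linarith [hlip t t' h]
    · rw [abs_of_nonneg (sub_nonneg.2 (hmono h)),
        abs_of_nonneg (sub_nonneg.2 (Subtype.coe_le_coe.2 h))]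
      linarith [hlip t' t h]
  have hbot : F 0 = 0 := by
    have : prob (Set.Iic (0 : Ω)) = 0 := by
      simp [prob, Measure.real, unitInterval.volume_Iic]
    exact le_antisymm ((prob_mono Set.inter_subset_right).trans this.le) (prob_nonneg _)
  have htop : F 1 = prob s := by
    simp only [hF]
    congr 1
    ext ω
    simp [unitInterval.le_one']
  have : q * prob s ∈ Set.Icc (F 0) (F 1) := by
    rw [hbot, htop]
    exact ⟨mul_nonneg h0 (prob_nonneg s), mul_le_of_le_one_left (prob_nonneg s) h1⟩
  obtain ⟨t, ht⟩ := intermediate_value_univ 0 1 hcont this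
  exact ⟨t, ht⟩

/-- There is an event of any given probability independent of a given discrete variable. -/
lemma exists_indep_event {α : Type} [Countable α] {X : Ω → α} (hX : Discrete X) {q : ℝ}
    (h0 : 0 ≤ q) (h1 : q ≤ 1) :
    ∃ B : Set Ω, NullMeasurableSet B (volume : Measure Ω) ∧
      ∀ a, prob (X ⁻¹' {a} ∩ B) = q * prob (X ⁻¹' {a}) := by
  -- Each atom of `X` is cut at its own point in the same proportion `q`; the union of the pieces is
  -- the event.
  choose t ht using fun a => exists_prob_inter_Iic (X ⁻¹' {a}) h0 h1
  refine ⟨⋃ a, X ⁻¹' {a} ∩ Set.Iic (t a), .iUnion fun a =>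
    (hX {a}).inter measurableSet_Iic.nullMeasurableSet, fun a => ?_⟩
  rw [← ht a]
  congr 1
  ext ω
  simp only [Set.mem_inter_iff, Set.mem_preimage, Set.mem_singleton_iff, Set.mem_iUnion,
    Set.mem_Iic]
  constructor
  · rintro ⟨rfl, b, hb, h⟩
    exact ⟨rfl, hb ▸ h⟩
  · rintro ⟨rfl, h⟩
    exact ⟨rfl, _, rfl, h⟩

/-- Values are peeled off one at a time: an event of probability `1/(n+2)` independent of `X`
carries the last value, and on its complement the value comes from a uniform variable on `n + 1`
values, independent of `X` together with that event. -/
lemma exists_indep_fin {α : Type} [Countable α] {X : Ω → α} (hX : Discrete X) (n : ℕ) :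
    ∃ U : Ω → Fin (n + 1), Discrete U ∧
      ∀ a i, prob (X ⁻¹' {a} ∩ U ⁻¹' {i}) = prob (X ⁻¹' {a}) * (1 / (n + 1)) := by
  classical
  induction n generalizing α with
  | zero =>
    refine ⟨fun _ => 0, fun s => ?_, fun a i => ?_⟩
    · exact (measurable_const (a := (0 : Fin 1)) trivial).nullMeasurableSet
    · have : (fun _ : Ω => (0 : Fin 1)) ⁻¹' {i} = Set.univ := by ext; simp [Fin.fin_one_eq_zero i]
      simp [this]
  | succ n ih =>
    obtain ⟨B, hB, hXB⟩ := exists_indep_event hX (q := 1 / ((n : ℝ) + 2)) (by positivity) (by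
      rw [div_le_one (by positivity)]
      linarith [(Nat.cast_nonneg n : (0 : ℝ) ≤ n)])
    obtain ⟨V, hV, hXV⟩ := ih (hX.prodMk (discrete_decide hB))
    refine ⟨fun ω => if ω ∈ B then Fin.last (n + 1) else (V ω).castSucc, ?_, fun a i => ?_⟩
    · have := ((discrete_decide hB).prodMk hV).comp
        (fun p => if p.1 = true then Fin.last (n + 1) else p.2.castSucc)
      simpa using this
    · have hn : ((n : ℝ) + 2) ≠ 0 := by positivity
      have hn1 : ((n : ℝ) + 1) ≠ 0 := by positivity
      push_cast
      induction i using Fin.lastCases with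
      | last =>
        have : X ⁻¹' {a} ∩ (fun ω => if ω ∈ B then Fin.last (n + 1) else (V ω).castSucc) ⁻¹'
            {Fin.last (n + 1)} = X ⁻¹' {a} ∩ B := by
          ext ω
          by_cases h : ω ∈ B <;> simp [h, Fin.castSucc_ne_last]
        rw [this, hXB]
        ring
      | cast i =>
        have : X ⁻¹' {a} ∩ (fun ω => if ω ∈ B then Fin.last (n + 1) else (V ω).castSucc) ⁻¹'
            {i.castSucc} = (fun ω => (X ω, decide (ω ∈ B))) ⁻¹' {(a, false)} ∩ V ⁻¹' {i} := by
          ext ω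
          by_cases h : ω ∈ B <;> simp [h, (Fin.castSucc_ne_last _).symm]
        rw [this, hXV]
        have h2 : (fun ω => (X ω, decide (ω ∈ B))) ⁻¹' {(a, false)} = X ⁻¹' {a} \ B := by
          ext ω; simp
        have h3 := prob_inter_add_diff (X ⁻¹' {a}) hB
        rw [hXB] at h3
        rw [h2, ← sub_eq_of_eq_add' h3.symm]
        field_simp
        ring

/-- There is a uniform variable independent of a given discrete variable. -/
lemma exists_indep_unif {α : Type} [Countable α] {X : Ω → α} (hX : Discrete X) (β : Type)
    [Fintype β] [Nonempty β] : ∃ U : Ω → β, Discrete U ∧ UnifOn U ∧ Ind X U := by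
  obtain ⟨n, hn⟩ : ∃ n, Fintype.card β = n + 1 := Nat.exists_eq_succ_of_ne_zero Fintype.card_ne_zero
  let e : Fin (n + 1) ≃ β := (Fintype.equivFinOfCardEq hn).symm
  obtain ⟨U, hU, h⟩ := exists_indep_fin hX n
  have hun : UnifOn U := by
    intro i
    have := prob_preimage_inter_of_singleton hX (hU {i}) (q := 1 / (n + 1)) (by positivity)
      (fun a => by rw [h, mul_comm]) Set.univ
    simpa [prob_univ] using this
  refine ⟨fun ω => e (U ω), hU.comp e, hun.equiv e, ?_⟩
  refine Ind.of_functionOf (ind_of_singleton hX hU fun a i => ?_) (.refl X) (functionOf_comp _ _)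
  rw [h, hun i]
  simp

/-! ## Being a function of a variable, in terms of independence -/

section functionOf

variable {α β γ : Type}

/-- Almost every point lies in an atom of the pair, so it suffices to send each `y` to the only
value of `X` compatible with it; `X 0` is a default for `y` of probability zero. -/
lemma functionOf_iff [Countable α] [Countable β] {X : Ω → α} {Y : Ω → β} :
    FunctionOf X Y ↔ ∀ y x x', 0 < prob (Y ⁻¹' {y} ∩ X ⁻¹' {x}) →
      0 < prob (Y ⁻¹' {y} ∩ X ⁻¹' {x'}) → x = x' := by
  classical
  constructor
  · rintro ⟨f, hf⟩ y x x' h h'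
    obtain ⟨ω, ⟨h1, h2⟩, h3⟩ := exists_of_prob_pos h hf
    obtain ⟨ω', ⟨h1', h2'⟩, h3'⟩ := exists_of_prob_pos h' hf
    simp only [Set.mem_preimage, Set.mem_singleton_iff] at h1 h2 h1' h2'
    rw [← h2, ← h2', h3, h3', h1, h1']
  · intro h
    refine ⟨fun y => if hy : ∃ x, 0 < prob (Y ⁻¹' {y} ∩ X ⁻¹' {x}) then hy.choose else X 0, ?_⟩
    filter_upwards [ae_prob_pos fun ω => (Y ω, X ω)] with ω hω
    have hω' : 0 < prob (Y ⁻¹' {Y ω} ∩ X ⁻¹' {X ω}) := by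
      convert hω using 2
      ext; simp
    have hy : ∃ x, 0 < prob (Y ⁻¹' {Y ω} ∩ X ⁻¹' {x}) := ⟨_, hω'⟩
    rw [dif_pos hy]
    exact h _ _ _ hω' hy.choose_spec

lemma preimage_decide_true (E : Set Ω) [DecidablePred (· ∈ E)] :
    (fun ω => decide (ω ∈ E)) ⁻¹' {true} = E := by
  ext; simp

open Classical in
lemma ind_decide [Countable α] {Y : Ω → α} (hY : Discrete Y) {E : Set Ω}
    (hE : NullMeasurableSet E (volume : Measure Ω)) {p : ℝ} (hp : 0 ≤ p)
    (h : ∀ y, prob (Y ⁻¹' {y} ∩ E) = p * prob (Y ⁻¹' {y})) :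
    Ind Y fun ω => decide (ω ∈ E) := by
  have hpE : prob E = p := by
    simpa [prob_univ] using prob_preimage_inter_of_singleton hY hE hp h Set.univ
  refine ind_of_singleton hY (discrete_decide hE) fun y b => ?_
  cases b
  · have h1 : (fun ω => decide (ω ∈ E)) ⁻¹' {false} = Eᶜ := by ext; simp
    have h2 := prob_inter_add_diff (Y ⁻¹' {y}) hE
    have h3 := prob_inter_add_diff Set.univ hE
    rw [Set.univ_inter, prob_univ, ← Set.compl_eq_univ_sdiff] at h3
    rw [h1, ← Set.sdiff_eq, ← sub_eq_of_eq_add' h2.symm, h, ← sub_eq_of_eq_add' h3.symm, hpE]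
    ring
  · rw [preimage_decide_true, h, hpE, mul_comm]

/-- A value `y` compatible with two values of `X` yields an event independent of `Y` yet positively
correlated with `X = x`. This is what makes functional dependence expressible by independence. -/
lemma functionOf_of_forall_ind [Countable α] [Countable β] {X : Ω → α} {Y : Ω → β}
    (hX : Discrete X) (hY : Discrete Y) (h : ∀ U : RV, Ind U Y → Ind U X) : FunctionOf X Y := by
  classical
  rw [functionOf_iff]
  intro y x x' hx hx'
  by_contra hne
  have hA := hX {x}
  have hy : prob (Y ⁻¹' {y} ∩ X ⁻¹' {x}) < prob (Y ⁻¹' {y}) := by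
    rw [← prob_inter_add_diff (Y ⁻¹' {y}) hA]
    refine lt_add_of_pos_right _ (hx'.trans_le (prob_mono fun ω hω => ⟨hω.1, fun h1 => ?_⟩))
    exact hne (Eq.trans (Set.mem_singleton_iff.1 h1).symm hω.2)
  have hy0 := hx.trans hy
  set p := prob (Y ⁻¹' {y} ∩ X ⁻¹' {x}) / prob (Y ⁻¹' {y}) with hp
  have hp0 : 0 < p := div_pos hx hy0
  have hp1 : p < 1 := (div_lt_one hy0).2 hy
  obtain ⟨B, hB, hBXY⟩ := exists_indep_event (hY.prodMk hX) hp0.le hp1.le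
  have hB' := prob_preimage_inter_of_singleton (hY.prodMk hX) hB hp0.le hBXY
  -- `E` has conditional probability `p` on every atom of `Y`: on `Y = y` by the choice of `p`,
  -- elsewhere because `B` is a coin of bias `p` independent of `(Y, X)`.
  set E : Set Ω := (Y ⁻¹' {y} ∩ X ⁻¹' {x}) ∪ (Y ⁻¹' {y})ᶜ ∩ B with hEdef
  clear_value E
  have hE : NullMeasurableSet E (volume : Measure Ω) := hEdef ▸
    ((hY _).inter hA).union ((hY _).compl.inter hB)
  have hYE : ∀ y', prob (Y ⁻¹' {y'} ∩ E) = p * prob (Y ⁻¹' {y'}) := by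
    intro y'
    by_cases hyy : y' = y
    · subst hyy
      have : Y ⁻¹' {y'} ∩ E = Y ⁻¹' {y'} ∩ X ⁻¹' {x} := by
        ext ω
        simp only [hEdef, Set.mem_inter_iff, Set.mem_union, Set.mem_compl_iff]
        tauto
      rw [this, hp, div_mul_cancel₀ _ hy0.ne']
    · have := hB' {q | q.1 = y'}
      convert this using 2
      · ext ω
        simp only [hEdef, Set.mem_inter_iff, Set.mem_union, Set.mem_compl_iff, Set.mem_preimage,
          Set.mem_singleton_iff, Set.mem_ofPred_eq]
        constructor
        · rintro ⟨h1, h2 | h2⟩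
          · exact absurd (h1.symm.trans h2.1) hyy
          · exact ⟨h1, h2.2⟩
        · rintro ⟨h1, h2⟩
          exact ⟨h1, Or.inr ⟨fun h3 => hyy (h1.symm.trans h3), h2⟩⟩
      · rfl
  obtain ⟨U, hU⟩ := (discrete_decide hE).exists_rv
  have hUX := (h U ((ind_decide hY hE hp0.le hYE).symm.of_functionOf_left hU.1)).of_functionOf_left
    hU.2
  have h1 := hUX {true} {x}
  have hpE : prob E = p := by
    simpa [prob_univ] using prob_preimage_inter_of_singleton hY hE hp0.le hYE Set.univ
  rw [preimage_decide_true, hpE, ← prob_inter_add_diff (E ∩ X ⁻¹' {x}) (hY {y}),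
    ← prob_inter_add_diff (X ⁻¹' {x}) (hY {y})] at h1
  have h3 : (E ∩ X ⁻¹' {x}) ∩ Y ⁻¹' {y} = X ⁻¹' {x} ∩ Y ⁻¹' {y} := by
    ext ω
    simp only [hEdef, Set.mem_inter_iff, Set.mem_union, Set.mem_compl_iff]
    tauto
  have h4 : prob ((E ∩ X ⁻¹' {x}) \ Y ⁻¹' {y}) = p * prob (X ⁻¹' {x} \ Y ⁻¹' {y}) := by
    have := hB' {q | q.1 ≠ y ∧ q.2 = x}
    convert this using 2
    · ext ω
      simp only [hEdef, Set.mem_inter_iff, Set.mem_union, Set.mem_compl_iff, Set.mem_preimage,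
        Set.mem_singleton_iff, Set.mem_ofPred_eq, Set.mem_sdiff]
      tauto
    · congr 1
      ext ω
      simp only [Set.mem_preimage, Set.mem_singleton_iff, Set.mem_ofPred_eq, Set.mem_sdiff]
      tauto
  rw [h3, h4, Set.inter_comm] at h1
  -- Independence of `E` and `X = x` would now read `(1 - p) P(X = x, Y = y) = 0`, although both
  -- factors are positive.
  nlinarith

end functionOf

/-! ## Semantics of the basic formulas -/

section semantics

variable {n : ℕ} (v : Fin n → RV)

lemma holds_inf (φ ψ : Fml n) : Holds (φ ⊓ ψ) v ↔ Holds φ v ∧ Holds ψ v :=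
  BoundedFormula.realize_inf

lemma holds_sup (φ ψ : Fml n) : Holds (φ ⊔ ψ) v ↔ Holds φ v ∨ Holds ψ v :=
  BoundedFormula.realize_sup

lemma holds_imp (φ ψ : Fml n) : Holds (φ.imp ψ) v ↔ (Holds φ v → Holds ψ v) :=
  BoundedFormula.realize_imp

lemma holds_not (φ : Fml n) : Holds φ.not v ↔ ¬ Holds φ v :=
  BoundedFormula.realize_not

lemma holds_bot : Holds (⊥ : Fml n) v ↔ False := Iff.rfl

lemma holds_ex (φ : Fin (n + 1) → Fml (n + 1)) :
    Holds (ex φ) v ↔ ∃ U : RV, Holds (φ (Fin.last n)) (Fin.snoc (α := fun _ => RV) v U) :=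
  BoundedFormula.realize_ex

lemma holds_all (φ : Fin (n + 1) → Fml (n + 1)) :
    Holds (all φ) v ↔ ∀ U : RV, Holds (φ (Fin.last n)) (Fin.snoc (α := fun _ => RV) v U) :=
  BoundedFormula.realize_all

lemma snoc_up (U : RV) (x : Fin n) : (Fin.snoc (α := fun _ => RV) v U : Fin (n + 1) → RV) (up x) = v x :=
  Fin.snoc_castSucc (α := fun _ => RV) U v x

lemma snoc_last (U : RV) : (Fin.snoc (α := fun _ => RV) v U : Fin (n + 1) → RV) (Fin.last n) = U :=
  Fin.snoc_last (α := fun _ => RV) U v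

lemma holds_ind (x y : Fin n) : Holds (ind x y) v ↔ Ind (v x) (v y) := by
  rw [ind_iff_indepFun, Holds, ind, BoundedFormula.realize_rel₂]
  rfl

lemma ind_self_iff (X : RV) : Ind X X ↔ ∃ a, prob (X ⁻¹' {a}) = 1 := by
  constructor
  · intro h
    obtain ⟨a, ha⟩ := exists_prob_inter_pos X (s := Set.univ) (by rw [prob_univ]; exact one_pos)
    rw [Set.univ_inter] at ha
    refine ⟨a, ?_⟩
    have := h {a} {a}
    rw [Set.inter_self] at this
    exact (mul_left_cancel₀ ha.ne' (by rw [mul_one]; exact this)).symm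
  · rintro ⟨a, ha⟩
    have hae : ∀ᵐ ω ∂(volume : Measure Ω), X ω = a := by
      rw [prob, measureReal_def, ENNReal.toReal_eq_one_iff] at ha
      exact (prob_compl_eq_zero_iff₀ (X.discrete {a})).2 ha
    have hind : Ind (fun _ : Ω => ()) X := by
      intro s t
      by_cases hs : () ∈ s
      · have : (fun _ : Ω => ()) ⁻¹' s = Set.univ := by ext; simp [hs]
        rw [this, Set.univ_inter, prob_univ, one_mul]
      · have : (fun _ : Ω => ()) ⁻¹' s = ∅ := by ext; simp [hs]
        rw [this, Set.empty_inter]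
        simp [prob]
    exact hind.of_functionOf_left ⟨fun _ => a, hae⟩

lemma holds_const (x : Fin n) : Holds (const x) v ↔ Ind (v x) (v x) := holds_ind v x x

lemma holds_le (x y : Fin n) : Holds (le x y) v ↔ FunctionOf (v x) (v y) := by
  simp only [le, holds_all, holds_imp, holds_ind, snoc_up, snoc_last]
  exact ⟨fun h => functionOf_of_forall_ind (v x).discrete (v y).discrete h,
    fun h U hU => hU.of_functionOf (.refl _) h⟩

lemma holds_equiv (x y : Fin n) : Holds (equiv x y) v ↔ InfoEquiv (v x) (v y) := by
  simp only [equiv, holds_inf, holds_le, InfoEquiv]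

lemma holds_lt (x y : Fin n) :
    Holds (lt x y) v ↔ FunctionOf (v x) (v y) ∧ ¬ FunctionOf (v y) (v x) := by
  simp only [lt, holds_inf, holds_not, holds_le]

/-- The pair, encoded as an element of `RV`, is itself an upper bound of `x` and `y`, so a least
upper bound must be equivalent to it. -/
lemma holds_joint (x y z : Fin n) :
    Holds (joint x y z) v ↔ InfoEquiv (v z) fun ω => (v x ω, v y ω) := by
  simp only [joint, holds_inf, holds_all, holds_imp, holds_le, snoc_up, snoc_last]
  constructor
  · rintro ⟨⟨hx, hy⟩, h⟩
    obtain ⟨U, hU⟩ := ((v x).discrete.prodMk (v y).discrete).exists_rv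
    exact ⟨(h U ⟨(functionOf_prod_left _ _).trans hU.2, (functionOf_prod_right _ _).trans hU.2⟩).trans
      hU.1, hx.prodMk hy⟩
  · intro h
    exact ⟨⟨(functionOf_prod_left _ _).trans h.2, (functionOf_prod_right _ _).trans h.2⟩,
      fun U hU => h.1.trans (hU.1.prodMk hU.2)⟩

lemma holds_leJoint (x y z : Fin n) :
    Holds (leJoint x y z) v ↔ FunctionOf (v x) fun ω => (v y ω, v z ω) := by
  simp only [leJoint, holds_ex, holds_inf, holds_joint, holds_le, snoc_up, snoc_last]
  constructor
  · rintro ⟨W, hW, h⟩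
    exact h.trans hW.1
  · intro h
    obtain ⟨U, hU⟩ := ((v y).discrete.prodMk (v z).discrete).exists_rv
    exact ⟨U, hU, h.trans hU.2⟩

lemma holds_leJoint₃ (x a b c : Fin n) :
    Holds (leJoint₃ x a b c) v ↔ FunctionOf (v x) fun ω => ((v a ω, v b ω), v c ω) := by
  simp only [leJoint₃, holds_ex, holds_inf, holds_joint, holds_leJoint, snoc_up, snoc_last]
  constructor
  · rintro ⟨W, hW, h⟩
    exact h.trans (hW.1.prod_congr (.refl _))
  · intro h
    obtain ⟨U, hU⟩ := ((v a).discrete.prodMk (v b).discrete).exists_rv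
    exact ⟨U, hU, h.trans (hU.2.prod_congr (.refl _))⟩

lemma holds_ind₃ (x y z : Fin n) :
    Holds (ind₃ x y z) v ↔ Ind (v y) (v x) ∧ Ind (v z) fun ω => (v x ω, v y ω) := by
  simp only [ind₃, holds_ex, holds_inf, holds_joint, holds_ind, snoc_up, snoc_last]
  refine and_congr_right fun _ => ⟨?_, fun h => ?_⟩
  · rintro ⟨W, hW, h⟩
    exact h.of_functionOf (.refl _) hW.2
  · obtain ⟨U, hU⟩ := ((v x).discrete.prodMk (v y).discrete).exists_rv
    exact ⟨U, hU, h.of_functionOf (.refl _) hU.1⟩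

end semantics

/-! ## Uniform variables -/

lemma RV.pmf_eq (X : RV) (a : ℕ+) : X.pmf a = prob (X ⁻¹' {a}) := rfl

lemma RV.ae_mem_supp (X : RV) : ∀ᵐ ω ∂(volume : Measure Ω), X ω ∈ X.supp := ae_prob_pos X

lemma RV.supp_nonempty (X : RV) : X.supp.Nonempty := by
  obtain ⟨ω, -, h⟩ := exists_of_prob_pos (s := Set.univ) (by rw [prob_univ]; exact one_pos)
    X.ae_mem_supp
  exact ⟨_, h⟩

lemma RV.prob_preimage_finset (X : RV) (T : Finset ℕ+) :
    prob (X ⁻¹' T) = ∑ a ∈ T, X.pmf a := by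
  classical
  induction T using Finset.induction_on with
  | empty => simp [prob]
  | insert a T ha ih =>
    rw [Finset.sum_insert ha, ← ih, ← prob_inter_add_diff _ (X.discrete {a}), RV.pmf_eq]
    congr 2
    · ext ω; simp +contextual
    · ext ω
      simp only [Finset.coe_insert, Set.mem_sdiff, Set.mem_preimage, Set.mem_insert_iff,
        Finset.mem_coe, Set.mem_singleton_iff]
      constructor
      · rintro ⟨h1 | h1, h2⟩
        · exact absurd h1 h2
        · exact h1
      · intro h
        exact ⟨Or.inr h, fun h2 => ha (h2 ▸ h)⟩

lemma RV.sum_pmf_of_supp (X : RV) (T : Finset ℕ+) (hT : X.supp = T) : ∑ a ∈ T, X.pmf a = 1 := by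
  rw [← X.prob_preimage_finset, ← prob_univ]
  refine prob_congr ?_
  filter_upwards [X.ae_mem_supp] with ω hω
  rw [hT] at hω
  simpa using hω

/-- At most `1/p` disjoint events can have probability `p`, so the support is finite; the total mass
then fixes `p`. -/
lemma RV.exists_isUnif_of_const (X : RV) {p : ℝ} (hp : 0 < p) (h : ∀ a ∈ X.supp, X.pmf a = p) :
    ∃ n : ℕ, X.IsUnif n ∧ p = 1 / n := by
  have hfin : X.supp.Finite := by
    by_contra hinf
    obtain ⟨N, hN⟩ := exists_nat_gt (1 / p)
    obtain ⟨T, hT, hTc⟩ := Set.Infinite.exists_subset_card_eq hinf N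
    have h1 : prob (X ⁻¹' T) ≤ 1 := by rw [← prob_univ]; exact prob_mono (Set.subset_univ _)
    rw [X.prob_preimage_finset, Finset.sum_congr rfl fun a ha => h a (hT ha), Finset.sum_const,
      hTc, nsmul_eq_mul] at h1
    rw [div_lt_iff₀ hp] at hN
    linarith
  have h1 := X.sum_pmf_of_supp hfin.toFinset (by simp)
  rw [Finset.sum_congr rfl fun a ha => h a (by simpa using ha), Finset.sum_const, nsmul_eq_mul] at h1
  have h2 : p = 1 / hfin.toFinset.card := eq_one_div_of_mul_eq_one_right h1
  refine ⟨hfin.toFinset.card, ⟨?_, fun a ha => (h a ha).trans h2⟩, h2⟩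
  rw [RV.card, hfin.encard_eq_coe_toFinset_card]

lemma not_isUnif_zero (X : RV) : ¬ X.IsUnif 0 := by
  rintro ⟨h, -⟩
  rw [RV.card, Nat.cast_zero, Set.encard_eq_zero] at h
  exact X.supp_nonempty.ne_empty h

lemma RV.IsUnif.pos {X : RV} {n : ℕ} (h : X.IsUnif n) : 0 < n :=
  Nat.pos_of_ne_zero fun h0 => not_isUnif_zero X (h0 ▸ h)

lemma RV.IsUnif.unique {X : RV} {m n : ℕ} (h : X.IsUnif m) (h' : X.IsUnif n) : m = n :=
  Nat.cast_injective (R := ℕ∞) (h.1.symm.trans h'.1)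

/-- This frees the choice of labels: `ZMod n` to have addition, a product to split off coordinates,
a sum type to have two sides. -/
lemma RV.IsUnif.exists_unifOn {X : RV} {n : ℕ} (h : X.IsUnif n) {α : Type} [Fintype α]
    (hα : Fintype.card α = n) :
    ∃ U : Ω → α, Discrete U ∧ UnifOn U ∧ InfoEquiv X U := by
  classical
  have hfin : X.supp.Finite := Set.finite_of_encard_eq_coe h.1
  let _ := hfin.fintype
  have hc : Fintype.card X.supp = Fintype.card α := by
    have := h.1
    rw [RV.card, Set.encard_eq_coe_toFinset_card, Nat.cast_inj, Set.toFinset_card] at this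
    rw [this, hα]
  let e := Fintype.equivOfCardEq hc
  obtain ⟨a0, ha0⟩ := X.supp_nonempty
  let g : ℕ+ → α := fun a => if ha : a ∈ X.supp then e ⟨a, ha⟩ else e ⟨a0, ha0⟩
  refine ⟨fun ω => g (X ω), X.discrete.comp g, fun i => ?_, ⟨fun i => e.symm i, ?_⟩,
    functionOf_comp _ _⟩
  · rw [hα, ← h.2 (e.symm i) (e.symm i).2, RV.pmf_eq]
    refine prob_congr ?_
    filter_upwards [X.ae_mem_supp] with ω hω
    simp only [Set.mem_preimage, Set.mem_singleton_iff, g, dif_pos hω]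
    rw [← Equiv.eq_symm_apply, Subtype.ext_iff]
  · filter_upwards [X.ae_mem_supp] with ω hω
    simp [g, dif_pos hω]

lemma isUnif_of_unifOn {X : RV} {α : Type} [Fintype α] {U : Ω → α} (hU : UnifOn U)
    (h : InfoEquiv X U) : X.IsUnif (Fintype.card α) := by
  obtain ⟨⟨f, hf⟩, ⟨g, hg⟩⟩ := h
  -- Every value `i` has positive probability, so an identity that holds almost surely holds at each
  -- `i`.
  have hgf : ∀ i, g (f i) = i := by
    intro i
    obtain ⟨ω, hω, h1, h2⟩ := exists_of_prob_pos (hU.prob_pos i) (hf.and hg)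
    rw [← Set.mem_singleton_iff.1 hω, ← h1, ← h2]
  have hpmf : ∀ i, X.pmf (f i) = 1 / Fintype.card α := by
    intro i
    rw [RV.pmf_eq, ← hU i]
    refine prob_congr ?_
    filter_upwards [hf, hg] with ω h1 h2
    simp only [Set.mem_preimage, Set.mem_singleton_iff]
    constructor
    · intro h3
      rw [h2, h3, hgf]
    · intro h3
      rw [h1, h3]
  have hsupp : X.supp = Set.range f := by
    ext a
    constructor
    · intro ha
      obtain ⟨ω, hω, h1⟩ := exists_of_prob_pos (s := X ⁻¹' {a}) ha hf
      exact ⟨U ω, h1.symm.trans hω⟩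
    · rintro ⟨i, rfl⟩
      show 0 < X.pmf (f i)
      rw [hpmf i, ← hU i]
      exact hU.prob_pos i
  refine ⟨?_, fun a ha => ?_⟩
  · have hinj : Function.Injective f := Function.LeftInverse.injective hgf
    rw [RV.card, hsupp, ← Set.image_univ, hinj.encard_image, Set.encard_univ,
      ENat.card_eq_coe_fintype_card]
  · rw [hsupp] at ha
    obtain ⟨i, rfl⟩ := ha
    exact hpmf i

/-- Pairwise independent variables each of which is a function of the other two. -/
def Triple (X Y Z : RV) : Prop :=
  (FunctionOf X fun ω => (Y ω, Z ω)) ∧ (FunctionOf Y fun ω => (X ω, Z ω)) ∧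
    (FunctionOf Z fun ω => (X ω, Y ω)) ∧ Ind X Y ∧ Ind X Z ∧ Ind Y Z

lemma holds_triple {n : ℕ} (v : Fin n → RV) (x y z : Fin n) :
    Holds (triple x y z) v ↔ Triple (v x) (v y) (v z) := by
  simp only [triple, holds_inf, holds_leJoint, holds_ind, Triple]
  tauto

lemma FunctionOf.prod_swap {α β γ : Type} {X : Ω → α} {Y : Ω → β} {Z : Ω → γ}
    (h : FunctionOf X fun ω => (Y ω, Z ω)) : FunctionOf X fun ω => (Z ω, Y ω) :=
  h.trans ((functionOf_prod_right _ _).prodMk (functionOf_prod_left _ _))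

lemma Triple.swap₁₂ {X Y Z : RV} (h : Triple X Y Z) : Triple Y X Z :=
  ⟨h.2.1, h.1, h.2.2.1.prod_swap, h.2.2.2.1.symm, h.2.2.2.2.2, h.2.2.2.2.1⟩

lemma Triple.swap₂₃ {X Y Z : RV} (h : Triple X Y Z) : Triple X Z Y :=
  ⟨h.1.prod_swap, h.2.2.1, h.2.1, h.2.2.2.2.1, h.2.2.2.1, h.2.2.2.2.2.symm⟩

/-- Given `X = x`, each of `Y`, `Z` determines the other, so the events `X = x, Y = y` and `X = x, Z
= z` coincide almost surely. Independence lets the common factor `P(X = x)` cancel. -/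
lemma Triple.prob_eq {X Y Z : RV} (h : Triple X Y Z) {x y z : ℕ+}
    (hpos : 0 < prob ((X ⁻¹' {x} ∩ Y ⁻¹' {y}) ∩ Z ⁻¹' {z})) :
    prob (Y ⁻¹' {y}) = prob (Z ⁻¹' {z}) := by
  obtain ⟨-, ⟨f, hf⟩, ⟨g, hg⟩, hXY, hXZ, -⟩ := h
  obtain ⟨ω, ⟨⟨h1, h2⟩, h3⟩, h4, h5⟩ := exists_of_prob_pos hpos (hf.and hg)
  simp only [Set.mem_preimage, Set.mem_singleton_iff] at h1 h2 h3
  dsimp only at h4 h5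
  rw [h1, h2, h3] at h4 h5
  have hx : 0 < prob (X ⁻¹' {x}) := hpos.trans_le (prob_mono fun ω hω => hω.1.1)
  refine mul_left_cancel₀ hx.ne' ?_
  rw [← hXY, ← hXZ]
  refine prob_congr ?_
  filter_upwards [hf, hg] with ω h6 h7
  simp only [Set.mem_inter_iff, Set.mem_preimage, Set.mem_singleton_iff]
  constructor
  · rintro ⟨h8, h9⟩
    exact ⟨h8, by rw [h7, h8, h9, h5]⟩
  · rintro ⟨h8, h9⟩
    exact ⟨h8, by rw [h6, h8, h9, h4]⟩

/-- Independence makes any two atoms of `X` and `Y` meet, and a value of `Z` occurring there has the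
mass of both. -/
lemma Triple.prob_eq_of_pos {X Y Z : RV} (h : Triple X Y Z) {x y : ℕ+}
    (hx : 0 < prob (X ⁻¹' {x})) (hy : 0 < prob (Y ⁻¹' {y})) :
    prob (X ⁻¹' {x}) = prob (Y ⁻¹' {y}) := by
  have hxy : 0 < prob (X ⁻¹' {x} ∩ Y ⁻¹' {y}) := by
    rw [h.2.2.2.1]
    exact mul_pos hx hy
  obtain ⟨z, hz⟩ := exists_prob_inter_pos Z hxy
  have h1 := h.prob_eq hz
  rw [Set.inter_comm (X ⁻¹' {x})] at hz
  exact (h.swap₁₂.prob_eq hz).trans h1.symm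

lemma Triple.isUnif {X Y Z : RV} (h : Triple X Y Z) :
    ∃ n : ℕ, X.IsUnif n ∧ Y.IsUnif n ∧ Z.IsUnif n := by
  obtain ⟨x, hx⟩ := X.supp_nonempty
  obtain ⟨y, hy⟩ := Y.supp_nonempty
  have hxy := h.prob_eq_of_pos hx hy
  obtain ⟨n, hn, hpn⟩ := X.exists_isUnif_of_const hx fun a ha =>
    (h.prob_eq_of_pos ha hy).trans hxy.symm
  obtain ⟨m, hm, hpm⟩ := Y.exists_isUnif_of_const hx fun a ha => (h.prob_eq_of_pos hx ha).symm
  obtain ⟨k, hk, hpk⟩ := Z.exists_isUnif_of_const hx fun a ha =>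
    (h.swap₂₃.prob_eq_of_pos hx ha).symm
  have hnm : n = m := by
    have := hpn.symm.trans hpm
    rw [one_div, one_div, inv_inj] at this
    exact_mod_cast this
  have hnk : n = k := by
    have := hpn.symm.trans hpk
    rw [one_div, one_div, inv_inj] at this
    exact_mod_cast this
  exact ⟨n, hn, hnm ▸ hm, hnk ▸ hk⟩

/-- The sum modulo `n` of independent uniform variables completes them to a triple. -/
lemma exists_triple {X U : RV} {n : ℕ} (hX : X.IsUnif n) (hU : U.IsUnif n) (h : Ind X U) :
    ∃ Z, Triple X U Z := by
  have : NeZero n := ⟨hX.pos.ne'⟩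
  obtain ⟨X', hX', hX'u, hXX'⟩ := hX.exists_unifOn (ZMod.card n)
  obtain ⟨U', hU', hU'u, hUU'⟩ := hU.exists_unifOn (ZMod.card n)
  have hind : Ind X' U' := h.of_functionOf hXX'.2 hUU'.2
  have hun := hX'u.prodMk hU'u hind
  -- Shears are bijections, so each summand paired with the sum is again uniform on the product,
  -- hence independent of it.
  let e₁ : ZMod n × ZMod n ≃ ZMod n × ZMod n :=
    ⟨fun p => (p.1, p.1 + p.2), fun p => (p.1, p.2 - p.1), fun p => by simp, fun p => by simp⟩
  let e₂ : ZMod n × ZMod n ≃ ZMod n × ZMod n :=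
    ⟨fun p => (p.2, p.1 + p.2), fun p => (p.2 - p.1, p.1), fun p => by simp, fun p => by simp⟩
  have hS : Discrete fun ω => X' ω + U' ω := (hX'.prodMk hU').comp fun p => p.1 + p.2
  obtain ⟨Z, hZ⟩ := hS.exists_rv
  have hXZ : Ind X' fun ω => X' ω + U' ω := (hun.equiv e₁).ind hX' hS
  have hUZ : Ind U' fun ω => X' ω + U' ω := (hun.equiv e₂).ind hU' hS
  refine ⟨Z, ?_, ?_, ?_, h, hXZ.of_functionOf hXX'.1 hZ.1, hUZ.of_functionOf hUU'.1 hZ.1⟩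
  · refine hXX'.1.trans (FunctionOf.trans ?_ (hUU'.2.prod_congr hZ.2))
    exact ⟨fun p => p.2 - p.1, .of_forall fun ω => by simp⟩
  · refine hUU'.1.trans (FunctionOf.trans ?_ (hXX'.2.prod_congr hZ.2))
    exact ⟨fun p => p.2 - p.1, .of_forall fun ω => by simp⟩
  · refine hZ.1.trans (FunctionOf.trans ?_ (hXX'.2.prod_congr hUU'.2))
    exact ⟨fun p => p.1 + p.2, .of_forall fun ω => rfl⟩

lemma exists_isUnif_ind {α : Type} [Countable α] {X : Ω → α} (hX : Discrete X) {n : ℕ}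
    (hn : 0 < n) : ∃ U : RV, U.IsUnif n ∧ Ind X U := by
  have : NeZero n := ⟨hn.ne'⟩
  obtain ⟨U', hU', hu, hi⟩ := exists_indep_unif hX (Fin n)
  obtain ⟨U, hU⟩ := hU'.exists_rv
  refine ⟨U, ?_, hi.of_functionOf (.refl _) hU.1⟩
  have := isUnif_of_unifOn hu hU
  rwa [Fintype.card_fin] at this

/-! ### Meaning of the formulas about uniform variables. -/

section semantics

variable {n : ℕ} (v : Fin n → RV)

lemma holds_unif (x : Fin n) : Holds (unif x) v ↔ ∃ k : ℕ, (v x).IsUnif k := by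
  simp only [unif, holds_ex, holds_triple, snoc_up, snoc_last]
  constructor
  · rintro ⟨Y, Z, h⟩
    obtain ⟨k, hk, -⟩ := h.isUnif
    exact ⟨k, hk⟩
  · rintro ⟨k, hk⟩
    obtain ⟨U, hU, hi⟩ := exists_isUnif_ind (v x).discrete hk.pos
    exact ⟨U, exists_triple hk hU hi⟩

/-- The two variables may be dependent and so need not fit into one triple. They are compared
through a third, taken uniform of the same size and independent of the pair. -/
lemma holds_ueq (x y : Fin n) :
    Holds (ueq x y) v ↔ ∃ k : ℕ, (v x).IsUnif k ∧ (v y).IsUnif k := by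
  simp only [ueq, holds_ex, holds_inf, holds_triple, snoc_up, snoc_last]
  constructor
  · rintro ⟨U, V, W, h, h'⟩
    obtain ⟨k, hk, hU, -⟩ := h.isUnif
    obtain ⟨m, hm, hU', -⟩ := h'.isUnif
    exact ⟨k, hk, hU.unique hU' ▸ hm⟩
  · rintro ⟨k, hk, hk'⟩
    obtain ⟨U, hU, hi⟩ := exists_isUnif_ind ((v x).discrete.prodMk (v y).discrete) hk.pos
    obtain ⟨V, hV⟩ := exists_triple hk hU (hi.of_functionOf_left (functionOf_prod_left _ _))
    obtain ⟨W, hW⟩ := exists_triple hk' hU (hi.of_functionOf_left (functionOf_prod_right _ _))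
    exact ⟨U, V, W, hV, hW⟩

lemma isUnif_prod {X Y Z : RV} {a b : ℕ} (hX : X.IsUnif a) (hY : Y.IsUnif b) (h : Ind X Y)
    (hZ : InfoEquiv Z fun ω => (X ω, Y ω)) : Z.IsUnif (a * b) := by
  obtain ⟨X', hX', hX'u, hXX'⟩ := hX.exists_unifOn (Fintype.card_fin a)
  obtain ⟨Y', hY', hY'u, hYY'⟩ := hY.exists_unifOn (Fintype.card_fin b)
  have := isUnif_of_unifOn (hX'u.prodMk hY'u (h.of_functionOf hXX'.2 hYY'.2))
    (hZ.trans (hXX'.prod_congr hYY'))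
  simpa using this

/-- For the converse, `z` is labelled by `Fin a × Fin b`; the coordinates of the label are the
independent copies of `x` and `y`. -/
lemma holds_uprod (x y z : Fin n) : Holds (uprod x y z) v ↔
    ∃ a b : ℕ, (v x).IsUnif a ∧ (v y).IsUnif b ∧ (v z).IsUnif (a * b) := by
  simp only [uprod, holds_ex, holds_inf, holds_ueq, holds_ind, holds_joint, snoc_up, snoc_last]
  constructor
  · rintro ⟨A, B, ⟨⟨⟨a, ha, hA⟩, ⟨b, hb, hB⟩⟩, hi⟩, hj⟩
    exact ⟨a, b, ha, hb, isUnif_prod hA hB hi hj⟩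
  · rintro ⟨a, b, ha, hb, hab⟩
    obtain ⟨P, hP, hPu, hPZ⟩ := hab.exists_unifOn (α := Fin a × Fin b) (by simp)
    obtain ⟨A, hA⟩ := (hP.comp Prod.fst).exists_rv
    obtain ⟨B, hB⟩ := (hP.comp Prod.snd).exists_rv
    have hPu' : UnifOn fun ω => ((P ω).1, (P ω).2) := hPu
    have hAu := isUnif_of_unifOn (hPu'.fst (hP.comp Prod.snd)) hA
    have hBu := isUnif_of_unifOn (hPu'.snd (hP.comp Prod.fst)) hB
    rw [Fintype.card_fin] at hAu hBu
    exact ⟨A, B, ⟨⟨⟨a, ha, hAu⟩, ⟨b, hb, hBu⟩⟩,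
      (hPu'.ind (hP.comp Prod.fst) (hP.comp Prod.snd)).of_functionOf hA.1 hB.1⟩,
      hPZ.trans (hA.prod_congr hB).symm⟩

end semantics

/-! ## Order and cardinalities -/

section card

variable {α β : Type}

/-- The image of a random variable under a relabelling of the values. -/
def RV.map (g : ℕ+ → ℕ+) (X : RV) : RV := ⟨fun ω => g (X ω), fun s _ => X.discrete (g ⁻¹' s)⟩

lemma RV.functionOf_map (g : ℕ+ → ℕ+) (X : RV) : FunctionOf (X.map g) X := functionOf_comp _ g

lemma RV.supp_subset_of_ae {X : RV} {S : Set ℕ+}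
    (h : ∀ᵐ ω ∂(volume : Measure Ω), X ω ∈ S) : X.supp ⊆ S := by
  intro a ha
  obtain ⟨ω, hω, h1⟩ := exists_of_prob_pos (s := X ⁻¹' {a}) ha h
  rwa [Set.mem_singleton_iff.1 hω] at h1

lemma RV.supp_map (g : ℕ+ → ℕ+) (X : RV) : (X.map g).supp = g '' X.supp := by
  refine (RV.supp_subset_of_ae ?_).antisymm ?_
  · filter_upwards [X.ae_mem_supp] with ω hω
    exact ⟨_, hω, rfl⟩
  · rintro _ ⟨x, hx, rfl⟩
    exact lt_of_lt_of_le (show 0 < prob (X ⁻¹' {x}) from hx) (prob_mono fun ω hω => by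
      rw [Set.mem_preimage, Set.mem_singleton_iff] at hω ⊢
      exact congrArg g hω)

lemma RV.card_le_of_functionOf [Fintype α] {X : RV} {U : Ω → α} (h : FunctionOf X U) :
    X.card ≤ Fintype.card α := by
  obtain ⟨f, hf⟩ := h
  have : X.supp ⊆ Set.range f := RV.supp_subset_of_ae <| by
    filter_upwards [hf] with ω hω
    exact ⟨_, hω.symm⟩
  refine (Set.encard_le_encard this).trans ?_
  rw [← Set.image_univ]
  refine (Set.encard_image_le _ _).trans ?_
  rw [Set.encard_univ, ENat.card_eq_coe_fintype_card]

lemma RV.card_eq_of_pos [Fintype α] {X : RV} {U : Ω → α} (h : InfoEquiv X U)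
    (hpos : ∀ i, 0 < prob (U ⁻¹' {i})) : X.card = Fintype.card α := by
  refine le_antisymm (RV.card_le_of_functionOf h.1) ?_
  obtain ⟨⟨f, hf⟩, ⟨g, hg⟩⟩ := h
  have hgf : Function.LeftInverse g f := by
    intro i
    obtain ⟨ω, hω, h1, h2⟩ := exists_of_prob_pos (hpos i) (hf.and hg)
    rw [← Set.mem_singleton_iff.1 hω, ← h1, ← h2]
  have : Set.range f ⊆ X.supp := by
    rintro _ ⟨i, rfl⟩
    refine (hpos i).trans_le ?_
    rw [RV.pmf_eq]
    refine ENNReal.toReal_mono (measure_ne_top _ _) (measure_mono_ae ?_)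
    filter_upwards [hf] with ω hω h1
    exact hω.trans (congrArg f h1)
  refine le_trans ?_ (Set.encard_le_encard this)
  rw [← Set.image_univ, hgf.injective.encard_image, Set.encard_univ, ENat.card_eq_coe_fintype_card]

lemma RV.functionOf_of_injOn {X : RV} {U : Ω → α} {g : ℕ+ → α}
    (hg : ∀ᵐ ω ∂(volume : Measure Ω), U ω = g (X ω)) (hinj : Set.InjOn g X.supp) :
    FunctionOf X U := by
  refine ⟨Function.invFunOn g X.supp, ?_⟩
  filter_upwards [hg, X.ae_mem_supp] with ω h1 h2
  rw [h1]
  exact (hinj.leftInvOn_invFunOn h2).symm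

/-- A surjection from a finite support onto one at least as large is injective, so a coarsening that
loses no value could be inverted. -/
lemma RV.card_le_of_lt {X U : RV} {N : ℕ} (h : FunctionOf U X) (h' : ¬ FunctionOf X U)
    (hX : X.card ≤ (N + 1 : ℕ)) : U.card ≤ N := by
  obtain ⟨g, hg⟩ := h
  by_contra hlt
  rw [not_le, ← Order.add_one_le_iff_of_not_isMax (by simp)] at hlt
  have hfin : X.supp.Finite := Set.finite_of_encard_le_coe hX
  have hsub : U.supp ⊆ g '' X.supp := RV.supp_subset_of_ae <| by
    filter_upwards [hg, X.ae_mem_supp] with ω h1 h2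
    exact ⟨_, h2, h1.symm⟩
  refine h' (RV.functionOf_of_injOn hg (hfin.injOn_of_encard_image_eq ?_))
  exact (Set.encard_image_le _ _).antisymm
    ((hX.trans (by exact_mod_cast hlt)).trans (Set.encard_le_encard hsub))

lemma RV.exists_coarsening {X : RV} {N : ℕ} (hN : 0 < N) (h : (N : ℕ∞) < X.card) :
    ∃ U : RV, FunctionOf U X ∧ ¬ FunctionOf X U ∧ U.card = N := by
  classical
  obtain ⟨T, hT, hTc⟩ := Set.exists_subset_encard_eq (show (N : ℕ∞) ≤ X.supp.encard from h.le)
  have hne : T.Nonempty := by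
    rw [← Set.encard_pos, hTc]
    exact_mod_cast hN
  obtain ⟨t, ht⟩ := hne
  obtain ⟨y, hy, hyT⟩ : ∃ y ∈ X.supp, y ∉ T := by
    by_contra! hsub
    exact absurd (Set.encard_le_encard hsub) (not_le.2 (hTc ▸ h))
  -- All values outside `T` are merged into `t`. Since `y ∉ T` then becomes indistinguishable from
  -- `t`, the coarsening is strict.
  set g : ℕ+ → ℕ+ := fun x => if x ∈ T then x else t with hg
  refine ⟨X.map g, X.functionOf_map g, ?_, ?_⟩
  · rintro ⟨f, hf⟩
    obtain ⟨ω, hω, h1⟩ := exists_of_prob_pos (s := X ⁻¹' {y}) hy hf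
    obtain ⟨ω', hω', h1'⟩ := exists_of_prob_pos (s := X ⁻¹' {t}) (hT ht) hf
    rw [Set.mem_preimage, Set.mem_singleton_iff] at hω hω'
    have e1 : g (X ω) = t := by rw [hω, hg]; simp [hyT]
    have e2 : g (X ω') = t := by rw [hω', hg]; simp
    have h2 : X ω = f (g (X ω)) := h1
    have h2' : X ω' = f (g (X ω')) := h1'
    rw [e1, hω] at h2
    rw [e2, hω'] at h2'
    exact hyT (h2.trans h2'.symm ▸ ht)
  · rw [RV.card, RV.supp_map, ← hTc]
    congr 1
    ext a
    constructor
    · rintro ⟨x, -, rfl⟩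
      by_cases hx : x ∈ T <;> simp [hg, hx, ht]
    · intro ha
      exact ⟨a, hT ha, by simp [hg, ha]⟩

lemma RV.one_le_card (X : RV) : 1 ≤ X.card := Set.one_le_encard_iff_nonempty.2 X.supp_nonempty

lemma ind_self_iff_card (X : RV) : Ind X X ↔ X.card ≤ 1 := by
  rw [ind_self_iff]
  constructor
  · rintro ⟨a, ha⟩
    have : FunctionOf X fun _ : Ω => () := by
      refine ⟨fun _ => a, ?_⟩
      rw [prob, measureReal_def, ENNReal.toReal_eq_one_iff] at ha
      exact (prob_compl_eq_zero_iff₀ (X.discrete {a})).2 ha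
    simpa using RV.card_le_of_functionOf this
  · intro h
    obtain ⟨a, ha⟩ := Set.encard_eq_one.1 (h.antisymm X.one_le_card)
    refine ⟨a, ?_⟩
    simpa [RV.pmf_eq] using X.sum_pmf_of_supp {a} (by simpa using ha)

/-- A variable with more than `k` values, even infinitely many, has a strict coarsening with exactly
`k`, for positive `k`; one with at most `k` values loses a value in every strict coarsening. -/
lemma holds_cardLE (k : ℕ) : ∀ {n : ℕ} (v : Fin n → RV) (x : Fin n),
    Holds (cardLE k x) v ↔ (v x).card ≤ k := by
  induction k with
  | zero =>
    intro n v x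
    simp only [cardLE, holds_bot, false_iff, not_le]
    exact lt_of_lt_of_le (by simp) (v x).one_le_card
  | succ k ih =>
    intro n v x
    cases k with
    | zero => simp [cardLE, holds_const, ind_self_iff_card]
    | succ k =>
      simp only [cardLE, holds_all, holds_imp, holds_lt, ih, snoc_up, snoc_last]
      constructor
      · intro h
        by_contra hlt
        obtain ⟨U, h1, h2, h3⟩ := RV.exists_coarsening (Nat.succ_pos _) (not_le.1 hlt)
        have := h U ⟨h1, h2⟩
        rw [h3, Nat.cast_le] at this
        omega
      · rintro h U ⟨h1, h2⟩
        exact RV.card_le_of_lt h1 h2 h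

variable {n : ℕ} (v : Fin n → RV)

lemma holds_cardEq (k : ℕ) (x : Fin n) : Holds (cardEq k x) v ↔ (v x).card = k := by
  simp only [cardEq, holds_inf, holds_not, holds_cardLE]
  have h1 := (v x).one_le_card
  cases k with
  -- Truncated subtraction makes the formula contradictory for `k = 0`, which is right because no
  -- support is empty.
  | zero =>
    simp only [Nat.cast_zero, nonpos_iff_eq_zero, Nat.zero_sub, and_not_self_iff, false_iff]
    intro h
    simp [h] at h1
  | succ k =>
    rw [Nat.add_sub_cancel, not_le, ← Order.add_one_le_iff_of_not_isMax (by simp)]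
    push_cast
    exact ⟨fun h => h.1.antisymm h.2, fun h => ⟨h.le, h.ge⟩⟩

lemma holds_ueqConst (k : ℕ) (x : Fin n) : Holds (ueqConst k x) v ↔ (v x).IsUnif k := by
  simp only [ueqConst, holds_inf, holds_unif, holds_cardEq]
  constructor
  · rintro ⟨⟨m, hm⟩, hk⟩
    have : m = k := Nat.cast_injective (R := ℕ∞) (hm.1.symm.trans hk)
    exact this ▸ hm
  · intro h
    exact ⟨⟨k, h⟩, h.1⟩

/-- A pair of variables with `b` values each has at most `b * b` values, so `a * b` of them force `a
≤ b`. Conversely, a second copy of `Y` can be made to carry an independent index with `a` values. -/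
lemma holds_ule (x y : Fin n) :
    Holds (ule x y) v ↔ ∃ a b : ℕ, (v x).IsUnif a ∧ (v y).IsUnif b ∧ a ≤ b := by
  simp only [ule, holds_ex, holds_inf, holds_ueq, holds_uprod, holds_leJoint, snoc_up, snoc_last]
  constructor
  · rintro ⟨G, B, ⟨⟨a, b, ha, hb, hG⟩, ⟨b', hb', hB⟩⟩, h⟩
    obtain rfl := hb.unique hb'
    refine ⟨a, b, ha, hb, ?_⟩
    obtain ⟨Y', -, -, hY'⟩ := hb.exists_unifOn (Fintype.card_fin b)
    obtain ⟨B', -, -, hB'⟩ := hB.exists_unifOn (Fintype.card_fin b)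
    have := RV.card_le_of_functionOf (h.trans (hY'.1.prod_congr hB'.1))
    rw [hG.1, Fintype.card_prod, Fintype.card_fin, Nat.cast_le] at this
    exact Nat.le_of_mul_le_mul_right this hb.pos
  · rintro ⟨a, b, ha, hb, hab⟩
    have : NeZero a := ⟨ha.pos.ne'⟩
    have : NeZero b := ⟨hb.pos.ne'⟩
    obtain ⟨Y, hY, hYu, hYe⟩ := hb.exists_unifOn (Fintype.card_fin b)
    obtain ⟨I, hI, hIu, hYI⟩ := exists_indep_unif hY (Fin a)
    have hu := hYu.prodMk hIu hYI
    let c : Fin a → Fin b := Fin.castLE hab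
    have hc : Function.Injective c := Fin.castLE_injective hab
    -- Shifting by the embedded index is a bijection, so `Y + c I` is uniform on `Fin b`;
    -- subtracting `Y` recovers the index.
    let e : Fin b × Fin a ≃ Fin b × Fin a :=
      ⟨fun p => (p.1 + c p.2, p.2), fun p => (p.1 - c p.2, p.2), fun p => by simp, fun p => by simp⟩
    have hS : Discrete fun ω => Y ω + c (I ω) := (hY.prodMk hI).comp fun p => p.1 + c p.2
    obtain ⟨G, hG⟩ := (hY.prodMk hI).exists_rv
    obtain ⟨B, hB⟩ := hS.exists_rv
    have hBu := isUnif_of_unifOn ((hu.equiv e).fst hI) hB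
    have hGu := isUnif_of_unifOn hu hG
    rw [Fintype.card_fin] at hBu
    rw [Fintype.card_prod, Fintype.card_fin, Fintype.card_fin, mul_comm] at hGu
    refine ⟨G, B, ⟨⟨a, b, ha, hb, hGu⟩, ⟨b, hb, hBu⟩⟩, ?_⟩
    refine hG.1.trans (FunctionOf.trans ?_ (hYe.2.prod_congr hB.2))
    refine (functionOf_prod_left _ _).prodMk ((FunctionOf.of_injective hc).trans ?_)
    exact ⟨fun p => p.2 - p.1, .of_forall fun ω => by simp⟩

lemma holds_ult (x y : Fin n) {a b : ℕ} (ha : (v x).IsUnif a) (hb : (v y).IsUnif b) :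
    Holds (ult x y) v ↔ a < b := by
  rw [ult, holds_not, holds_ule, ← not_le, not_iff_not]
  constructor
  · rintro ⟨b', a', hb', ha', h⟩
    rwa [ha.unique ha', hb.unique hb']
  · intro h
    exact ⟨b, a, hb, ha, h⟩

end card

/-! ## Single-mass indicators -/

section smi

variable {α β γ : Type}

/-- `V` is informationally equivalent to the event `X = a` for some `a` of positive probability. -/
def SMI (X : Ω → α) (V : Ω → β) : Prop :=
  ∃ a, 0 < prob (X ⁻¹' {a}) ∧ InfoEquiv V fun ω => X ω = a

lemma isSingleMassIndicator_iff (X Y : RV) : IsSingleMassIndicator X Y ↔ SMI X Y := by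
  classical
  refine exists_congr fun a => and_congr_right fun _ => ?_
  have : InfoEquiv (fun ω => X ω = a) (fun ω => if X ω = a then (1 : ℕ) else 0) :=
    ⟨⟨fun m => m = 1, .of_forall fun ω => by simp⟩,
      ⟨fun p => if p then 1 else 0, .of_forall fun ω => by simp⟩⟩
  constructor
  · intro h
    refine InfoEquiv.trans ?_ this.symm
    convert h
  · intro h
    convert h.trans this

lemma SMI.congr_left {X : Ω → α} {X' : Ω → γ} {V : Ω → β} (h : SMI X V) (hX : InfoEquiv X X') :
    SMI X' V := by
  obtain ⟨a, ha, hV⟩ := h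
  obtain ⟨⟨f, hf⟩, ⟨g, hg⟩⟩ := hX
  have hgf : f (g a) = a := by
    obtain ⟨ω, hω, h1, h2⟩ := exists_of_prob_pos ha (hf.and hg)
    rw [← Set.mem_singleton_iff.1 hω, ← h2, ← h1]
  have key : ∀ᵐ ω ∂(volume : Measure Ω), X ω = a ↔ X' ω = g a := by
    filter_upwards [hf, hg] with ω h1 h2
    exact ⟨fun h => h2.trans (congrArg g h), fun h => by rw [h1, h, hgf]⟩
  refine ⟨g a, ha.trans_eq (prob_congr key), hV.trans ⟨⟨id, ?_⟩, ⟨id, ?_⟩⟩⟩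
  · filter_upwards [key] with ω hω
    simp [hω]
  · filter_upwards [key] with ω hω
    simp [hω]

lemma ae_of_prob_eq_one {s : Set Ω} (hs : NullMeasurableSet s (volume : Measure Ω))
    (h : prob s = 1) : ∀ᵐ ω ∂(volume : Measure Ω), ω ∈ s := by
  rw [prob, measureReal_def, ENNReal.toReal_eq_one_iff] at h
  exact (prob_compl_eq_zero_iff₀ hs).2 h

lemma functionOf_of_ae_eq_const {X : Ω → α} {a : α} (h : ∀ᵐ ω ∂(volume : Measure Ω), X ω = a)
    (Y : Ω → β) : FunctionOf X Y := ⟨fun _ => a, h⟩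

lemma prob_add_prob_compl {s : Set Ω} (hs : NullMeasurableSet s (volume : Measure Ω)) :
    prob s + prob sᶜ = 1 := by
  have := prob_inter_add_diff Set.univ hs
  rwa [Set.univ_inter, prob_univ, ← Set.compl_eq_univ_sdiff] at this

/-- On the atom `X = a` the variable `U` is constant, and off it `Y` is constant, so `U` depends on
`V` alone: at most `1 + 2` values. -/
lemma SMI.card_le_three {X Y U V : RV} (h : SMI X Y) (hU : FunctionOf U X) (hV : V.card ≤ 2)
    (hUV : FunctionOf U fun ω => (Y ω, V ω)) : U.card ≤ 3 := by
  obtain ⟨a, -, ⟨k, hk⟩, -⟩ := h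
  obtain ⟨g, hg⟩ := hU
  obtain ⟨f, hf⟩ := hUV
  have hsub : U.supp ⊆ {g a} ∪ (fun b => f (k False, b)) '' V.supp := RV.supp_subset_of_ae <| by
    filter_upwards [hk, hg, hf, V.ae_mem_supp] with ω h1 h2 h3 h4
    by_cases hω : X ω = a
    · exact Or.inl (by rw [h2, hω]; rfl)
    · refine Or.inr ⟨V ω, h4, ?_⟩
      simp only [hω] at h1
      rw [h3, h1]
  refine (Set.encard_le_encard hsub).trans ((Set.encard_union_le _ _).trans ?_)
  rw [Set.encard_singleton]
  calc (1 : ℕ∞) + _ ≤ 1 + 2 := by gcongr; exact (Set.encard_image_le _ _).trans hV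
    _ = 3 := by norm_num

lemma smi_of_unique_preimage {X Y : RV} {g : ℕ+ → ℕ+}
    (hg : ∀ᵐ ω ∂(volume : Measure Ω), Y ω = g (X ω)) {p q a : ℕ+}
    (hY : ∀ᵐ ω ∂(volume : Measure Ω), Y ω = p ∨ Y ω = q) (ha : a ∈ X.supp)
    (hap : g a = p) (huniq : ∀ x ∈ X.supp, g x = p → x = a) : SMI X Y := by
  classical
  refine ⟨a, ha, ⟨fun r => if r then p else q, ?_⟩, ⟨fun y => y = p, ?_⟩⟩
  · filter_upwards [hg, hY, X.ae_mem_supp] with ω h1 h2 h3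
    by_cases hω : X ω = a
    · simp [hω, h1, hap]
    · have : Y ω ≠ p := fun h4 => hω (huniq _ h3 (h1.symm.trans h4))
      simpa [hω] using h2.resolve_left this
  · filter_upwards [hg, X.ae_mem_supp] with ω h1 h3
    refine propext ⟨fun h => by rw [h1, h, hap], fun h => huniq _ h3 (h1.symm.trans h)⟩

lemma RV.exists_pair_of_card_two {Y : RV} (h : Y.card = 2) :
    ∃ p q, p ≠ q ∧ Y.supp = {p, q} := by
  obtain ⟨p, q, hne, hs⟩ := Set.encard_eq_two.1 h
  exact ⟨p, q, hne, hs⟩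

/-- If both fibres of `Y` contained two values of `X`, one bit splitting each fibre would, together
with `Y`, form a forbidden four-valued coarsening. So some fibre is a single atom. -/
lemma smi_of_forall {X Y : RV} (hYX : FunctionOf Y X) (hY : Y.card = 2)
    (h : ∀ U : RV, FunctionOf U X ∧ U.card = 4 →
      ¬ ∃ V : RV, V.card ≤ 2 ∧ FunctionOf U fun ω => (Y ω, V ω)) : SMI X Y := by
  classical
  obtain ⟨p, q, hpq, hs⟩ := RV.exists_pair_of_card_two hY
  have hYae : ∀ᵐ ω ∂(volume : Measure Ω), Y ω = p ∨ Y ω = q := by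
    filter_upwards [Y.ae_mem_supp] with ω hω
    rwa [hs] at hω
  obtain ⟨g, hg⟩ := hYX
  have hex : ∀ y ∈ Y.supp, ∃ x ∈ X.supp, g x = y := by
    intro y hy
    obtain ⟨ω, hω, h1, h2⟩ := exists_of_prob_pos (s := Y ⁻¹' {y}) hy (hg.and X.ae_mem_supp)
    exact ⟨X ω, h2, h1.symm.trans hω⟩
  obtain ⟨a, ha, hap⟩ := hex p (by simp [hs])
  obtain ⟨b, hb, hbq⟩ := hex q (by simp [hs])
  by_cases hp : ∀ x ∈ X.supp, g x = p → x = a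
  · exact smi_of_unique_preimage hg hYae ha hap hp
  by_cases hq : ∀ x ∈ X.supp, g x = q → x = b
  · exact smi_of_unique_preimage hg (hYae.mono fun _ => Or.symm) hb hbq hq
  push Not at hp hq
  obtain ⟨a', ha', hap', haa⟩ := hp
  obtain ⟨b', hb', hbq', hbb⟩ := hq
  exfalso
  -- The first bit is the fibre, the second separates `a` from `a'` and `b` from `b'`; these four
  -- values realize all four combinations.
  let k : ℕ+ → Bool × Bool := fun x => (decide (g x = p), decide (x = a ∨ x = b))
  obtain ⟨U, hU⟩ := (X.discrete.comp k).exists_rv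
  obtain ⟨V, hV⟩ := (X.discrete.comp fun x => (k x).2).exists_rv
  refine h U ⟨hU.1.trans (functionOf_comp _ _), ?_⟩ ⟨V, ?_, ?_⟩
  · have := RV.card_eq_of_pos hU fun i => ?_
    · simpa using this
    · have hk : ∃ x ∈ X.supp, k x = i := by
        have hba : b ≠ a := fun e => hpq (by rw [← hap, ← hbq, e])
        have hb'a : b' ≠ a := fun e => hpq (by rw [← hap, ← hbq', e])
        have ha'b : a' ≠ b := fun e => hpq (by rw [← hap', ← hbq, e])
        rcases i with ⟨_ | _, _ | _⟩
        · exact ⟨b', hb', by simp [k, hbq', hpq.symm, hbb, hb'a]⟩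
        · exact ⟨b, hb, by simp [k, hbq, hpq.symm]⟩
        · exact ⟨a', ha', by simp [k, hap', haa, ha'b]⟩
        · exact ⟨a, ha, by simp [k, hap]⟩
      obtain ⟨x, hx, hkx⟩ := hk
      refine lt_of_lt_of_le (show 0 < prob (X ⁻¹' {x}) from hx) (prob_mono fun ω hω => ?_)
      rw [Set.mem_preimage, Set.mem_singleton_iff] at hω ⊢
      rw [hω, hkx]
  · simpa using RV.card_le_of_functionOf hV.1
  · refine hU.1.trans (FunctionOf.trans ?_ ((FunctionOf.refl _).prod_congr hV.2))
    refine ⟨fun r => (decide (r.1 = p), r.2), ?_⟩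
    filter_upwards [hg] with ω hω
    simp [k, hω]

variable {n : ℕ} (v : Fin n → RV)

lemma holds_smi (x y : Fin n) : Holds (smi x y) v ↔ SMI (v x) (v y) := by
  simp only [smi, holds_sup, holds_inf, holds_all, holds_imp, holds_not, holds_ex, holds_equiv,
    holds_const, holds_le, holds_cardEq, holds_cardLE, holds_leJoint, snoc_up, snoc_last]
  constructor
  · rintro (⟨h, hc⟩ | ⟨⟨h1, h2⟩, h3⟩)
    · obtain ⟨a, ha⟩ := (ind_self_iff _).1 (hc.of_functionOf h.1 h.1)
      obtain ⟨b, hb⟩ := (ind_self_iff _).1 hc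
      refine ⟨a, by rw [ha]; exact one_pos, functionOf_of_ae_eq_const (a := b)
        (ae_of_prob_eq_one ((v y).discrete {b}) hb) _, functionOf_of_ae_eq_const (a := True) ?_ _⟩
      filter_upwards [ae_of_prob_eq_one ((v x).discrete {a}) ha] with ω hω
      exact eq_true hω
    · exact smi_of_forall h1 h2 h3
  · intro h
    obtain ⟨a, ha, hY⟩ := id h
    -- An atom of full probability means that `X` is degenerate and its indicator is constant; this
    -- is what the first disjunct of `smi` covers.
    by_cases h1 : prob (v x ⁻¹' {a}) = 1
    · have hae := ae_of_prob_eq_one ((v x).discrete {a}) h1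
      have hc : FunctionOf (v y) fun ω => v x ω = a := hY.1
      have hev (Z : Ω → ℕ+) : FunctionOf (fun ω => v x ω = a) Z :=
        functionOf_of_ae_eq_const (a := True) (by
          filter_upwards [hae] with ω hω
          exact eq_true hω) Z
      have hXc : Ind (v x) (v x) := (ind_self_iff _).2 ⟨a, h1⟩
      exact Or.inl ⟨⟨functionOf_of_ae_eq_const hae _, hc.trans (hev _)⟩,
        hXc.of_functionOf (hc.trans (hev _)) (hc.trans (hev _))⟩
    · refine Or.inr ⟨⟨hY.1.trans (functionOf_comp (v x) fun b => b = a), ?_⟩, ?_⟩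
      · have := RV.card_eq_of_pos hY fun i => ?_
        · simpa using this
        · by_cases hi : i
          · convert ha using 2
            ext ω
            simp [hi]
          · have h2 := prob_add_prob_compl ((v x).discrete {a})
            have h3 : prob (v x ⁻¹' {a}) ≤ 1 := by
              linarith [prob_nonneg (v x ⁻¹' {a})ᶜ]
            have h4 : 0 < prob (v x ⁻¹' {a})ᶜ := by
              have := lt_of_le_of_ne h3 h1
              linarith
            convert h4 using 2
            ext ω
            simp [hi]
      · rintro U ⟨hU, hU4⟩ ⟨V, hV, hUV⟩
        have := h.card_le_three hU hV hUV
        rw [hU4] at this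
        exact absurd this (by norm_num)

lemma holds_smiJoint (x u w : Fin n) :
    Holds (smiJoint x u w) v ↔ SMI (fun ω => (v x ω, v u ω)) (v w) := by
  simp only [smiJoint, holds_ex, holds_inf, holds_joint, holds_smi, snoc_up, snoc_last]
  constructor
  · rintro ⟨W, hW, h⟩
    exact h.congr_left hW
  · intro h
    obtain ⟨W, hW⟩ := ((v x).discrete.prodMk (v u).discrete).exists_rv
    exact ⟨W, hW, h.congr_left hW.symm⟩

end smi

/-! ## Fractions and sums -/

section frac

variable {α β : Type}

lemma prob_preimage_of_unifOn [Fintype α] {X : Ω → α} (hX : Discrete X) (hu : UnifOn X)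
    (p : α → Prop) [DecidablePred p] :
    prob (X ⁻¹' {a | p a}) = (Finset.univ.filter p).card / Fintype.card α := by
  rw [prob_eq_sum hX]
  have h (a : α) : prob (X ⁻¹' {a | p a} ∩ X ⁻¹' {a}) =
      if p a then 1 / (Fintype.card α : ℝ) else 0 := by
    split_ifs with ha
    · rw [← hu a]
      congr 1
      ext ω
      simp only [Set.mem_inter_iff, Set.mem_preimage, Set.mem_singleton_iff, and_iff_right_iff_imp]
      rintro rfl
      exact ha
    · convert measureReal_empty (μ := (volume : Measure Ω))
      ext ω
      simp only [Set.mem_inter_iff, Set.mem_preimage, Set.mem_singleton_iff, Set.mem_empty_iff_false,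
        iff_false, not_and]
      rintro h1 rfl
      exact ha h1
  simp only [h, ← Finset.sum_filter, Finset.sum_const, nsmul_eq_mul]
  ring

lemma RV.pmf_of_unifOn [Fintype α] {X : RV} {U : Ω → α} (hU : Discrete U) (hu : UnifOn U)
    {f : α → ℕ+} (hf : ∀ᵐ ω ∂(volume : Measure Ω), X ω = f (U ω)) (c : ℕ+) :
    X.pmf c = (Finset.univ.filter fun i => f i = c).card / Fintype.card α := by
  rw [← prob_preimage_of_unifOn hU hu, RV.pmf_eq]
  refine prob_congr ?_
  filter_upwards [hf] with ω hω
  simp [hω]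

lemma RV.ae_of_pmf_add {X : RV} {p q : ℕ+} (hpq : p ≠ q) (h : X.pmf p + X.pmf q = 1) :
    ∀ᵐ ω ∂(volume : Measure Ω), X ω = p ∨ X ω = q := by
  have := X.prob_preimage_finset {p, q}
  rw [Finset.sum_pair hpq, h] at this
  filter_upwards [ae_of_prob_eq_one (X.discrete _) this] with ω hω
  simpa using hω

/-- Two equivalent nontrivial events are equal or complementary. -/
lemma event_eq_or_compl {p q : Ω → Prop} (h : InfoEquiv p q) (h1 : 0 < prob {ω | p ω})
    (h0 : 0 < prob {ω | ¬ p ω}) :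
    (∀ᵐ ω ∂(volume : Measure Ω), p ω ↔ q ω) ∨ ∀ᵐ ω ∂(volume : Measure Ω), p ω ↔ ¬ q ω := by
  obtain ⟨⟨f, hf⟩, -⟩ := h
  -- A function on truth values is the identity, the negation or constant; the constant cases
  -- contradict the nontriviality of `p`.
  by_cases hT : f True <;> by_cases hF : f False
  · obtain ⟨ω, hω, h2⟩ := exists_of_prob_pos h0 hf
    by_cases hq : q ω <;> simp_all
  · refine Or.inl ?_
    filter_upwards [hf] with ω hω
    by_cases hq : q ω <;> simp_all
  · refine Or.inr ?_
    filter_upwards [hf] with ω hω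
    by_cases hq : q ω <;> simp_all
  · obtain ⟨ω, hω, h2⟩ := exists_of_prob_pos h1 hf
    by_cases hq : q ω <;> simp_all

lemma RV.IsUnif.prob_eq {X : RV} {n : ℕ} (h : X.IsUnif n) {x : ℕ+}
    (hx : 0 < prob (X ⁻¹' {x})) : prob (X ⁻¹' {x}) = 1 / n := h.2 x hx

/-- If the event `Z = z` is an atom `(x, t)` of `(A, U)`, then `t = w` and comparing masses gives
`1/n = P(U = w)/a`. Informational equivalence also allows the complement of such an atom, which can
only happen when `a = 1`. -/
lemma prob_of_smi_pair {A U Z : RV} {a n : ℕ} (hA : A.IsUnif a) (hZ : Z.IsUnif n)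
    (hAU : Ind U A) (hUZ : FunctionOf U Z) {w w' z : ℕ+} (hww : w ≠ w')
    (hw' : 0 < prob (U ⁻¹' {w'})) (hz : 0 < prob (U ⁻¹' {w} ∩ Z ⁻¹' {z}))
    {V : RV} (hV : InfoEquiv V fun ω => Z ω = z) (h : SMI (fun ω => (A ω, U ω)) V) :
    prob (U ⁻¹' {w}) = a / n := by
  obtain ⟨k, hk⟩ := hUZ
  have hkz : k z = w := by
    obtain ⟨ω, ⟨h1, h2⟩, h3⟩ := exists_of_prob_pos hz hk
    simp only [Set.mem_preimage, Set.mem_singleton_iff] at h1 h2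
    rw [← h2, ← h3, h1]
  have hzpos : 0 < prob (Z ⁻¹' {z}) := hz.trans_le (prob_mono Set.inter_subset_right)
  have hz' : 0 < prob {ω | ¬ Z ω = z} := by
    refine hw'.trans_le ?_
    refine ENNReal.toReal_mono (measure_ne_top _ _) (measure_mono_ae ?_)
    filter_upwards [hk] with ω hω h1 h2
    rw [h2, hkz] at hω
    exact hww (hω.symm.trans h1)
  obtain ⟨⟨x, t⟩, hxt, hV'⟩ := h
  have hxt' : 0 < prob (U ⁻¹' {t} ∩ A ⁻¹' {x}) := by
    convert hxt using 2
    ext ω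
    simp [and_comm]
  have hx : 0 < prob (A ⁻¹' {x}) := hxt'.trans_le (prob_mono Set.inter_subset_right)
  have ha0 : (a : ℝ) ≠ 0 := Nat.cast_ne_zero.2 hA.pos.ne'
  have hn0 : (n : ℝ) ≠ 0 := Nat.cast_ne_zero.2 hZ.pos.ne'
  rcases event_eq_or_compl (hV.symm.trans hV') hzpos hz' with heq | heq
  · have htw : t = w := by
      obtain ⟨ω, hω, h1, h2⟩ := exists_of_prob_pos hxt (heq.and hk)
      have h3 : (A ω, U ω) = (x, t) := hω
      rw [h1.2 h3, hkz] at h2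
      exact (congrArg Prod.snd h3).symm.trans h2
    subst htw
    have h1 : prob (Z ⁻¹' {z}) = prob (U ⁻¹' {t} ∩ A ⁻¹' {x}) := prob_congr <| by
      filter_upwards [heq] with ω hω
      simp [hω, and_comm]
    rw [hAU, hA.prob_eq hx, hZ.prob_eq hzpos] at h1
    field_simp at h1 ⊢
    linarith
  -- Complementary case: the other side `U = w'` misses `Z = z`, so it lies inside the atom `(x,
  -- t)`. This forces `t = w'` and `a = 1`, and `U = w` is then exactly `Z = z`.
  · have hsub : ∀ᵐ ω ∂(volume : Measure Ω), U ω = w' → A ω = x ∧ U ω = t := by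
      filter_upwards [heq, hk] with ω h1 h2 h3
      by_contra h4
      have h5 : Z ω = z := h1.2 fun h6 => h4 (Prod.ext_iff.1 h6)
      rw [h5, hkz] at h2
      exact hww (h2.symm.trans h3)
    have htw : t = w' := by
      obtain ⟨ω, hω, h1⟩ := exists_of_prob_pos hw' hsub
      exact (h1 hω).2.symm.trans hω
    subst htw
    have h1 : prob (U ⁻¹' {t} ∩ A ⁻¹' {x}) = prob (U ⁻¹' {t}) := prob_congr <| by
      filter_upwards [hsub] with ω hω
      simp only [Set.mem_inter_iff, Set.mem_preimage, Set.mem_singleton_iff, and_iff_left_iff_imp]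
      exact fun h => (hω h).1
    rw [hAU, hA.prob_eq hx] at h1
    have ha1 : (1 : ℝ) / a = 1 := mul_left_cancel₀ hw'.ne' (h1.trans (mul_one _).symm)
    have h2 : prob (U ⁻¹' {w}) = prob (Z ⁻¹' {z}) := prob_congr <| by
      filter_upwards [heq, hk] with ω h1 h2
      simp only [Set.mem_preimage, Set.mem_singleton_iff]
      constructor
      · intro h3
        refine h1.2 fun h4 => hww ?_
        exact h3.symm.trans (congrArg Prod.snd h4)
      · intro h3
        rw [h2, h3, hkz]
    rw [h2, hZ.prob_eq hzpos]
    field_simp at ha1 ⊢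
    linarith

lemma RV.pmf_add_of_supp {X : RV} {p q : ℕ+} (hpq : p ≠ q) (h : X.supp = {p, q}) :
    X.pmf p + X.pmf q = 1 := by
  have := X.sum_pmf_of_supp {p, q} (by simpa using h)
  rwa [Finset.sum_pair hpq] at this

lemma isBern_of_smi {A B Z U : RV} {a b n : ℕ} (hA : A.IsUnif a) (hB : B.IsUnif b)
    (hZ : Z.IsUnif n) (hU : U.card = 2) (hU' : ¬ ∃ k : ℕ, U.IsUnif k) (hUZ : FunctionOf U Z)
    (hUA : Ind U A) (hUB : Ind U B)
    (h : ∀ V : RV, SMI Z V → SMI (fun ω => (A ω, U ω)) V ∨ SMI (fun ω => (B ω, U ω)) V) :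
    n = a + b ∧ U.IsBern (a / (a + b)) := by
  obtain ⟨p, q, hpq, hs⟩ := RV.exists_pair_of_card_two hU
  have key : ∀ w w', w ≠ w' → w ∈ U.supp → w' ∈ U.supp → U.pmf w = a / n ∨ U.pmf w = b / n := by
    intro w w' hne hw hw'
    obtain ⟨z, hz⟩ := exists_prob_inter_pos Z (s := U ⁻¹' {w}) hw
    obtain ⟨V, hV⟩ := (Z.discrete.comp fun c => c = z).exists_rv
    rcases h V ⟨z, hz.trans_le (prob_mono Set.inter_subset_right), hV⟩ with h1 | h1
    · exact Or.inl (prob_of_smi_pair hA hZ hUA hUZ hne hw' hz hV h1)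
    · exact Or.inr (prob_of_smi_pair hB hZ hUB hUZ hne hw' hz hV h1)
  have hp : p ∈ U.supp := by simp [hs]
  have hq : q ∈ U.supp := by simp [hs]
  have hsum := RV.pmf_add_of_supp hpq hs
  -- Equal masses would make `U` uniform. Unequal masses exclude that both are `a/n` or both `b/n`,
  -- so their sum, which is one, is `(a + b)/n`.
  have hne : U.pmf p ≠ U.pmf q := by
    intro heq
    obtain ⟨k, hk, -⟩ := U.exists_isUnif_of_const (p := U.pmf p) hp fun c hc => by
      rw [hs] at hc
      rcases hc with rfl | rfl
      · rfl
      · exact heq.symm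
    exact hU' ⟨k, hk⟩
  have hn0 : (n : ℝ) ≠ 0 := Nat.cast_ne_zero.2 hZ.pos.ne'
  have hfin : (a : ℝ) / n + b / n = 1 → n = a + b := by
    intro h1
    rw [← add_div, div_eq_one_iff_eq hn0] at h1
    exact_mod_cast h1.symm
  rcases key p q hpq hp hq with h1 | h1 <;> rcases key q p hpq.symm hq hp with h2 | h2
  · exact absurd (h1.trans h2.symm) hne
  · have hn := hfin (by rw [← h1, ← h2, hsum])
    refine ⟨hn, p, q, hpq, ?_, ?_⟩
    · rw [h1, hn]; push_cast; rfl
    · rw [eq_sub_of_add_eq' hsum, h1, hn]; push_cast; rfl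
  · have hn := hfin (by rw [← h1, ← h2, add_comm, hsum])
    refine ⟨hn, q, p, hpq.symm, ?_, ?_⟩
    · rw [h2, hn]; push_cast; rfl
    · rw [eq_sub_of_add_eq hsum, h2, hn]; push_cast; rfl
  · exact absurd (h1.trans h2.symm) hne

/-- Uniform labels for `Z` with values in `Fin a ⊕ Fin b`, such that `U` is the side. -/
lemma exists_unifOn_sum {Z U : RV} {a b : ℕ} (hZ : Z.IsUnif (a + b))
    (hU : U.IsBern (a / (a + b))) (hUZ : FunctionOf U Z) :
    ∃ Z' : Ω → Fin a ⊕ Fin b, Discrete Z' ∧ UnifOn Z' ∧ InfoEquiv Z Z' ∧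
      InfoEquiv U fun ω => (Z' ω).isLeft := by
  classical
  obtain ⟨Y, hY, hYu, hZY⟩ := hZ.exists_unifOn (Fintype.card_fin _)
  obtain ⟨f, hf⟩ := hUZ.trans hZY.1
  obtain ⟨p, q, hpq, hp, hq⟩ := hU
  have hab : ((a + b : ℕ) : ℝ) ≠ 0 := Nat.cast_ne_zero.2 hZ.pos.ne'
  -- The labels are equally likely, so the mass `a/(a+b)` of `U = p` counts the labels in its fibre.
  have hcard : Fintype.card {i // f i = p} = a := by
    have := RV.pmf_of_unifOn hY hYu hf p
    rw [hp, Fintype.card_fin, Nat.cast_add] at this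
    push_cast at hab
    rw [div_left_inj' hab] at this
    rw [Fintype.card_subtype]
    exact_mod_cast this.symm
  have hcard' : Fintype.card {i // ¬ f i = p} = b := by
    rw [Fintype.card_subtype_compl, hcard, Fintype.card_fin]
    omega
  let e : Fin (a + b) ≃ Fin a ⊕ Fin b :=
    (Equiv.sumCompl fun i => f i = p).symm.trans
      ((Fintype.equivFinOfCardEq hcard).sumCongr (Fintype.equivFinOfCardEq hcard'))
  have he : ∀ i, (e i).isLeft = decide (f i = p) := by
    intro i
    by_cases hi : f i = p
    · simp [e, hi, Equiv.sumCompl_symm_apply_of_pos]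
    · simp [e, hi, Equiv.sumCompl_symm_apply_of_neg]
  refine ⟨fun ω => e (Y ω), hY.comp e, hYu.equiv e,
    hZY.trans ⟨.of_injective e.injective, functionOf_comp _ _⟩, ?_, ?_⟩
  · refine ⟨fun c => if c then p else q, ?_⟩
    filter_upwards [hf, RV.ae_of_pmf_add hpq (by rw [hp, hq]; ring)] with ω h1 h2
    by_cases h3 : f (Y ω) = p
    · simp [he, h3, h1]
    · rw [h1] at h2 ⊢
      simp [he, h2.resolve_left h3]
  · refine ⟨fun u => decide (u = p), ?_⟩
    filter_upwards [hf] with ω h1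
    simp [he, h1]

/-- Rearranges a value in `α ⊕ β` and a pair in `α × β` so that the value comes to determine the
component of the pair on its own side. -/
def sumProdShuffle (α β : Type) : (α ⊕ β) × (α × β) ≃ (α × β) × (α ⊕ β) where
  toFun
    | (.inl i, (x, y)) => ((i, y), .inl x)
    | (.inr j, (x, y)) => ((x, j), .inr y)
  invFun
    | ((i, y), .inl x) => (.inl i, (x, y))
    | ((x, j), .inr y) => (.inr j, (x, y))
  left_inv := by rintro ⟨i | j, x, y⟩ <;> rfl
  right_inv := by rintro ⟨⟨x, y⟩, i | j⟩ <;> rfl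

/-- On the left side `A` carries the label of `Z` and `B` is fresh randomness; on the right side the
roles are exchanged. The discarded coordinate is kept as a new label on the same side. The
rearrangement is thus a bijection and preserves uniformity, which makes `(A, B)` independent of the
side. -/
lemma exists_frac_witness {Z U : RV} {a b : ℕ} (ha : 0 < a) (hb : 0 < b) (hZ : Z.IsUnif (a + b))
    (hU : U.IsBern (a / (a + b))) (hUZ : FunctionOf U Z) :
    ∃ A B : RV, A.IsUnif a ∧ B.IsUnif b ∧ Ind B A ∧ (Ind U fun ω => (A ω, B ω)) ∧
      (FunctionOf Z fun ω => ((A ω, B ω), U ω)) ∧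
      ∀ V : RV, SMI Z V → SMI (fun ω => (A ω, U ω)) V ∨ SMI (fun ω => (B ω, U ω)) V := by
  have : NeZero a := ⟨ha.ne'⟩
  have : NeZero b := ⟨hb.ne'⟩
  obtain ⟨Y, hY, hYu, hZY, hUY⟩ := exists_unifOn_sum hZ hU hUZ
  obtain ⟨R, hR, hRu, hYR⟩ := exists_indep_unif hY (Fin a × Fin b)
  let e := sumProdShuffle (Fin a) (Fin b)
  let Q : Ω → (Fin a × Fin b) × (Fin a ⊕ Fin b) := fun ω => e (Y ω, R ω)
  have hQ : Discrete Q := (hY.prodMk hR).comp e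
  have hQu : UnifOn fun ω => ((Q ω).1, (Q ω).2) := (hYu.prodMk hRu hYR).equiv e
  have hQ1u : UnifOn fun ω => ((Q ω).1.1, (Q ω).1.2) := hQu.fst (hQ.comp Prod.snd)
  have hA : Discrete fun ω => (Q ω).1.1 := hQ.comp fun q => q.1.1
  have hB : Discrete fun ω => (Q ω).1.2 := hQ.comp fun q => q.1.2
  have hside : ∀ ω, (Q ω).2.isLeft = (Y ω).isLeft := by
    intro ω
    simp only [Q, e, sumProdShuffle, Equiv.coe_fn_mk]
    rcases Y ω with i | j <;> rfl
  have hleft : ∀ ω i, Y ω = .inl i ↔ ((Q ω).1.1, (Y ω).isLeft) = (i, true) := by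
    intro ω i
    simp only [Q, e, sumProdShuffle, Equiv.coe_fn_mk]
    rcases Y ω with i | j <;> simp
  have hright : ∀ ω j, Y ω = .inr j ↔ ((Q ω).1.2, (Y ω).isLeft) = (j, false) := by
    intro ω i
    simp only [Q, e, sumProdShuffle, Equiv.coe_fn_mk]
    rcases Y ω with i | j <;> simp
  obtain ⟨A, hAe⟩ := hA.exists_rv
  obtain ⟨B, hBe⟩ := hB.exists_rv
  have hAu := isUnif_of_unifOn (hQ1u.fst hB) hAe
  have hBu := isUnif_of_unifOn (hQ1u.snd hA) hBe
  rw [Fintype.card_fin] at hAu hBu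
  refine ⟨A, B, hAu, hBu, ((hQ1u.ind hA hB).of_functionOf hAe.1 hBe.1).symm, ?_, ?_, ?_⟩
  · refine (hQu.ind (hQ.comp Prod.fst) (hQ.comp Prod.snd)).symm.of_functionOf ?_
      (hAe.1.prod_congr hBe.1)
    refine hUY.1.trans ⟨fun s => s.isLeft, .of_forall fun ω => (hside ω).symm⟩
  · refine hZY.1.trans (FunctionOf.trans ?_ ((hAe.2.prod_congr hBe.2).prod_congr hUY.2))
    refine ⟨fun r => if r.2 then .inl r.1.1 else .inr r.1.2, .of_forall fun ω => ?_⟩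
    rcases hω : Y ω with i | j
    · simpa [hω] using ((Prod.ext_iff.1 ((hleft ω i).1 hω)).1).symm
    · simpa [hω] using ((Prod.ext_iff.1 ((hright ω j).1 hω)).1).symm
  · intro V hV
    obtain ⟨i | j, hpos, hVe⟩ := hV.congr_left hZY
    · refine Or.inl (SMI.congr_left (X := fun ω => ((Q ω).1.1, (Y ω).isLeft)) ⟨(i, true), ?_, ?_⟩
        (hAe.symm.prod_congr hUY.symm))
      · convert hpos using 2
        ext ω
        exact (hleft ω i).symm
      · simpa only [hleft] using hVe
    · refine Or.inr (SMI.congr_left (X := fun ω => ((Q ω).1.2, (Y ω).isLeft)) ⟨(j, false), ?_, ?_⟩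
        (hBe.symm.prod_congr hUY.symm))
      · convert hpos using 2
        ext ω
        exact (hright ω j).symm
      · simpa only [hright] using hVe

lemma RV.IsBern.exists_supp {X : RV} {θ : ℝ} (h : X.IsBern θ) (h0 : 0 < θ) (h1 : θ < 1) :
    ∃ p q, p ≠ q ∧ X.supp = {p, q} ∧ X.pmf p = θ ∧ X.pmf q = 1 - θ := by
  obtain ⟨p, q, hpq, hp, hq⟩ := h
  refine ⟨p, q, hpq, (RV.supp_subset_of_ae ?_).antisymm ?_, hp, hq⟩
  · filter_upwards [RV.ae_of_pmf_add hpq (by rw [hp, hq]; ring)] with ω hω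
    simpa using hω
  · rintro c (rfl | rfl)
    · exact h0.trans_eq hp.symm
    · exact (sub_pos.2 h1).trans_eq hq.symm

lemma RV.IsBern.card_eq_two {X : RV} {θ : ℝ} (h : X.IsBern θ) (h0 : 0 < θ) (h1 : θ < 1) :
    X.card = 2 := by
  obtain ⟨p, q, hpq, hs, -⟩ := h.exists_supp h0 h1
  rw [RV.card, hs, Set.encard_pair hpq]

lemma RV.IsBern.eq_half_of_isUnif {X : RV} {θ : ℝ} {n : ℕ} (h : X.IsBern θ) (h0 : 0 < θ)
    (h1 : θ < 1) (hn : X.IsUnif n) : θ = 1 / 2 := by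
  obtain ⟨p, q, hpq, hs, hp, hq⟩ := h.exists_supp h0 h1
  have e1 := hn.2 p (by simp [hs])
  have e2 := hn.2 q (by simp [hs])
  linarith

lemma isUnif_two_iff {X : RV} : X.IsUnif 2 ↔ X.IsBern (1 / 2) := by
  constructor
  · intro h
    obtain ⟨p, q, hpq, hs⟩ := RV.exists_pair_of_card_two h.1
    refine ⟨p, q, hpq, ?_, ?_⟩
    · simpa using h.2 p (by simp [hs])
    · rw [h.2 q (by simp [hs])]; norm_num
  · intro h
    obtain ⟨p, q, hpq, hs, hp, hq⟩ := h.exists_supp (by norm_num) (by norm_num)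
    refine ⟨h.card_eq_two (by norm_num) (by norm_num), ?_⟩
    rw [hs]
    rintro c (rfl | rfl)
    · simpa using hp
    · rw [hq]; norm_num

variable {n : ℕ} (v : Fin n → RV)

/-- For `a = b` the marker is a fair coin and the masses cannot tell the two sides apart, so this
case is treated as doubling by the first disjunct, with `U` unrelated to `Z`. -/
lemma holds_frac (x y z u : Fin n) : Holds (frac x y z u) v ↔
    ∃ a b : ℕ, (v x).IsUnif a ∧ (v y).IsUnif b ∧ (v z).IsUnif (a + b) ∧
      (v u).IsBern (a / (a + b)) ∧ (a = b ∨ FunctionOf (v u) (v z)) := by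
  simp only [frac, holds_sup, holds_inf, holds_ex, holds_all, holds_imp, holds_not, holds_ueqConst,
    holds_uprod, holds_ueq, holds_unif, holds_cardEq, holds_le, holds_ind₃, holds_leJoint₃,
    holds_smi, holds_smiJoint, snoc_up, snoc_last]
  constructor
  · rintro (⟨⟨hu, a, k, ha, hk, hz⟩, b, k', hb, hk', hz'⟩ |
      ⟨A, B, ⟨⟨⟨⟨⟨⟨⟨⟨a, ha, hA⟩, b, hb, hB⟩, c, hZ⟩, hU⟩, hU'⟩, hUZ⟩, hBA, hUAB⟩, -⟩, h⟩)
    · obtain rfl := hu.unique hk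
      obtain rfl := hu.unique hk'
      have hab : a = b := Nat.eq_of_mul_eq_mul_right two_pos (hz.unique hz')
      subst hab
      have ha0 : (a : ℝ) ≠ 0 := Nat.cast_ne_zero.2 ha.pos.ne'
      refine ⟨a, a, ha, hb, mul_two a ▸ hz, ?_, Or.inl rfl⟩
      have : (a : ℝ) / (a + a) = 1 / 2 := by field_simp; norm_num
      rw [this]
      exact isUnif_two_iff.1 hu
    · obtain ⟨rfl, hbern⟩ := isBern_of_smi hA hB hZ hU hU' hUZ
        (hUAB.of_functionOf (.refl _) (functionOf_prod_left _ _))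
        (hUAB.of_functionOf (.refl _) (functionOf_prod_right _ _)) h
      exact ⟨a, b, ha, hb, hZ, hbern, Or.inr hUZ⟩
  · rintro ⟨a, b, ha, hb, hz, hu, h⟩
    have ha0 : (0 : ℝ) < a := Nat.cast_pos.2 ha.pos
    have hb0 : (0 : ℝ) < b := Nat.cast_pos.2 hb.pos
    by_cases hab : a = b
    · subst hab
      have : (a : ℝ) / (a + a) = 1 / 2 := by field_simp; norm_num
      rw [this] at hu
      have h2 := isUnif_two_iff.2 hu
      rw [← mul_two] at hz
      exact Or.inl ⟨⟨h2, a, 2, ha, h2, hz⟩, a, 2, hb, h2, hz⟩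
    · have hUZ := h.resolve_left hab
      obtain ⟨A, B, hA, hB, hBA, hUAB, hZ, hV⟩ := exists_frac_witness ha.pos hb.pos hz hu hUZ
      have h0 : (0 : ℝ) < a / (a + b) := by positivity
      have h1 : (a : ℝ) / (a + b) < 1 := by rw [div_lt_one (by positivity)]; linarith
      refine Or.inr ⟨A, B, ⟨⟨⟨⟨⟨⟨⟨⟨a, ha, hA⟩, b, hb, hB⟩, _, hz⟩, hu.card_eq_two h0 h1⟩, ?_⟩, hUZ⟩,
        hBA, hUAB⟩, hZ⟩, hV⟩
      rintro ⟨k, hk⟩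
      have := hu.eq_half_of_isUnif h0 h1 hk
      field_simp at this
      exact hab (by exact_mod_cast (by linarith : (a : ℝ) = b))

lemma exists_bern_functionOf {Z : RV} {a b : ℕ} (ha : 0 < a) (hb : 0 < b)
    (hZ : Z.IsUnif (a + b)) : ∃ U : RV, U.IsBern (a / (a + b)) ∧ FunctionOf U Z := by
  have hc : Fintype.card (Fin a ⊕ Fin b) = a + b := by simp
  obtain ⟨Y, hY, hYu, hZY⟩ := hZ.exists_unifOn hc
  let f : Fin a ⊕ Fin b → ℕ+ := fun s => if s.isLeft then 1 else 2
  let U : RV := ⟨fun ω => f (Y ω), fun s _ => hY.comp f s⟩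
  have hU := RV.pmf_of_unifOn (X := U) hY hYu (f := f) (.of_forall fun ω => rfl)
  refine ⟨U, ⟨1, 2, by decide, ?_, ?_⟩, FunctionOf.trans (functionOf_comp Y f) hZY.2⟩
  · rw [hU, hc]
    have : (Finset.univ.filter fun i => f i = 1).card = a := by
      rw [Finset.card_filter, Fintype.sum_sum_type]
      simp [f]
    rw [this]; push_cast; rfl
  · rw [hU, hc]
    have : (Finset.univ.filter fun i => f i = 2).card = b := by
      rw [Finset.card_filter, Fintype.sum_sum_type]
      simp [f]
    rw [this]
    have : (a : ℝ) + b ≠ 0 := by positivity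
    push_cast
    field_simp
    ring

lemma holds_usum (x y z : Fin n) : Holds (usum x y z) v ↔
    ∃ a b : ℕ, (v x).IsUnif a ∧ (v y).IsUnif b ∧ (v z).IsUnif (a + b) := by
  simp only [usum, holds_ex, holds_frac, snoc_up, snoc_last]
  constructor
  · rintro ⟨U, a, b, ha, hb, h, -⟩
    exact ⟨a, b, ha, hb, h⟩
  · rintro ⟨a, b, ha, hb, h⟩
    obtain ⟨U, hU, hUZ⟩ := exists_bern_functionOf ha.pos hb.pos h
    exact ⟨U, a, b, ha, hb, h, hU, Or.inr hUZ⟩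

end frac

/-! ## The representation of the nonnegative integers -/

/-- A map on three labels that is neither injective nor constant has one fibre of size one and one
of size two. -/
lemma isBern_third_of_functionOf {X T : RV} (hT : T.IsUnif 3) (hXT : FunctionOf X T)
    (hTX : ¬ FunctionOf T X) (hX : ¬ Ind X X) : X.IsBern (1 / 3) := by
  obtain ⟨Y, hY, hYu, hTY⟩ := hT.exists_unifOn (Fintype.card_fin 3)
  obtain ⟨f, hf⟩ := hXT.trans hTY.1
  have hpmf := RV.pmf_of_unifOn hY hYu hf
  have hninj : ¬ Function.Injective f := by
    intro hinj
    refine hTX (hTY.1.trans ((FunctionOf.of_injective hinj).trans ⟨id, ?_⟩))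
    filter_upwards [hf] with ω hω
    exact hω.symm
  have hnconst : ¬ ∃ c, ∀ i, f i = c := by
    rintro ⟨c, hc⟩
    refine hX ((ind_self_iff X).2 ⟨c, ?_⟩)
    rw [← RV.pmf_eq, hpmf]
    simp [hc]
  simp only [Fintype.card_fin, Finset.card_filter, Fin.sum_univ_three] at hpmf
  by_cases h01 : f 0 = f 1
  · have h12 : f 1 ≠ f 2 := fun h => hnconst ⟨f 0, by simp [Fin.forall_fin_succ, h01, h]⟩
    refine ⟨f 2, f 0, h01 ▸ h12.symm, ?_, ?_⟩ <;> rw [hpmf]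
    · simp [h01, h12]
    · simp [h01, h12.symm]; norm_num
  by_cases h12 : f 1 = f 2
  · refine ⟨f 0, f 1, h01, ?_, ?_⟩ <;> rw [hpmf]
    · simp [← h12, Ne.symm h01]
    · simp [h12]
      rw [if_neg (h12 ▸ h01)]
      norm_num
  by_cases h02 : f 0 = f 2
  · refine ⟨f 1, f 0, Ne.symm h01, ?_, ?_⟩ <;> rw [hpmf]
    · simp [h01, Ne.symm h12]
    · simp [← h02, Ne.symm h01]; norm_num
  · refine absurd ?_ hninj
    intro i j hij
    fin_cases i <;> fin_cases j <;> simp_all [eq_comm]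

lemma RV.IsBern.not_ind_self {X : RV} {θ : ℝ} (h : X.IsBern θ) (h0 : 0 < θ) (h1 : θ < 1) :
    ¬ Ind X X := by
  rw [ind_self_iff_card, h.card_eq_two h0 h1]
  norm_num

/-- An independent fair coin halves the atom of mass `2/3`; the halves are invisible to `X`, so the
refinement is strict. -/
lemma exists_isUnif_three_of_isBern {X : RV} (hX : X.IsBern (1 / 3)) :
    ∃ T : RV, T.IsUnif 3 ∧ FunctionOf X T ∧ ¬ FunctionOf T X := by
  classical
  obtain ⟨p, q, hpq, hs, hp, hq⟩ := hX.exists_supp (by norm_num) (by norm_num)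
  obtain ⟨R, hR, hRu, hXR⟩ := exists_indep_unif X.discrete Bool
  let Y : Ω → Option Bool := fun ω => if X ω = p then none else some (R ω)
  have hY : Discrete Y := (X.discrete.prodMk hR).comp fun r => if r.1 = p then none else some r.2
  have hsome (b : Bool) : prob (X ⁻¹' {q} ∩ Y ⁻¹' {some b}) = 1 / 3 := by
    have : X ⁻¹' {q} ∩ Y ⁻¹' {some b} = X ⁻¹' {q} ∩ R ⁻¹' {b} := by
      ext ω
      simp only [Set.mem_inter_iff, Set.mem_preimage, Set.mem_singleton_iff, and_congr_right_iff]
      intro h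
      simp [Y, h, hpq.symm]
    rw [this, hXR, hRu, ← RV.pmf_eq, hq, Fintype.card_bool]
    norm_num
  have hae : ∀ᵐ ω ∂(volume : Measure Ω), X ω = p ∨ X ω = q := by
    filter_upwards [X.ae_mem_supp] with ω hω
    simpa [hs] using hω
  have hYu : UnifOn Y := by
    rintro (_ | b)
    · have : Y ⁻¹' {none} = X ⁻¹' {p} := by
        ext ω
        simp [Y]
      rw [this, ← RV.pmf_eq, hp]
      simp
    · have : prob (Y ⁻¹' {some b}) = prob (X ⁻¹' {q} ∩ Y ⁻¹' {some b}) := prob_congr <| by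
        filter_upwards [hae] with ω hω
        simp only [Set.mem_inter_iff, Set.mem_preimage, Set.mem_singleton_iff, iff_and_self]
        intro h
        refine hω.resolve_left fun h' => ?_
        simp [Y, h'] at h
      rw [this, hsome]
      simp
  obtain ⟨T, hT⟩ := hY.exists_rv
  have hTu := isUnif_of_unifOn hYu hT
  refine ⟨T, by simpa using hTu, FunctionOf.trans ⟨fun o => if o = none then p else q, ?_⟩ hT.2, ?_⟩
  · filter_upwards [hae] with ω hω
    by_cases h : X ω = p
    · simp [Y, h]
    · simpa [Y, h] using hω.resolve_left h
  · intro h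
    have := functionOf_iff.1 (hT.2.trans h) q (some true) (some false)
      (by rw [hsome]; norm_num) (by rw [hsome]; norm_num)
    simp at this

/-- `X` represents the nonnegative integer `n`. -/
def Represents (X : RV) (n : ℕ) : Prop := (n = 0 ∧ X.IsBern (1 / 3)) ∨ X.IsUnif n

lemma RV.IsBern.not_isUnif {X : RV} (h : X.IsBern (1 / 3)) (n : ℕ) : ¬ X.IsUnif n := by
  intro h'
  have := h.eq_half_of_isUnif (by norm_num) (by norm_num) h'
  norm_num at this

lemma Represents.unique {X : RV} {m n : ℕ} (h : Represents X m) (h' : Represents X n) : m = n := by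
  rcases h with ⟨rfl, h⟩ | h <;> rcases h' with ⟨rfl, h'⟩ | h'
  · rfl
  · exact absurd h' (h.not_isUnif n)
  · exact absurd h (h'.not_isUnif m)
  · exact h.unique h'

lemma represents_zero {X : RV} : Represents X 0 ↔ X.IsBern (1 / 3) := by
  simp [Represents, not_isUnif_zero]

lemma represents_of_pos {X : RV} {n : ℕ} (hn : 0 < n) : Represents X n ↔ X.IsUnif n := by
  simp [Represents, hn.ne']

lemma discrete_unit : Discrete fun _ : Ω => () := fun _ =>
  (measurable_const (a := ()) trivial).nullMeasurableSet

lemma exists_represents (n : ℕ) : ∃ X, Represents X n := by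
  rcases Nat.eq_zero_or_pos n with rfl | hn
  -- Zero is obtained by coarsening Unif[3] into sides of one and two labels.
  · obtain ⟨T, hT, -⟩ := exists_isUnif_ind discrete_unit (n := 1 + 2) (by norm_num)
    obtain ⟨U, hU, -⟩ := exists_bern_functionOf one_pos two_pos hT
    refine ⟨U, Or.inl ⟨rfl, ?_⟩⟩
    convert hU using 1
    norm_num
  · obtain ⟨T, hT, -⟩ := exists_isUnif_ind discrete_unit hn
    exact ⟨T, Or.inr hT⟩

section semantics

variable {n : ℕ} (v : Fin n → RV)

lemma holds_is0 (x : Fin n) : Holds (is0 x) v ↔ (v x).IsBern (1 / 3) := by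
  simp only [is0, holds_ex, holds_inf, holds_not, holds_ueqConst, holds_const, holds_lt, snoc_up,
    snoc_last]
  constructor
  · rintro ⟨T, ⟨hT, hc⟩, h1, h2⟩
    exact isBern_third_of_functionOf hT h1 h2 hc
  · intro h
    obtain ⟨T, hT, h1, h2⟩ := exists_isUnif_three_of_isBern h
    exact ⟨T, ⟨hT, h.not_ind_self (by norm_num) (by norm_num)⟩, h1, h2⟩

lemma holds_isnat' (x : Fin n) :
    Holds (isnat x) v ↔ (v x).IsBern (1 / 3) ∨ ∃ k : ℕ, (v x).IsUnif k := by
  simp only [isnat, holds_sup, holds_is0, holds_unif]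

lemma holds_isnat (x : Fin n) : Holds (isnat x) v ↔ ∃ k, Represents (v x) k := by
  rw [holds_isnat']
  constructor
  · rintro (h | ⟨k, h⟩)
    exacts [⟨0, Or.inl ⟨rfl, h⟩⟩, ⟨k, Or.inr h⟩]
  · rintro ⟨k, ⟨-, h⟩ | h⟩
    exacts [Or.inl h, Or.inr ⟨k, h⟩]

lemma holds_natEq (x y : Fin n) :
    Holds (natEq x y) v ↔ ∃ k, Represents (v x) k ∧ Represents (v y) k := by
  simp only [natEq, holds_sup, holds_inf, holds_is0, holds_ueq]
  constructor
  · rintro (⟨h, h'⟩ | ⟨k, h, h'⟩)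
    exacts [⟨0, Or.inl ⟨rfl, h⟩, Or.inl ⟨rfl, h'⟩⟩, ⟨k, Or.inr h, Or.inr h'⟩]
  · rintro ⟨k, h, h'⟩
    rcases Nat.eq_zero_or_pos k with rfl | hk
    · rw [represents_zero] at h h'
      exact Or.inl ⟨h, h'⟩
    · rw [represents_of_pos hk] at h h'
      exact Or.inr ⟨k, h, h'⟩

lemma holds_natAdd (x y z : Fin n) : Holds (natAdd x y z) v ↔
    ∃ a b, Represents (v x) a ∧ Represents (v y) b ∧ Represents (v z) (a + b) := by
  simp only [natAdd, holds_sup, holds_inf, holds_is0, holds_isnat, holds_natEq, holds_usum]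
  constructor
  · rintro ((⟨⟨h, -⟩, k, hk, hk'⟩ | ⟨⟨h, -⟩, k, hk, hk'⟩) | ⟨a, b, ha, hb, hab⟩)
    · exact ⟨0, k, represents_zero.2 h, hk, by rwa [zero_add]⟩
    · exact ⟨k, 0, hk, represents_zero.2 h, hk'⟩
    · exact ⟨a, b, Or.inr ha, Or.inr hb, Or.inr hab⟩
  · rintro ⟨a, b, ha, hb, hab⟩
    rcases Nat.eq_zero_or_pos a with rfl | ha0
    · rw [zero_add] at hab
      exact Or.inl (Or.inl ⟨⟨represents_zero.1 ha, b, hb⟩, b, hb, hab⟩)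
    rcases Nat.eq_zero_or_pos b with rfl | hb0
    · exact Or.inl (Or.inr ⟨⟨represents_zero.1 hb, a, ha⟩, a, ha, hab⟩)
    · exact Or.inr ⟨a, b, (represents_of_pos ha0).1 ha, (represents_of_pos hb0).1 hb,
        (represents_of_pos (Nat.add_pos_left ha0 b)).1 hab⟩

lemma holds_natMul (x y z : Fin n) : Holds (natMul x y z) v ↔
    ∃ a b, Represents (v x) a ∧ Represents (v y) b ∧ Represents (v z) (a * b) := by
  simp only [natMul, holds_sup, holds_inf, holds_is0, holds_isnat, holds_uprod]
  constructor
  · rintro ((⟨⟨h, k, hk⟩, h'⟩ | ⟨⟨h, k, hk⟩, h'⟩) | ⟨a, b, ha, hb, hab⟩)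
    · exact ⟨0, k, represents_zero.2 h, hk, by rwa [zero_mul, represents_zero]⟩
    · exact ⟨k, 0, hk, represents_zero.2 h, by rwa [mul_zero, represents_zero]⟩
    · exact ⟨a, b, Or.inr ha, Or.inr hb, Or.inr hab⟩
  · rintro ⟨a, b, ha, hb, hab⟩
    rcases Nat.eq_zero_or_pos a with rfl | ha0
    · rw [zero_mul, represents_zero] at hab
      exact Or.inl (Or.inl ⟨⟨represents_zero.1 ha, b, hb⟩, hab⟩)
    rcases Nat.eq_zero_or_pos b with rfl | hb0
    · rw [mul_zero, represents_zero] at hab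
      exact Or.inl (Or.inr ⟨⟨represents_zero.1 hb, a, ha⟩, hab⟩)
    · exact Or.inr ⟨a, b, (represents_of_pos ha0).1 ha, (represents_of_pos hb0).1 hb,
        (represents_of_pos (Nat.mul_pos ha0 hb0)).1 hab⟩

lemma holds_natLt (x y : Fin n) : Holds (natLt x y) v ↔
    ∃ a b, Represents (v x) a ∧ Represents (v y) b ∧ a < b := by
  simp only [natLt, holds_sup, holds_inf, holds_is0, holds_unif]
  constructor
  · rintro (⟨h, k, hk⟩ | ⟨⟨⟨a, ha⟩, b, hb⟩, h⟩)
    · exact ⟨0, k, represents_zero.2 h, Or.inr hk, hk.pos⟩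
    · exact ⟨a, b, Or.inr ha, Or.inr hb, (holds_ult v x y ha hb).1 h⟩
  · rintro ⟨a, b, ha, hb, hab⟩
    have hb' := (represents_of_pos (Nat.zero_lt_of_lt hab)).1 hb
    rcases Nat.eq_zero_or_pos a with rfl | ha0
    · exact Or.inl ⟨represents_zero.1 ha, b, hb'⟩
    · have ha' := (represents_of_pos ha0).1 ha
      exact Or.inr ⟨⟨⟨a, ha'⟩, b, hb'⟩, (holds_ult v x y ha' hb').2 hab⟩

end semantics

lemma exists_represents_of_dom (X : arithInterp.Dom RV) : ∃ k, Represents X.1 k :=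
  (holds_isnat ![X.1] 0).1 X.2

/-- The nonnegative integer represented by a random variable. -/
noncomputable def value (X : arithInterp.Dom RV) : ℕ := (exists_represents_of_dom X).choose

lemma represents_value (X : arithInterp.Dom RV) : Represents X.1 (value X) :=
  (exists_represents_of_dom X).choose_spec

lemma represents_iff_value (X : arithInterp.Dom RV) (n : ℕ) : Represents X.1 n ↔ value X = n :=
  ⟨fun h => (represents_value X).unique h, fun h => h ▸ represents_value X⟩

lemma value_surjective : Function.Surjective value := by
  intro n
  obtain ⟨X, hX⟩ := exists_represents n
  exact ⟨⟨X, (holds_isnat ![X] 0).2 ⟨n, hX⟩⟩, (represents_iff_value _ n).1 hX⟩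

lemma isCoordinateMap_value : arithInterp.IsCoordinateMap value := by
  refine ⟨value_surjective, fun x y => ?_, ?_, ?_⟩
  · refine (holds_natEq ![x.1, y.1] 0 1).trans ?_
    simp only [Matrix.cons_val_zero, Matrix.cons_val_one, represents_iff_value]
    simp [eq_comm]
  · intro k f x y
    cases f with
    | add =>
      refine (holds_natAdd (Fin.snoc (α := fun _ => RV) (fun i => (x i).1) y.1) 0 1 2).trans ?_
      change (∃ a b, Represents (x 0).1 a ∧ Represents (x 1).1 b ∧ Represents y.1 (a + b)) ↔
        value (x 0) + value (x 1) = value y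
      simp [represents_iff_value, eq_comm]
    | mul =>
      refine (holds_natMul (Fin.snoc (α := fun _ => RV) (fun i => (x i).1) y.1) 0 1 2).trans ?_
      change (∃ a b, Represents (x 0).1 a ∧ Represents (x 1).1 b ∧ Represents y.1 (a * b)) ↔
        value (x 0) * value (x 1) = value y
      simp [represents_iff_value, eq_comm]
  · intro k R x
    cases R with
    | lt =>
      refine (holds_natLt (fun i => (x i).1) 0 1).trans ?_
      change _ ↔ value (x 0) < value (x 1)
      simp [represents_iff_value]

/-! ## Formulas without equality -/

section eqFree

variable {L L' : FirstOrder.Language.{0, 0}} {α β γ : Type}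

lemma eqFree_imp {n : ℕ} {φ ψ : L.BoundedFormula α n} :
    EqFree (φ.imp ψ) ↔ EqFree φ ∧ EqFree ψ := Iff.rfl

lemma eqFree_all {n : ℕ} {φ : L.BoundedFormula α (n + 1)} : EqFree φ.all ↔ EqFree φ := Iff.rfl

lemma eqFree_not {n : ℕ} {φ : L.BoundedFormula α n} : EqFree φ.not ↔ EqFree φ :=
  ⟨fun h => h.1, fun h => ⟨h, trivial⟩⟩

lemma eqFree_inf {n : ℕ} {φ ψ : L.BoundedFormula α n} :
    EqFree (φ ⊓ ψ) ↔ EqFree φ ∧ EqFree ψ :=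
  ⟨fun h => ⟨h.1.1, h.1.2.1⟩, fun h => ⟨⟨h.1, h.2, trivial⟩, trivial⟩⟩

lemma eqFree_sup {n : ℕ} {φ ψ : L.BoundedFormula α n} :
    EqFree (φ ⊔ ψ) ↔ EqFree φ ∧ EqFree ψ :=
  ⟨fun h => ⟨h.1.1, h.2⟩, fun h => ⟨⟨h.1, trivial⟩, h.2⟩⟩

lemma eqFree_ex {n : ℕ} {φ : L.BoundedFormula α (n + 1)} : EqFree φ.ex ↔ EqFree φ :=
  ⟨fun h => h.1.1, fun h => ⟨⟨h, trivial⟩, trivial⟩⟩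

lemma EqFree.mapTermRel {g : ℕ → ℕ} (ft : ∀ n, L.Term (α ⊕ Fin n) → L'.Term (β ⊕ Fin (g n)))
    (fr : ∀ n, L.Relations n → L'.Relations n)
    (h : ∀ n, L'.BoundedFormula β (g (n + 1)) → L'.BoundedFormula β (g n + 1))
    (hh : ∀ n φ, EqFree φ → EqFree (h n φ)) :
    ∀ {n : ℕ} {φ : L.BoundedFormula α n}, EqFree φ → EqFree (φ.mapTermRel ft fr h)
  | _, .falsum, _ => trivial
  | _, .rel _ _, _ => trivial
  | _, .imp _ _, hφ => ⟨hφ.1.mapTermRel ft fr h hh, hφ.2.mapTermRel ft fr h hh⟩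
  | _, .all _, hφ => hh _ _ (EqFree.mapTermRel ft fr h hh (eqFree_all.1 hφ))

lemma EqFree.castLE : ∀ {m n : ℕ} (h : m ≤ n) {φ : L.BoundedFormula α m},
    EqFree φ → EqFree (φ.castLE h)
  | _, _, _, .falsum, _ => trivial
  | _, _, _, .rel _ _, _ => trivial
  | _, _, h, .imp _ _, hφ => ⟨hφ.1.castLE h, hφ.2.castLE h⟩
  | _, _, h, .all _, hφ => EqFree.castLE (Nat.add_le_add_right h 1) (eqFree_all.1 hφ)

lemma EqFree.relabel {m k : ℕ} (g : α → β ⊕ Fin m) {φ : L.BoundedFormula α k} (h : EqFree φ) :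
    EqFree (φ.relabel g) :=
  h.mapTermRel _ _ _ fun _ _ h => h.castLE _

lemma EqFree.formula_relabel (g : α → β) {φ : L.Formula α} (h : EqFree φ) :
    EqFree (Formula.relabel g φ) := EqFree.relabel _ h

lemma EqFree.alls {n : ℕ} {φ : L.BoundedFormula α n} (h : EqFree φ) : EqFree φ.alls := by
  induction n with
  | zero => exact h
  | succ n ih => exact ih (eqFree_all.2 h)

lemma EqFree.exs {n : ℕ} {φ : L.BoundedFormula α n} (h : EqFree φ) : EqFree φ.exs := by
  induction n with
  | zero => exact h
  | succ n ih => exact ih (eqFree_ex.2 h)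

lemma EqFree.iAlls [Finite β] {φ : L.Formula (α ⊕ β)} (h : EqFree φ) : EqFree (φ.iAlls β) :=
  (EqFree.relabel _ h).alls

lemma EqFree.iExs [Finite β] {φ : L.Formula (α ⊕ β)} (h : EqFree φ) : EqFree (φ.iExs β) :=
  (EqFree.relabel _ h).exs

lemma eqFree_iInf [Finite β] {f : β → L.Formula α} (h : ∀ b, EqFree (f b)) :
    EqFree (Formula.iInf f) := by
  let _ := Fintype.ofFinite β
  have key : ∀ l : List β, EqFree ((l.map f).foldr (· ⊓ ·) (⊤ : L.BoundedFormula α 0)) := by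
    intro l
    induction l with
    | nil => exact ⟨trivial, trivial⟩
    | cons b l ih => exact eqFree_inf.2 ⟨h b, ih⟩
  exact key _

lemma EqFree.toFormula : ∀ {n : ℕ} {φ : L.BoundedFormula α n}, EqFree φ → EqFree φ.toFormula
  | _, .falsum, _ => trivial
  | _, .rel _ _, _ => trivial
  | _, .imp _ _, h => ⟨h.1.toFormula, h.2.toFormula⟩
  | _, .all _, h => eqFree_all.2 (EqFree.relabel _ (EqFree.toFormula (eqFree_all.1 h)))

namespace Interpretation

variable {Γ : Interpretation L' L}

lemma eqFree_inst {k : ℕ} {φ : L.BoundedFormula Empty k} (h : EqFree φ) (v : Fin k → β) :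
    EqFree (inst φ v) := h.toFormula.formula_relabel _

lemma eqFree_termGraph (hΓ : Γ.IsEqFree) : ∀ t : L'.Term β, EqFree (Γ.termGraph t)
  | .var _ => eqFree_inst hΓ.2.1 _
  | .func _ ts => EqFree.iExs (eqFree_inf.2 ⟨eqFree_iInf fun i => eqFree_inf.2
      ⟨eqFree_inst hΓ.1 _, (eqFree_termGraph hΓ (ts i)).formula_relabel _⟩,
      eqFree_inst (hΓ.2.2.1 _) _⟩)

lemma eqFree_translateFormula (hΓ : Γ.IsEqFree) :
    ∀ {n : ℕ} (φ : L'.BoundedFormula α n), EqFree (Γ.translateFormula φ)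
  | _, .falsum => trivial
  | _, .equal s t => EqFree.iExs (eqFree_inf.2 ⟨eqFree_inf.2
      ⟨eqFree_inst hΓ.1 _, eqFree_termGraph hΓ s⟩, eqFree_termGraph hΓ t⟩)
  | _, .rel _ ts => EqFree.iExs (eqFree_inf.2 ⟨eqFree_iInf fun i => eqFree_inf.2
      ⟨eqFree_inst hΓ.1 _, (eqFree_termGraph hΓ (ts i)).formula_relabel _⟩,
      eqFree_inst (hΓ.2.2.2 _) _⟩)
  | _, .imp φ ψ => ⟨eqFree_translateFormula hΓ φ, eqFree_translateFormula hΓ ψ⟩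
  | _, .all φ => EqFree.iAlls (eqFree_imp.2
      ⟨eqFree_inst hΓ.1 _, (eqFree_translateFormula hΓ φ).formula_relabel _⟩)

/-! ## Correctness of the translation -/

variable {M N : Type} [L.Structure M] [L'.Structure N] {c : Γ.Dom M → N}

lemma realize_inst {k : ℕ} (φ : L.BoundedFormula Empty k) (v : Fin k → β) (w : β → M) :
    (inst φ v).Realize w ↔ φ.Realize default (w ∘ v) := by
  rw [inst, Formula.realize_relabel, BoundedFormula.realize_toFormula]
  rw [Subsingleton.elim ((w ∘ Sum.elim Empty.elim v) ∘ Sum.inl) default]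
  rfl

lemma comp_vec_one (w : β → M) (b : β) : w ∘ ![b] = ![w b] :=
  funext fun i => by fin_cases i; rfl

/-- Unnesting is harmless because the coordinate map is onto: every intermediate value has a
representative, and the formulas of the interpretation depend only on the values represented. -/
lemma realize_termGraph (hc : Γ.IsCoordinateMap c) (v : β → Γ.Dom M) :
    ∀ (t : L'.Term β) (y : Γ.Dom M),
      (Γ.termGraph t).Realize (Sum.elim (fun b => (v b).1) fun _ => y.1) ↔
        t.realize (c ∘ v) = c y
  | .var b, y => by
    rw [termGraph, realize_inst, Term.realize_var, Function.comp_apply, ← hc.2.1]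
    rw [show Sum.elim (fun b => (v b).1) (fun _ => y.1) ∘ ![Sum.inl b, Sum.inr ()] =
      ![(v b).1, y.1] from funext fun i => by fin_cases i <;> rfl]
  | .func (l := k) f ts, y => by
    simp only [termGraph, Formula.realize_iExs, Formula.realize_inf, Formula.realize_iInf,
      realize_inst, comp_vec_one, Formula.realize_relabel, Term.realize_func]
    have hrel (x : Fin k → Γ.Dom M) (i) :
        (Γ.termGraph (ts i)).Realize ((Sum.elim (Sum.elim (fun b => (v b).1) fun _ => y.1)
          fun i => (x i).1) ∘ (Sum.elim (fun b => .inl (.inl b)) fun _ => .inr i :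
            β ⊕ Unit → (β ⊕ Unit) ⊕ Fin k)) ↔
        (ts i).realize (c ∘ v) = c (x i) := by
      rw [← realize_termGraph hc v (ts i) (x i)]
      congr! 1
      ext (b | u) <;> rfl
    have hfn (x : Fin k → Γ.Dom M) :
        (Sum.elim (Sum.elim (fun b => (v b).1) fun _ => y.1) fun i => (x i).1) ∘
          (Fin.snoc (α := fun _ => (β ⊕ Unit) ⊕ Fin k) .inr (.inl (.inr ()))) =
        Fin.snoc (α := fun _ => M) (fun i => (x i).1) y.1 := by
      ext i
      induction i using Fin.lastCases with
      | last => simp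
      | cast i => simp
    constructor
    · rintro ⟨x, hx, hf⟩
      obtain ⟨x, rfl⟩ : ∃ x' : Fin k → Γ.Dom M, x = fun i => (x' i).1 :=
        ⟨fun i => ⟨x i, (hx i).1⟩, rfl⟩
      rw [hfn, hc.2.2.1] at hf
      rw [← hf]
      congr 1
      ext i
      exact (hrel x i).1 (hx i).2
    · intro h
      choose x hx using fun i => hc.1 ((ts i).realize (c ∘ v))
      refine ⟨fun i => (x i).1, fun i => ⟨(x i).2, (hrel x i).2 (hx i).symm⟩, ?_⟩
      rw [hfn, hc.2.2.1]
      simpa only [hx] using h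

/-- Surjectivity matches quantifiers over `N` with quantifiers over the domain. An equation becomes
the existence of one element that represents both sides. -/
lemma realize_translateFormula (hc : Γ.IsCoordinateMap c) (v : α → Γ.Dom M) :
    ∀ {n : ℕ} (φ : L'.BoundedFormula α n) (xs : Fin n → Γ.Dom M),
      (Γ.translateFormula φ).Realize (Sum.elim (fun a => (v a).1) fun i => (xs i).1) ↔
        φ.Realize (c ∘ v) (c ∘ xs)
  | _, .falsum, _ => Iff.rfl
  | n, .equal s t, xs => by
    have hw (x : Γ.Dom M) (t : L'.Term (α ⊕ Fin n)) : (Γ.termGraph t).Realize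
        (Sum.elim (Sum.elim (fun a => (v a).1) fun i => (xs i).1) fun _ : Unit => x.1) ↔
          t.realize (Sum.elim (c ∘ v) (c ∘ xs)) = c x := by
      have := realize_termGraph hc (Sum.elim v xs) t x
      rw [Sum.comp_elim] at this
      rw [← this]
      congr! 2
      ext (a | i) <;> rfl
    simp only [translateFormula, Formula.realize_iExs, Formula.realize_inf, realize_inst,
      comp_vec_one]
    change _ ↔ s.realize (Sum.elim (c ∘ v) (c ∘ xs)) = t.realize (Sum.elim (c ∘ v) (c ∘ xs))
    constructor
    · rintro ⟨x, ⟨hx, hs⟩, ht⟩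
      rw [show x = fun _ => (⟨x (), hx⟩ : Γ.Dom M).1 from rfl, hw] at hs ht
      rw [hs, ht]
    · intro h
      obtain ⟨x, hx⟩ := hc.1 (s.realize (Sum.elim (c ∘ v) (c ∘ xs)))
      exact ⟨fun _ => x.1, ⟨x.2, (hw x s).2 hx.symm⟩, (hw x t).2 (by rw [← h, hx])⟩
  | n, .rel (l := k) R ts, xs => by
    have hw (x : Fin k → Γ.Dom M) (j : Fin k) : (Γ.termGraph (ts j)).Realize
        ((Sum.elim (Sum.elim (fun a => (v a).1) fun i => (xs i).1) fun i => (x i).1) ∘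
          Sum.elim .inl fun _ => .inr j) ↔
          (ts j).realize (Sum.elim (c ∘ v) (c ∘ xs)) = c (x j) := by
      have := realize_termGraph hc (Sum.elim v xs) (ts j) (x j)
      rw [Sum.comp_elim] at this
      rw [← this]
      congr! 1
      ext ((a | i) | u) <;> rfl
    simp only [translateFormula, Formula.realize_iExs, Formula.realize_inf, Formula.realize_iInf,
      realize_inst, comp_vec_one, Formula.realize_relabel, Sum.elim_comp_inr]
    change _ ↔ Structure.RelMap R fun i => (ts i).realize (Sum.elim (c ∘ v) (c ∘ xs))
    constructor
    · rintro ⟨x, hx, hR⟩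
      obtain ⟨x, rfl⟩ : ∃ x' : Fin _ → Γ.Dom M, x = fun i => (x' i).1 :=
        ⟨fun i => ⟨x i, (hx i).1⟩, rfl⟩
      rw [hc.2.2.2] at hR
      convert hR using 2 with i
      exact (hw x i).1 (hx i).2
    · intro h
      choose x hx using fun i => hc.1 ((ts i).realize (Sum.elim (c ∘ v) (c ∘ xs)))
      refine ⟨fun i => (x i).1, fun i => ⟨(x i).2, (hw x i).2 (hx i).symm⟩, ?_⟩
      rw [hc.2.2.2]
      simpa only [hx] using h
  | _, .imp φ ψ, xs => by
    rw [translateFormula, Formula.realize_imp, BoundedFormula.realize_imp,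
      realize_translateFormula hc v φ xs, realize_translateFormula hc v ψ xs]
  | n, .all φ, xs => by
    have hw (x : Γ.Dom M) : (Γ.translateFormula φ).Realize
        ((Sum.elim (Sum.elim (fun a => (v a).1) fun i => (xs i).1) fun _ : Unit => x.1) ∘
          Sum.elim (fun a => .inl (.inl a))
            (Fin.snoc (α := fun _ => (α ⊕ Fin n) ⊕ Unit) (fun i => .inl (.inr i)) (.inr ()))) ↔
        φ.Realize (c ∘ v) (Fin.snoc (α := fun _ => N) (c ∘ xs) (c x)) := by
      have := realize_translateFormula hc v φ (Fin.snoc (α := fun _ => Γ.Dom M) xs x)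
      rw [Fin.comp_snoc] at this
      rw [← this]
      congr! 1
      ext (a | i)
      · rfl
      · induction i using Fin.lastCases with
        | last => simp
        | cast i => simp
    simp only [translateFormula, Formula.realize_iAlls, Formula.realize_imp, realize_inst, comp_vec_one,
      Formula.realize_relabel, BoundedFormula.realize_all]
    constructor
    · intro h y
      obtain ⟨x, rfl⟩ := hc.1 y
      exact (hw x).1 (h (fun _ => x.1) x.2)
    · intro h x hx
      exact (hw ⟨x (), hx⟩).2 (h _)

lemma realize_translate (hc : Γ.IsCoordinateMap c) (σ : L'.Sentence) :
    M ⊨ Γ.translate σ ↔ N ⊨ σ := by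
  have := realize_translateFormula hc Empty.elim σ Fin.elim0
  rw [Sentence.Realize, translate, Formula.realize_relabel]
  change _ ↔ BoundedFormula.Realize σ default default
  rw [Subsingleton.elim (default : Empty → N) (c ∘ Empty.elim),
    Subsingleton.elim (default : Fin 0 → N) (c ∘ Fin.elim0), ← this]
  congr! 1
  ext (a | i)
  · exact a.elim
  · exact i.elim0

end Interpretation

end eqFree

/-! ### Absence of equality from the formulas of the interpretation. -/

section eqFreeFormulas

variable {n : ℕ} (x y z u : Fin n)

lemma eqFree_ex' {φ : Fin (n + 1) → Fml (n + 1)} : EqFree (ex φ) ↔ EqFree (φ (Fin.last n)) :=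
  eqFree_ex

lemma eqFree_all' {φ : Fin (n + 1) → Fml (n + 1)} : EqFree (all φ) ↔ EqFree (φ (Fin.last n)) :=
  Iff.rfl

lemma eqFree_ind : EqFree (ind x y) := trivial

lemma eqFree_le : EqFree (le x y) := ⟨trivial, trivial⟩

lemma eqFree_joint : EqFree (joint x y z) := by
  simp [joint, eqFree_inf, eqFree_all', eqFree_imp, eqFree_le]

lemma eqFree_leJoint : EqFree (leJoint x y z) := by
  simp [leJoint, eqFree_inf, eqFree_ex', eqFree_joint, eqFree_le]

lemma eqFree_leJoint₃ : EqFree (leJoint₃ x y z u) := by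
  simp [leJoint₃, eqFree_inf, eqFree_ex', eqFree_joint, eqFree_leJoint]

lemma eqFree_ind₃ : EqFree (ind₃ x y z) := by
  simp [ind₃, eqFree_inf, eqFree_ex', eqFree_joint, eqFree_ind]

lemma eqFree_triple : EqFree (triple x y z) := by
  simp [triple, eqFree_inf, eqFree_leJoint, eqFree_ind]

lemma eqFree_unif : EqFree (unif x) := by
  simp [unif, eqFree_ex', eqFree_triple]

lemma eqFree_lt : EqFree (lt x y) := by
  simp [lt, eqFree_inf, eqFree_not, eqFree_le]

lemma eqFree_cardLE : ∀ (k : ℕ) {n : ℕ} (x : Fin n), EqFree (cardLE k x)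
  | 0, _, _ => trivial
  | 1, _, _ => trivial
  | k + 2, _, _ => ⟨eqFree_lt _ _, eqFree_cardLE (k + 1) _⟩

lemma eqFree_cardEq (k : ℕ) : EqFree (cardEq k x) := by
  simp [cardEq, eqFree_inf, eqFree_not, eqFree_cardLE]

lemma eqFree_ueq : EqFree (ueq x y) := by
  simp [ueq, eqFree_inf, eqFree_ex', eqFree_triple]

lemma eqFree_ueqConst (k : ℕ) : EqFree (ueqConst k x) := by
  simp [ueqConst, eqFree_inf, eqFree_unif, eqFree_cardEq]

lemma eqFree_uprod : EqFree (uprod x y z) := by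
  simp [uprod, eqFree_inf, eqFree_ex', eqFree_ueq, eqFree_ind, eqFree_joint]

lemma eqFree_ule : EqFree (ule x y) := by
  simp [ule, eqFree_inf, eqFree_ex', eqFree_ueq, eqFree_uprod, eqFree_leJoint]

lemma eqFree_ult : EqFree (ult x y) := by
  simp [ult, eqFree_not, eqFree_ule]

lemma eqFree_smi : EqFree (smi x y) := by
  simp [smi, equiv, const, eqFree_sup, eqFree_inf, eqFree_all', eqFree_imp, eqFree_not, eqFree_ex',
    eqFree_le, eqFree_ind, eqFree_cardEq, eqFree_cardLE, eqFree_leJoint]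

lemma eqFree_smiJoint : EqFree (smiJoint x y z) := by
  simp [smiJoint, eqFree_inf, eqFree_ex', eqFree_joint, eqFree_smi]

lemma eqFree_frac : EqFree (frac x y z u) := by
  simp [frac, eqFree_sup, eqFree_inf, eqFree_all', eqFree_imp, eqFree_not, eqFree_ex', eqFree_le,
    eqFree_cardEq, eqFree_ueqConst, eqFree_uprod, eqFree_ueq, eqFree_unif, eqFree_ind₃,
    eqFree_leJoint₃, eqFree_smi, eqFree_smiJoint]

lemma eqFree_usum : EqFree (usum x y z) := by
  simp [usum, eqFree_ex', eqFree_frac]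

lemma eqFree_is0 : EqFree (is0 x) := by
  simp [is0, const, eqFree_ex', eqFree_inf, eqFree_not, eqFree_ueqConst, eqFree_ind, eqFree_lt]

lemma eqFree_isnat : EqFree (isnat x) := by
  simp [isnat, eqFree_sup, eqFree_is0, eqFree_unif]

lemma eqFree_natEq : EqFree (natEq x y) := by
  simp [natEq, eqFree_sup, eqFree_inf, eqFree_is0, eqFree_ueq]

lemma eqFree_natAdd : EqFree (natAdd x y z) := by
  simp [natAdd, eqFree_sup, eqFree_inf, eqFree_is0, eqFree_isnat, eqFree_natEq, eqFree_usum]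

lemma eqFree_natMul : EqFree (natMul x y z) := by
  simp [natMul, eqFree_sup, eqFree_inf, eqFree_is0, eqFree_isnat, eqFree_uprod]

lemma eqFree_natLt : EqFree (natLt x y) := by
  simp [natLt, eqFree_sup, eqFree_inf, eqFree_is0, eqFree_unif, eqFree_ult]

end eqFreeFormulas

lemma isEqFree_arithInterp : arithInterp.IsEqFree := by
  refine ⟨eqFree_isnat _, eqFree_natEq _ _, ?_, ?_⟩
  · intro k f
    cases f
    · exact eqFree_natAdd _ _ _
    · exact eqFree_natMul _ _ _
  · intro k R
    cases R
    exact eqFree_natLt _ _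

/-! ## Arithmetical definability of partial recursive functions -/

/-- Arithmetically definable predicates on tuples of natural numbers. -/
def ADef {α : Type} (p : (α → ℕ) → Prop) : Prop := (∅ : Set ℕ).Definable arithLang {v | p v}

/-- Arithmetically definable functions on tuples of natural numbers. -/
def AFun {α : Type} (f : (α → ℕ) → ℕ) : Prop := (∅ : Set ℕ).DefinableFun arithLang f

/-! ### Closure properties of arithmetical definability. -/

section definability

variable {α β : Type} {p q : (α → ℕ) → Prop} {f g : (α → ℕ) → ℕ}

lemma ADef.congr (h : ADef p) (hpq : ∀ v, q v ↔ p v) : ADef q := by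
  rwa [show q = p from funext fun v => propext (hpq v)]

lemma ADef.not (h : ADef p) : ADef fun v => ¬ p v := Set.Definable.compl h

lemma ADef.and (h : ADef p) (h' : ADef q) : ADef fun v => p v ∧ q v := Set.Definable.inter h h'

lemma ADef.imp (h : ADef p) (h' : ADef q) : ADef fun v => p v → q v :=
  (h.and h'.not).not.congr fun v => by tauto

lemma ADef.relabel (h : ADef p) (e : α → β) : ADef fun w : β → ℕ => p fun a => w (e a) :=
  Set.Definable.preimage_comp e h

/-- Passing from `α` to `Option α` adds one variable, `none`, to the context; this is the variable
that gets bound. -/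
lemma ADef.ex {r : (Option α → ℕ) → Prop} (h : ADef r) :
    ADef fun v : α → ℕ => ∃ x, r fun o => o.elim x v := by
  have h1 := Set.Definable.exists_of_finite (β := Unit)
    (h.relabel (β := α ⊕ Unit) fun o => o.elim (.inr ()) .inl)
  refine ADef.congr h1 fun v => ?_
  have (x : ℕ) (u : Unit → ℕ) (hu : u () = x) : (fun o : Option α => o.elim x v) =
      fun o => Sum.elim v u (o.elim (.inr ()) .inl) := by
    ext o
    cases o
    exacts [hu.symm, rfl]
  constructor
  · rintro ⟨x, hx⟩
    refine ⟨fun _ => x, ?_⟩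
    rwa [this x (fun _ => x) rfl] at hx
  · rintro ⟨u, hu⟩
    refine ⟨u (), ?_⟩
    rwa [this (u ()) u rfl]

lemma ADef.all {r : (Option α → ℕ) → Prop} (h : ADef r) :
    ADef fun v : α → ℕ => ∀ x, r fun o => o.elim x v :=
  h.not.ex.not.congr fun v => by simp

lemma AFun.of_graph (h : ADef fun w : Option α → ℕ => w none = f fun a => w (some a)) :
    AFun f :=
  ADef.congr h fun _ => eq_comm

lemma AFun.relabel (h : AFun f) (e : α → β) : AFun fun w : β → ℕ => f fun a => w (e a) := by
  refine AFun.of_graph ?_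
  have := ADef.relabel (p := fun w : Option α → ℕ => f (fun a => w (some a)) = w none) h
    (Option.map e)
  exact this.congr fun v => eq_comm

lemma AFun.some (h : AFun f) : AFun fun w : Option α → ℕ => f fun a => w (some a) :=
  h.relabel Option.some

lemma AFun.proj (i : α) : AFun fun v : α → ℕ => v i := Set.DefinableFun.proj arithLang

lemma ADef.eq (hf : AFun f) (hg : AFun g) : ADef fun v => f v = g v :=
  Set.DefinableFun.ofPred_eq hf hg

lemma definableMap_pair (hf : AFun f) (hg : AFun g) :
    (∅ : Set ℕ).DefinableMap arithLang fun v => ![f v, g v] := by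
  intro i
  fin_cases i
  exacts [hf, hg]

lemma ADef.lt (hf : AFun f) (hg : AFun g) : ADef fun v => f v < g v := by
  have h : (∅ : Set ℕ).Definable arithLang {w : Fin 2 → ℕ | w 0 < w 1} :=
    (Set.empty_definable_iff (L := arithLang) (M := ℕ)).2 ⟨Relations.formula (L := arithLang) ArithRel.lt fun i => Term.var i, by
      ext w
      exact Iff.rfl⟩
  exact h.preimage_map (definableMap_pair hf hg)

lemma AFun.add (hf : AFun f) (hg : AFun g) : AFun fun v => f v + g v :=
  (Set.DefinableFun.fun_symbol (L := arithLang) (M := ℕ) ArithFun.add).comp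
    (definableMap_pair hf hg)

lemma AFun.mul (hf : AFun f) (hg : AFun g) : AFun fun v => f v * g v :=
  (Set.DefinableFun.fun_symbol (L := arithLang) (M := ℕ) ArithFun.mul).comp
    (definableMap_pair hf hg)

/-- The language has no constants: `0` is the solution of `y + y = y`, and `1` is the solution of `y
* y = y` that is not `0`. -/
lemma AFun.const (n : ℕ) : AFun fun _ : α → ℕ => n := by
  induction n with
  | zero =>
    refine AFun.of_graph ((ADef.eq ((AFun.proj none).add (AFun.proj none))
      (AFun.proj none)).congr fun v => ?_)
    omega
  | succ n ih =>
    refine ih.add (AFun.of_graph ?_)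
    refine ADef.congr ((ADef.eq ((AFun.proj none).mul (AFun.proj none)) (AFun.proj none)).and
      (ADef.eq ((AFun.proj none).add (AFun.proj none)) (AFun.proj none)).not) fun v => ?_
    generalize v none = y
    constructor
    · rintro rfl
      simp
    · rintro ⟨h1, h2⟩
      have hy : 0 < y := by omega
      exact Nat.eq_of_mul_eq_mul_left hy (by rw [h1, mul_one])

lemma AFun.pair (hf : AFun f) (hg : AFun g) : AFun fun v => Nat.pair (f v) (g v) :=
  Set.DefinableFun.ite (p := fun v => f v < g v) (ADef.lt hf hg) ((hg.mul hg).add hf)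
    (((hf.mul hf).add hf).add hg)

lemma AFun.unpair_fst (hf : AFun f) : AFun fun v => (Nat.unpair (f v)).1 := by
  refine AFun.of_graph (ADef.congr (ADef.ex (ADef.eq
    ((AFun.proj (Option.some none)).pair (AFun.proj none)) (hf.some.some))) fun w => ?_)
  change _ ↔ ∃ y, Nat.pair (w none) y = f fun a => w (Option.some a)
  constructor
  · intro h
    exact ⟨(Nat.unpair (f fun a => w (Option.some a))).2, by rw [h, Nat.pair_unpair]⟩
  · rintro ⟨y, hy⟩
    rw [← hy, Nat.unpair_pair]

lemma AFun.unpair_snd (hf : AFun f) : AFun fun v => (Nat.unpair (f v)).2 := by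
  refine AFun.of_graph (ADef.congr (ADef.ex (ADef.eq
    ((AFun.proj none).pair (AFun.proj (Option.some none))) (hf.some.some))) fun w => ?_)
  change _ ↔ ∃ y, Nat.pair y (w none) = f fun a => w (Option.some a)
  constructor
  · intro h
    exact ⟨(Nat.unpair (f fun a => w (Option.some a))).1, by rw [h, Nat.pair_unpair]⟩
  · rintro ⟨y, hy⟩
    rw [← hy, Nat.unpair_pair]

/-- Division with remainder is expressible by a quotient; the successor keeps the modulus positive
and is the form in which Gödel's β-function uses it. -/
lemma AFun.mod_succ (hf : AFun f) (hg : AFun g) : AFun fun v => f v % (g v + 1) := by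
  refine AFun.of_graph (ADef.congr ((ADef.lt (AFun.proj none) (hg.some.add (.const 1))).and
    (ADef.ex (ADef.eq hf.some.some (((hg.some.some.add (.const 1)).mul (AFun.proj none)).add
      (AFun.proj (Option.some none)))))) fun w => ?_)
  change _ ↔ _ ∧ ∃ x, (f fun a => w (Option.some a)) =
    ((g fun a => w (Option.some a)) + 1) * x + w none
  constructor
  · intro h
    rw [h]
    exact ⟨Nat.mod_lt _ (Nat.succ_pos _), _, (Nat.div_add_mod _ _).symm⟩
  · rintro ⟨h, x, hx⟩
    rw [hx, Nat.mul_add_mod, Nat.mod_eq_of_lt h]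

lemma AFun.beta (hf : AFun f) (hg : AFun g) : AFun fun v => Nat.beta (f v) (g v) :=
  hf.unpair_fst.mod_succ ((hg.add (.const 1)).mul hf.unpair_snd)

end definability

/-! ### Computation histories coded by single numbers. -/

lemma exists_beta (h : ℕ → ℕ) (n : ℕ) : ∃ s, ∀ i ≤ n, Nat.beta s i = h i := by
  refine ⟨Nat.unbeta (List.ofFn fun i : Fin (n + 1) => h i), fun i hi => ?_⟩
  have := Nat.beta_unbeta_coe (List.ofFn fun i : Fin (n + 1) => h i)
    ⟨i, by simpa [Nat.lt_succ_iff] using hi⟩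
  rw [this]
  exact List.getElem_ofFn _

/-- A recursion yields `m` exactly when a finite history of intermediate values ends in `m`. Coding
the history by one number `s` turns the recursion into a first-order statement. -/
lemma mem_rec_iff (x : Part ℕ) (G : ℕ → ℕ → Part ℕ) (n m : ℕ) :
    m ∈ (Nat.rec x (fun y IH => IH.bind fun i => G y i) n : Part ℕ) ↔
      ∃ s, (Nat.beta s 0 ∈ x ∧ ∀ y, y < n → Nat.beta s (y + 1) ∈ G y (Nat.beta s y)) ∧
        Nat.beta s n = m := by
  have key : m ∈ (Nat.rec x (fun y IH => IH.bind fun i => G y i) n : Part ℕ) ↔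
      ∃ h : ℕ → ℕ, (h 0 ∈ x ∧ ∀ y, y < n → h (y + 1) ∈ G y (h y)) ∧ h n = m := by
    induction n generalizing m with
    | zero => exact ⟨fun h => ⟨fun _ => m, ⟨h, by simp⟩, rfl⟩, fun ⟨h, ⟨h0, _⟩, h1⟩ => h1 ▸ h0⟩
    | succ n ih =>
      rw [Part.mem_bind_iff]
      constructor
      · rintro ⟨i, hi, hm⟩
        obtain ⟨h, ⟨h0, h1⟩, rfl⟩ := (ih i).1 hi
        refine ⟨fun k => if k ≤ n then h k else m, ⟨by simpa using h0, fun y hy => ?_⟩, by simp⟩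
        rcases Nat.lt_succ_iff_lt_or_eq.1 hy with hy | rfl
        · have h2 : y + 1 ≤ n := hy
          have h3 : y ≤ n := hy.le
          simpa [h2, h3] using h1 y hy
        · simpa using hm
      · rintro ⟨h, ⟨h0, h1⟩, rfl⟩
        exact ⟨h n, (ih _).2 ⟨h, ⟨h0, fun y hy => h1 y (hy.trans n.lt_succ_self)⟩, rfl⟩,
          h1 n n.lt_succ_self⟩
  rw [key]
  constructor
  · rintro ⟨h, ⟨h0, h1⟩, rfl⟩
    obtain ⟨s, hs⟩ := exists_beta h n
    refine ⟨s, ⟨by rwa [hs 0 n.zero_le], fun y hy => ?_⟩, hs n le_rfl⟩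
    rw [hs _ hy, hs _ hy.le]
    exact h1 y hy
  · rintro ⟨s, h, hm⟩
    exact ⟨Nat.beta s, h, hm⟩

/-- The graph of a partial recursive function is arithmetically definable. -/
lemma aDef_of_partrec {F : ℕ →. ℕ} (hF : Nat.Partrec F) :
    ∀ {α : Type} {f g : (α → ℕ) → ℕ}, AFun f → AFun g → ADef fun v => g v ∈ F (f v) := by
  -- Arbitrary definable arguments `f`, `g` in arbitrary contexts are kept in the induction, so that
  -- the hypotheses apply under the quantifiers introduced by pairing, composition, recursion and
  -- search.
  induction hF with
  | zero =>
    intro α f g _ hg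
    exact (ADef.eq hg (.const 0)).congr fun v => Part.mem_some_iff
  | succ =>
    intro α f g hf hg
    exact (ADef.eq hg (hf.add (.const 1))).congr fun v => Part.mem_some_iff
  | left =>
    intro α f g hf hg
    exact (ADef.eq hg hf.unpair_fst).congr fun v => Part.mem_some_iff
  | right =>
    intro α f g hf hg
    exact (ADef.eq hg hf.unpair_snd).congr fun v => Part.mem_some_iff
  | pair hF hG ihF ihG =>
    intro α f g hf hg
    refine ADef.congr (ADef.ex (ADef.ex ((ihF hf.some.some (AFun.proj (some none))).and
      ((ihG hf.some.some (AFun.proj none)).and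
        (ADef.eq ((AFun.proj (some none)).pair (AFun.proj none)) hg.some.some))))) fun v => ?_
    simp [Seq.seq, Part.mem_bind_iff, eq_comm]
  | comp hF hG ihF ihG =>
    intro α f g hf hg
    refine ADef.congr (ADef.ex ((ihG hf.some (AFun.proj none)).and
      (ihF (AFun.proj none) hg.some))) fun v => ?_
    exact Part.mem_bind_iff
  | prec hF hG ihF ihG =>
    intro α f g hf hg
    refine ADef.congr (ADef.ex (ADef.and (ADef.and
      (ihF hf.unpair_fst.some ((AFun.proj none).beta (.const 0)))
      (ADef.all (ADef.imp (ADef.lt (AFun.proj none) hf.unpair_snd.some.some)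
        (ihG (hf.unpair_fst.some.some.pair ((AFun.proj none).pair
          ((AFun.proj (some none)).beta (AFun.proj none))))
          ((AFun.proj (some none)).beta ((AFun.proj none).add (.const 1)))))))
      (ADef.eq ((AFun.proj none).beta hf.unpair_snd.some) hg.some))) fun v => ?_
    exact mem_rec_iff _ _ _ _
  | rfind hF ihF =>
    intro α f g hf hg
    refine ADef.congr (ADef.and (ihF (hf.pair hg) (.const 0)) (ADef.all (ADef.imp
      (ADef.lt (AFun.proj none) hg.some) (ADef.ex (ADef.and
        (ihF (hf.some.some.pair (AFun.proj (some none))) (AFun.proj none))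
        (ADef.eq (AFun.proj none) (.const 0)).not))))) fun v => ?_
    refine Nat.mem_rfind.trans ?_
    simp [Part.mem_map_iff]

/-! ## Gödel numbers -/

section godel

variable {n : ℕ}

lemma varIndex_injective :
    Function.Injective (varIndex : indepLang.Term (Empty ⊕ Fin n) → ℕ)
  | .var (.inr i), .var (.inr j), h => by rw [Fin.ext (show (i : ℕ) = j from h)]
  | .var (.inl e), _, _ => e.elim
  | _, .var (.inl e), _ => e.elim
  | .func f _, _, _ => nomatch f
  | _, .func f _, _ => nomatch f

lemma godelNumber_injective : ∀ {n : ℕ} (φ ψ : Fml n), godelNumber φ = godelNumber ψ → φ = ψ := by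
  intro n φ
  induction φ with
  | falsum =>
    intro ψ h
    cases ψ with
    | falsum => rfl
    | rel R ts => cases R; simp [godelNumber, Nat.pair_eq_pair] at h
    | _ => simp [godelNumber, Nat.pair_eq_pair] at h
  | equal s t =>
    intro ψ h
    cases ψ with
    | equal s' t' =>
      simp only [godelNumber, Nat.pair_eq_pair, true_and] at h
      rw [varIndex_injective h.1, varIndex_injective h.2]
    | rel R ts => cases R; simp [godelNumber, Nat.pair_eq_pair] at h
    | _ => simp [godelNumber, Nat.pair_eq_pair] at h
  | rel R ts =>
    intro ψ h
    cases R
    cases ψ with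
    | rel R' ts' =>
      cases R'
      simp only [godelNumber, Nat.pair_eq_pair, true_and] at h
      have : ts = ts' := by
        funext i
        fin_cases i
        exacts [varIndex_injective h.1, varIndex_injective h.2]
      rw [this]
    | _ => simp [godelNumber, Nat.pair_eq_pair] at h
  | imp φ₁ φ₂ ih₁ ih₂ =>
    intro ψ h
    cases ψ with
    | imp ψ₁ ψ₂ =>
      simp only [godelNumber, Nat.pair_eq_pair, true_and] at h
      rw [ih₁ _ h.1, ih₂ _ h.2]
    | rel R ts => cases R; simp [godelNumber, Nat.pair_eq_pair] at h
    | _ => simp [godelNumber, Nat.pair_eq_pair] at h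
  | all φ ih =>
    intro ψ h
    cases ψ with
    | all ψ =>
      simp only [godelNumber, Nat.pair_eq_pair, true_and] at h
      rw [ih _ h]
    | rel R ts => cases R; simp [godelNumber, Nat.pair_eq_pair] at h
    | _ => simp [godelNumber, Nat.pair_eq_pair] at h

lemma godelNumber_mem_iff {T : Set indepLang.Sentence} {σ : indepLang.Sentence} :
    godelNumber σ ∈ godelNumbers T ↔ σ ∈ T :=
  ⟨fun ⟨_, hτ, h⟩ => godelNumber_injective _ _ h ▸ hτ, fun h => ⟨σ, h, rfl⟩⟩

/-- The Gödel number of an implication. -/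
def impCode (a b : ℕ) : ℕ := Nat.pair 3 (Nat.pair a b)

/-- The Gödel number of a universally quantified formula. -/
def allCode (a : ℕ) : ℕ := Nat.pair 4 a

/-- The Gödel number of a negation. -/
def notCode (a : ℕ) : ℕ := impCode a (Nat.pair 0 0)

/-- The Gödel number of a conjunction. -/
def infCode (a b : ℕ) : ℕ := notCode (impCode a (notCode b))

/-- The Gödel number of `ind`. -/
def indCode (x y : ℕ) : ℕ := Nat.pair 2 (Nat.pair x y)

/-- The Gödel number of `le` in a context of `n` variables. -/
def leCode (n x y : ℕ) : ℕ := allCode (impCode (indCode n y) (indCode n x))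

/-- The Gödel number of `lt` in a context of `n` variables. -/
def ltCode (n x y : ℕ) : ℕ := infCode (leCode n x y) (notCode (leCode n y x))

/-- The Gödel number of `cardLE (j + 1)` for the last of `N - j + 1` variables. -/
def cardCode (N j : ℕ) : ℕ :=
  Nat.rec (indCode N N)
    (fun j c => allCode (impCode (ltCode (N - j + 1) (N - j) (N - (j + 1))) c)) j

lemma godelNumber_imp (φ ψ : Fml n) :
    godelNumber (φ.imp ψ) = impCode (godelNumber φ) (godelNumber ψ) := by
  simp [godelNumber, impCode]

lemma godelNumber_all (φ : Fml (n + 1)) : godelNumber φ.all = allCode (godelNumber φ) := by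
  simp [godelNumber, allCode]

lemma godelNumber_not (φ : Fml n) : godelNumber φ.not = notCode (godelNumber φ) :=
  godelNumber_imp φ ⊥

lemma godelNumber_inf (φ ψ : Fml n) :
    godelNumber (φ ⊓ ψ) = infCode (godelNumber φ) (godelNumber ψ) := by
  rw [infCode, ← godelNumber_not, ← godelNumber_imp, ← godelNumber_not]
  rfl

lemma godelNumber_ind (x y : Fin n) : godelNumber (ind x y) = indCode x y := rfl

lemma godelNumber_le (x y : Fin n) : godelNumber (le x y) = leCode n x y := by
  rw [le, all, godelNumber_all, godelNumber_imp, godelNumber_ind, godelNumber_ind]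
  rfl

lemma godelNumber_lt (x y : Fin n) : godelNumber (lt x y) = ltCode n x y := by
  rw [lt, godelNumber_inf, godelNumber_not, godelNumber_le, godelNumber_le]
  rfl

/-- Each unfolding binds one more variable and lowers the bound by one, so `n + j` stays fixed.
Taking it as the parameter `N` makes the code a recursion on `j` alone. -/
lemma godelNumber_cardLE (j : ℕ) :
    ∀ n : ℕ, godelNumber (cardLE (j + 1) (Fin.last n)) = cardCode (n + j) j := by
  induction j with
  | zero => intro n; rfl
  | succ j ih =>
    intro n
    rw [cardLE, all, godelNumber_all, godelNumber_imp, godelNumber_lt, ih]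
    have h1 : n + (j + 1) - j = n + 1 := by omega
    have h2 : n + (j + 1) - (j + 1) = n := by omega
    have h3 : n + 1 + j = n + (j + 1) := by omega
    rw [h3]
    change _ = allCode (impCode (ltCode (n + (j + 1) - j + 1) (n + (j + 1) - j)
      (n + (j + 1) - (j + 1))) (cardCode (n + (j + 1)) j))
    rw [h1, h2]
    rfl

/-- The Gödel number of the statement that the formula with Gödel number `m` holds for the random
variables that represent the number `m + 2`, where `c` is the Gödel number of `unif`. -/
def diagCode (c m : ℕ) : ℕ :=
  allCode (impCode (infCode c
    (infCode (cardCode (m + 1) (m + 1)) (notCode (cardCode m m)))) m)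

/-- With the offset 2, both cardinality bounds in `ueqConst`, `m + 2` and `m + 1`, are positive, so
`cardCode` describes them uniformly and `cardLE 0` never occurs. -/
lemma godelNumber_diag (ψ : Fml 1) :
    godelNumber ((ueqConst (godelNumber ψ + 2) (0 : Fin 1)).imp ψ).all =
      diagCode (godelNumber (unif (0 : Fin 1))) (godelNumber ψ) := by
  have h (j : ℕ) : godelNumber (cardLE (j + 1) (0 : Fin 1)) = cardCode j j :=
    (godelNumber_cardLE j 0).trans (congrArg (fun i => cardCode i j) (zero_add j))
  rw [godelNumber_all, godelNumber_imp, ueqConst, godelNumber_inf, cardEq, godelNumber_inf,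
    godelNumber_not, Nat.add_sub_assoc (by norm_num), h, h, diagCode]

/-! ### Primitive recursiveness of the codes. -/

section primrec

variable {α : Type} [Primcodable α] {f g h : α → ℕ}

lemma primrec_impCode (hf : Primrec f) (hg : Primrec g) : Primrec fun a => impCode (f a) (g a) :=
  Primrec₂.natPair.comp (.const 3) (Primrec₂.natPair.comp hf hg)

lemma primrec_allCode (hf : Primrec f) : Primrec fun a => allCode (f a) :=
  Primrec₂.natPair.comp (.const 4) hf

lemma primrec_notCode (hf : Primrec f) : Primrec fun a => notCode (f a) :=
  primrec_impCode hf (.const _)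

lemma primrec_infCode (hf : Primrec f) (hg : Primrec g) : Primrec fun a => infCode (f a) (g a) :=
  primrec_notCode (primrec_impCode hf (primrec_notCode hg))

lemma primrec_indCode (hf : Primrec f) (hg : Primrec g) : Primrec fun a => indCode (f a) (g a) :=
  Primrec₂.natPair.comp (.const 2) (Primrec₂.natPair.comp hf hg)

lemma primrec_leCode (hf : Primrec f) (hg : Primrec g) (hh : Primrec h) :
    Primrec fun a => leCode (f a) (g a) (h a) :=
  primrec_allCode (primrec_impCode (primrec_indCode hf hh) (primrec_indCode hf hg))

lemma primrec_ltCode (hf : Primrec f) (hg : Primrec g) (hh : Primrec h) :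
    Primrec fun a => ltCode (f a) (g a) (h a) :=
  primrec_infCode (primrec_leCode hf hg hh) (primrec_notCode (primrec_leCode hf hh hg))

lemma primrec_cardCode : Primrec₂ cardCode := by
  have hN : Primrec fun q : ℕ × (ℕ × ℕ) => q.1 := Primrec.fst
  have hj : Primrec fun q : ℕ × (ℕ × ℕ) => q.2.1 := Primrec.fst.comp Primrec.snd
  have hsub : Primrec fun q : ℕ × (ℕ × ℕ) => q.1 - q.2.1 := Primrec.nat_sub.comp hN hj
  have hsub' : Primrec fun q : ℕ × (ℕ × ℕ) => q.1 - (q.2.1 + 1) :=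
    Primrec.nat_sub.comp hN (Primrec.succ.comp hj)
  exact Primrec.nat_rec (f := fun N => indCode N N)
    (g := fun N q => allCode (impCode (ltCode (N - q.1 + 1) (N - q.1) (N - (q.1 + 1))) q.2))
    (primrec_indCode Primrec.id Primrec.id)
    (primrec_allCode (primrec_impCode (primrec_ltCode (Primrec.succ.comp hsub) hsub hsub')
      (Primrec.snd.comp Primrec.snd)))

lemma primrec_diagCode (c : ℕ) : Primrec (diagCode c) :=
  primrec_allCode (primrec_impCode (primrec_infCode (.const _) (primrec_infCode
    (primrec_cardCode.comp Primrec.succ Primrec.succ)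
    (primrec_notCode (primrec_cardCode.comp Primrec.id Primrec.id)))) Primrec.id)

end primrec

end godel

/-! ## Undefinability and undecidability -/

lemma AFun.of_primrec {F : ℕ → ℕ} (hF : Primrec F) {α : Type} {f : (α → ℕ) → ℕ} (hf : AFun f) :
    AFun fun v => F (f v) :=
  AFun.of_graph ((aDef_of_partrec (Nat.Partrec.of_primrec (Primrec.nat_iff.1 hF)) hf.some
    (AFun.proj none)).congr fun _ => Part.mem_some_iff.symm)

lemma ADef.of_computablePred {p : ℕ → Prop} (hp : ComputablePred p) :
    ADef fun v : Fin 1 → ℕ => p (v 0) := by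
  obtain ⟨_, hp⟩ := hp
  have h1 : Computable fun n => cond (decide (p n)) 1 0 :=
    Computable.cond hp (.const 1) (.const 0)
  have h2 : Nat.Partrec fun n => Part.some (cond (decide (p n)) 1 0) := Partrec.nat_iff.1 h1
  refine (aDef_of_partrec h2 (AFun.proj (0 : Fin 1)) (AFun.const 1)).congr fun v => ?_
  rw [Part.mem_some_iff]
  by_cases h : p (v 0) <;> simp [h]

lemma arithmeticallyDefinable_of_decidable {T : Set indepLang.Sentence} (h : Decidable T) :
    ArithmeticallyDefinable T := ADef.of_computablePred h

/-- Every arithmetical set of numbers is defined, on the random variables that represent numbers,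
by a formula without the equality symbol. -/
lemma exists_eqFree_of_aDef {p : ℕ → Prop} (hp : ADef fun v : Fin 1 → ℕ => p (v 0)) :
    ∃ ψ : Fml 1, EqFree ψ ∧ ∀ (X : RV) (n : ℕ), Represents X n → (Holds ψ ![X] ↔ p n) := by
  obtain ⟨φ, hφ⟩ := Set.empty_definable_iff.1 hp
  refine ⟨BoundedFormula.relabel (n := 1) (Sum.elim Sum.inr Fin.elim0 : Fin 1 ⊕ Fin 0 → Empty ⊕ Fin 1)
    (arithInterp.translateFormula φ),
    (Interpretation.eqFree_translateFormula isEqFree_arithInterp φ).relabel _, fun X n hX => ?_⟩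
  let X' : arithInterp.Dom RV := ⟨X, (holds_isnat ![X] 0).2 ⟨n, hX⟩⟩
  have h := Interpretation.realize_translateFormula isCoordinateMap_value
    (fun _ : Fin 1 => X') φ Fin.elim0
  have hn : value X' = n := (represents_iff_value X' n).1 hX
  have h2 : φ.Realize (fun _ : Fin 1 => n) ↔ p n := by
    have := Set.ext_iff.1 hφ fun _ => n
    exact this.symm
  rw [← h2, ← hn]
  have h3 : BoundedFormula.Realize φ (value ∘ fun _ => X') (value ∘ Fin.elim0) ↔
      φ.Realize (fun _ : Fin 1 => value X') :=
    iff_of_eq (congrArg (BoundedFormula.Realize φ _) (Subsingleton.elim _ _))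
  rw [← h3, ← h, Holds, BoundedFormula.realize_relabel, Formula.Realize]
  refine iff_of_eq (congrArg₂ _ ?_ (Subsingleton.elim _ _))
  ext (i | i)
  · fin_cases i
    rfl
  · exact i.elim0

/-- No set of sentences that agrees with the theory on sentences without the equality symbol is
arithmetically definable. -/
lemma not_arithmeticallyDefinable {T : Set indepLang.Sentence}
    (hT : ∀ σ, EqFree σ → (σ ∈ T ↔ σ ∈ theory)) : ¬ ArithmeticallyDefinable T := by
  intro h
  -- Only the fact that the code of `unif` is a fixed number matters, so it is kept opaque.
  obtain ⟨c, hc⟩ : ∃ c, ∀ ψ : indepLang.BoundedFormula Empty 1,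
      godelNumber ((ueqConst (godelNumber ψ + 2) (0 : Fin 1)).imp ψ).all =
        diagCode c (godelNumber ψ) := ⟨_, godelNumber_diag⟩
  have hmem : ADef fun v : Fin 1 → ℕ => v 0 ∈ godelNumbers T := h
  have hdiag : ADef fun v : Option (Fin 1) → ℕ => ¬ diagCode c (v none) ∈ godelNumbers T := by
    refine ADef.not (Set.Definable.preimage_map (F := fun v => fun _ : Fin 1 => diagCode c (v none))
      (fun _ => AFun.of_primrec (primrec_diagCode c) (AFun.proj none)) hmem)
  -- The number `m + 2` has this property when the diagonal sentence of the formula coded by `m` is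
  -- not in `T`; the offset matches the one in `diagCode`.
  have hp : ADef fun v : Fin 1 → ℕ => ∃ m, v 0 = m + 2 ∧ ¬ diagCode c m ∈ godelNumbers T :=
    ((ADef.eq (AFun.proj (some 0)) ((AFun.proj none).add (.const 2))).and hdiag).ex
  obtain ⟨ψ, hψ, hψp⟩ := exists_eqFree_of_aDef
    (p := fun k => ∃ m, k = m + 2 ∧ ¬ diagCode c m ∈ godelNumbers T) hp
  let σ : indepLang.Sentence := ((ueqConst (godelNumber ψ + 2) (0 : Fin 1)).imp ψ).all
  have hσ : EqFree σ := eqFree_all.2 (eqFree_imp.2 ⟨eqFree_ueqConst _ _, hψ⟩)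
  have h1 : σ ∈ theory ↔ ∀ X : RV, X.IsUnif (godelNumber ψ + 2) → Holds ψ ![X] := by
    refine (holds_all (n := 0) default (fun _ => (ueqConst (godelNumber ψ + 2) 0).imp ψ)).trans ?_
    refine forall_congr' fun X => ?_
    have : (Fin.snoc (α := fun _ => RV) default X : Fin 1 → RV) = ![X] := by
      funext i
      fin_cases i
      rfl
    rw [this, holds_imp, holds_ueqConst]
    rfl
  -- `σ` applies `ψ` to the number representing its own code, and `ψ` denies membership in `T` of
  -- exactly this sentence.
  have h2 : σ ∈ theory ↔ ¬ σ ∈ T := by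
    have hcode : godelNumber σ = diagCode c (godelNumber ψ) := hc ψ
    rw [h1, ← godelNumber_mem_iff (T := T), hcode]
    constructor
    · intro h3
      obtain ⟨X, hX⟩ := exists_represents (godelNumber ψ + 2)
      obtain ⟨m, hm, hm'⟩ := (hψp X _ hX).1 (h3 X ((represents_of_pos (Nat.succ_pos _)).1 hX))
      rwa [Nat.add_right_cancel hm]
    · intro h3 X hX
      exact (hψp X _ (Or.inr hX)).2 ⟨_, rfl, h3⟩
  rw [hT σ hσ] at h2
  exact (iff_not_self h2)

lemma not_arithmeticallyDefinable_theory : ¬ ArithmeticallyDefinable theory :=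
  not_arithmeticallyDefinable fun _ _ => Iff.rfl

lemma not_arithmeticallyDefinable_pureTheory : ¬ ArithmeticallyDefinable pureTheory :=
  not_arithmeticallyDefinable fun _ hσ => and_iff_left hσ

end FOTPI

theorem mainTheorem2 :
    -- uniformity and cardinality
    (∀ X : FOTPI.RV, FOTPI.Holds (FOTPI.unif 0) ![X] ↔ ∃ n : ℕ, X.IsUnif n) ∧
    (∀ (k : ℕ) (X : FOTPI.RV), FOTPI.Holds (FOTPI.cardLE k 0) ![X] ↔ X.card ≤ k) ∧
    (∀ (k : ℕ) (X : FOTPI.RV), FOTPI.Holds (FOTPI.cardEq k 0) ![X] ↔ X.card = k) ∧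
    (∀ (k : ℕ) (X : FOTPI.RV), FOTPI.Holds (FOTPI.ueqConst k 0) ![X] ↔ X.IsUnif k) ∧
    -- equality, product and order of positive integers
    (∀ X Y : FOTPI.RV, FOTPI.Holds (FOTPI.ueq 0 1) ![X, Y] ↔
      ∃ a : ℕ, X.IsUnif a ∧ Y.IsUnif a) ∧
    (∀ X Y Z : FOTPI.RV, FOTPI.Holds (FOTPI.uprod 0 1 2) ![X, Y, Z] ↔
      ∃ a b : ℕ, X.IsUnif a ∧ Y.IsUnif b ∧ Z.IsUnif (a * b)) ∧
    (∀ X Y : FOTPI.RV, FOTPI.Holds (FOTPI.ule 0 1) ![X, Y] ↔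
      ∃ a b : ℕ, X.IsUnif a ∧ Y.IsUnif b ∧ a ≤ b) ∧
    (∀ (X Y : FOTPI.RV) (a b : ℕ), X.IsUnif a → Y.IsUnif b →
      (FOTPI.Holds (FOTPI.ult 0 1) ![X, Y] ↔ a < b)) ∧
    -- single-mass indicators, fractions and sums
    (∀ X Y : FOTPI.RV, FOTPI.Holds (FOTPI.smi 0 1) ![X, Y] ↔ FOTPI.IsSingleMassIndicator X Y) ∧
    (∀ X Y Z U : FOTPI.RV, FOTPI.Holds (FOTPI.frac 0 1 2 3) ![X, Y, Z, U] ↔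
      ∃ a b : ℕ, X.IsUnif a ∧ Y.IsUnif b ∧ Z.IsUnif (a + b) ∧ U.IsBern (a / (a + b)) ∧
        (a = b ∨ FOTPI.FunctionOf U Z)) ∧
    (∀ X Y Z : FOTPI.RV, FOTPI.Holds (FOTPI.usum 0 1 2) ![X, Y, Z] ↔
      ∃ a b : ℕ, X.IsUnif a ∧ Y.IsUnif b ∧ Z.IsUnif (a + b)) ∧
    -- the representation of nonnegative integers
    (∀ X : FOTPI.RV, FOTPI.Holds (FOTPI.is0 0) ![X] ↔ X.IsBern (1 / 3)) ∧
    (∀ X : FOTPI.RV, FOTPI.Holds (FOTPI.isnat 0) ![X] ↔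
      X.IsBern (1 / 3) ∨ ∃ n : ℕ, X.IsUnif n) ∧
    -- the interpretation of true arithmetic, by formulas without the equality symbol
    FOTPI.arithInterp.IsEqFree ∧
    (∃ c : FOTPI.arithInterp.Dom FOTPI.RV → ℕ,
      FOTPI.arithInterp.IsCoordinateMap c ∧
      (∀ X, c X = 0 ↔ FOTPI.RV.IsBern X.1 (1 / 3)) ∧
      (∀ X, ∀ n : ℕ, 0 < n → (c X = n ↔ FOTPI.RV.IsUnif X.1 n))) ∧
    (∀ σ : FOTPI.arithLang.Sentence,
      σ ∈ FOTPI.trueArithmetic ↔ FOTPI.arithInterp.translate σ ∈ FOTPI.theory) ∧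
    -- undecidability and arithmetical undefinability
    ¬ FOTPI.Decidable FOTPI.theory ∧
    ¬ FOTPI.Decidable FOTPI.pureTheory ∧
    ¬ FOTPI.ArithmeticallyDefinable FOTPI.theory ∧
    ¬ FOTPI.ArithmeticallyDefinable FOTPI.pureTheory := by
  refine ⟨fun X => FOTPI.holds_unif ![X] 0, fun k X => FOTPI.holds_cardLE k ![X] 0,
    fun k X => FOTPI.holds_cardEq ![X] k 0, fun k X => FOTPI.holds_ueqConst ![X] k 0,
    fun X Y => FOTPI.holds_ueq ![X, Y] 0 1, fun X Y Z => FOTPI.holds_uprod ![X, Y, Z] 0 1 2,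
    fun X Y => FOTPI.holds_ule ![X, Y] 0 1, fun X Y a b => FOTPI.holds_ult ![X, Y] 0 1,
    fun X Y => (FOTPI.holds_smi ![X, Y] 0 1).trans (FOTPI.isSingleMassIndicator_iff X Y).symm,
    fun X Y Z U => FOTPI.holds_frac ![X, Y, Z, U] 0 1 2 3,
    fun X Y Z => FOTPI.holds_usum ![X, Y, Z] 0 1 2, fun X => FOTPI.holds_is0 ![X] 0,
    fun X => FOTPI.holds_isnat' ![X] 0, FOTPI.isEqFree_arithInterp,
    ⟨FOTPI.value, FOTPI.isCoordinateMap_value, fun X => ?_, fun X n hn => ?_⟩, fun σ => ?_,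
    fun h => FOTPI.not_arithmeticallyDefinable_theory
      (FOTPI.arithmeticallyDefinable_of_decidable h),
    fun h => FOTPI.not_arithmeticallyDefinable_pureTheory
      (FOTPI.arithmeticallyDefinable_of_decidable h),
    FOTPI.not_arithmeticallyDefinable_theory, FOTPI.not_arithmeticallyDefinable_pureTheory⟩
  · rw [← FOTPI.represents_iff_value, FOTPI.represents_zero]
  · rw [← FOTPI.represents_iff_value, FOTPI.represents_of_pos hn]
  · exact (FOTPI.Interpretation.realize_translate FOTPI.isCoordinateMap_value σ).symm
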